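/- Let $\alpha_1,\dots,\alpha_N\in\mathbb Z^n$ be non-zero vectors with nonnegative coordinates which span $\mathbb R^n$, and let $P(\gamma)=\#\{a\in\mathbb Z_{\ge0}^N:\sum a_i\alpha_i=\gamma\}$, $\gamma\in\mathbb Z^n$. Write $\Lambda(S)$ for the closed cone generated by $S$ over the nonnegative scalars and $\Lambda=\Lambda(\alpha_1,\dots,\alpha_N)$. A *closed pointed polyhedral cone* is a subset of $\mathbb R^n$ with non-empty interior given by finitely many homogeneous non-strict rational linear inequalities; its supporting hyperplanes are the hyperplanes spanned by its facets, and a finite set of such cones *subdivides* a region if its union is the region and the interiors are pairwise disjoint. A *quasipolynomial* is an element of the $\mathbb Q$-algebra of functions on $\mathbb Z^n$ generated by the coordinates and the functions $\tau_{M,c,d}$ ($M$ an integer matrix, $c$ an integer vector, $d\ge1$), where $\tau_{M,c,d}(\gamma)=1$ if $M\gamma\equiv c \pmod d$ and $0$ otherwise. $P$ is a quasipolynomial on $C\subset\mathbb R^n$ if it agrees with a quasipolynomial on $C\cap\mathbb Z^n$. *Wall-crossing algorithm.* Start with the one-element list $\{\Lambda(S)\}$, $S$ consisting of $n$ linearly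 independent vectors among the $\alpha_i$. To add a further vector $a=\alpha_i$, first enlarge the list by a subdivision of $\overline{\Lambda(S\cup\{a\})\setminus\Lambda(S)}$. Then replace the cones $C$ of the list, one after another in any order, by subdivisions of $C$ into closed pointed polyhedral cones $C'$ each having a unique choice of exit walls: there are cones $C=c_0,\dots,c_r$ of the current list and hyperplanes $H_0,\dots,H_r$ such that for each $\gamma\in C'$ lying on no supporting hyperplane of a cone of the current list the ray $\gamma-ta$, $t\ge0$, runs successively through $c_0,\dots,c_r$, passes from $c_j$ to $c_{j+1}$ through $H_j$, which is a supporting hyperplane of both (with the two cones on opposite sides), and leaves $c_r$ through its supporting hyperplane $H_r$, which is also a supporting hyperplane of the union of the list. When every cone has been so replaced, the next vector is added, until all of $\alpha_1,\dots,\alpha_N$ have been used. *Partial fraction algorithm.* It works with a list of fractions $p\prod_{i\in I}(1-x^{\beta_i})^{-m_i}$, with $p$ a Laurent polynomial over $\mathbb Q$, $\beta_i=l_i\alpha_i$, $l_i,m_i\ge1$, $I\subset\{1,\dots,N\}$ its support, starting with the single fraction $\prod_{i=1}^N(1-x^{\alpha_i})^{-1}$; initially no fraction is labelled "reduced" or stores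 a linear dependence. While some fraction stores a linear dependence, select one such fraction. If none does, select one not labelled "reduced"; label it "reduced" if its vectors are linearly independent, otherwise choose and store with it a dependence $a_0\beta_{i_0}=\sum_{k=1}^r a_k\beta_{j_k}$ with $i_0,j_1,\dots,j_r\in I$ distinct, $a_0>0$, all $a_k\in\mathbb Z\setminus\{0\}$. A selected fraction with stored dependence is replaced by the $r$ fractions, $k=1,\dots,r$, obtained from it by multiplying $p$ by $$x^{a_1\beta_{j_1}+\dots+a_{k-1}\beta_{j_{k-1}}}\;\frac{1-x^{a_k\beta_{j_k}}}{1-x^{\beta_{j_k}}}\left(\frac{1-x^{a_0\beta_{i_0}}}{1-x^{\beta_{i_0}}}\right)^{m_{i_0}},$$ lowering $m_{j_k}$ by $1$, raising $m_{i_0}$ by $1$ and replacing $\beta_{i_0}$ by $a_0\beta_{i_0}$; those with unchanged support inherit the dependence (now with $a_0=1$), the others store none. The algorithm stops when all fractions are labelled "reduced". For a vector $v$, the *expression indicated by $v$* is the function of $\gamma\in\mathbb Z^n$ $$\sum\ \sum_\delta p_\delta\prod_{i\in I}\prod_{l=1}^{m_i-1}\Bigl(\frac{\langle b_i,\gamma-\delta\rangle}{l}+1\Bigr)\bar\tau(\gamma-\delta),$$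 where the outer sum is over the final fractions $\bigl(\sum_\delta p_\delta x^\delta\bigr)\prod_{i\in I}(1-x^{\beta_i})^{-m_i}$ with $v\in\Lambda(\{\beta_i\}_{i\in I})$, $(b_i)$ is the dual basis of $(\beta_i)_{i\in I}$ for the standard scalar product, and $\bar\tau$ is the indicator function of the lattice $\sum_{i\in I}\mathbb Z\beta_i$. Then: (a) The partial fraction algorithm always stops, whatever choices are made, and it stops only when all fractions are labelled "reduced". For each cone $C$ in a final list of the wall-crossing algorithm, each result of the partial fraction algorithm, and each $v\in C$ lying on the boundary of none of the cones generated by the supports of the resulting fractions, the expression indicated by $v$ is a quasipolynomial, and it equals $P(\gamma)$ for all $\gamma\in C\cap\mathbb Z^n$. (b) Let $D_1,\dots,D_M$ be the cones spanned by the $(n-1)$-element subsets of $\alpha_1,\dots,\alpha_N$ of rank $n-1$. Then $P$ is a quasipolynomial on each of the closed pieces into which the boundaries of the $D_j$ split $\Lambda$, that is, on the closure of each connected component of $\Lambda\setminus\bigcup_j\partial D_j$ (boundaries taken in $\mathbb R^n$). (c) The same holds with the $D_j$ replaced by the cones in the cone support of any partial fraction decomposition $$\prod_{i=1}^N\frac1{1-x^{\alpha_i}}=\sum_{t}p_t(x)\prod_{i=1}^{s_t}\frac1{(1-x^{l_{t,i}\beta_{t,i}})^{m_{t,i}}}$$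 (a finite sum with $p_t\in\mathbb Q[x_1^{\pm1},\dots,x_n^{\pm1}]$, $s_t,l_{t,i},m_{t,i}\ge1$, and for each $t$ linearly independent $\beta_{t,1},\dots,\beta_{t,s_t}\in\mathbb Z^n$; the cone support is the set of cones $\Lambda(\beta_{t,1},\dots,\beta_{t,s_t})$) whose vectors $\beta_{t,i}$ lie together with the $\alpha_i$ in an open half-space $\{\varphi>0\}$, $\varphi$ a linear form; for example, all $\beta_{t,i}$ may have nonnegative coordinates. -/

import Mathlib

noncomputable section

namespace VPF

/-! ### Cones, walls and chambers in real `n`-space -/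

/-- The real point with given integer coordinates. -/
def toR {n : ℕ} (γ : Fin n → ℤ) : Fin n → ℝ := fun k => (γ k : ℝ)

/-- The cone generated over the nonnegative scalars by the vectors `β i`, `i ∈ S`. -/
def coneOver {ι : Type} {n : ℕ} (S : Finset ι) (β : ι → Fin n → ℤ) : Set (Fin n → ℝ) :=
  {x | ∃ c : ι → ℝ, (∀ i, 0 ≤ c i) ∧ x = ∑ i ∈ S, c i • toR (β i)}

/-- A closed pointed polyhedral cone: it has nonzero `n`-volume and is given by finitely many
homogeneous non-strict rational linear inequalities (denominators are cleared). -/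
def IsClosedPointedCone {n : ℕ} (C : Set (Fin n → ℝ)) : Prop :=
  (∃ F : Finset (Fin n → ℤ), C = {x | ∀ ν ∈ F, 0 ≤ toR ν ⬝ᵥ x}) ∧ (interior C).Nonempty

/-- The hyperplane with normal `ν` is a supporting hyperplane of the convex cone `C`, with `ν`
pointing towards `C`: it meets `C` in a cone of nonzero `(n-1)`-volume, that is, in a cone that
spans the whole hyperplane. -/
def IsSupporting {n : ℕ} (C : Set (Fin n → ℝ)) (ν : Fin n → ℝ) : Prop :=
  ν ≠ 0 ∧ (∀ x ∈ C, 0 ≤ ν ⬝ᵥ x) ∧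
    ∀ y : Fin n → ℝ, ν ⬝ᵥ y = 0 → y ∈ Submodule.span ℝ {x | x ∈ C ∧ ν ⬝ᵥ x = 0}

/-- `L` is a finite subdivision of the region `R` into closed pointed polyhedral cones. -/
def IsSubdivision {n : ℕ} (R : Set (Fin n → ℝ)) (L : Set (Set (Fin n → ℝ))) : Prop :=
  L.Finite ∧ (∀ C ∈ L, IsClosedPointedCone C) ∧ ⋃₀ L = R ∧
    ∀ C ∈ L, ∀ C' ∈ L, C ≠ C' → Disjoint (interior C) (interior C')

/-- The closed pieces into which the boundaries of the cones `D ∈ 𝒟` split `R`: the closures of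
the connected components of `R` with all these boundaries removed. -/
def chambers {n : ℕ} (R : Set (Fin n → ℝ)) (𝒟 : Set (Set (Fin n → ℝ))) :
    Set (Set (Fin n → ℝ)) :=
  {C | ∃ x ∈ R \ ⋃ D ∈ 𝒟, frontier D,
    C = closure (connectedComponentIn (R \ ⋃ D ∈ 𝒟, frontier D) x)}

/-- The cones spanned by the `(n-1)`-element subsets of rank `n-1` of a family of vectors. -/
def wallCones {n N : ℕ} (α : Fin N → Fin n → ℤ) : Set (Set (Fin n → ℝ)) :=
  {D | ∃ S : Finset (Fin N), S.card + 1 = n ∧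
    LinearIndependent ℤ (fun i : S => α i) ∧ D = coneOver S α}

/-! ### Vector partition functions and quasipolynomials -/

/-- The vector partition function: the number of ways to write `γ` as a combination of the `α i`
with nonnegative integer coefficients. -/
def partitionFunction {n N : ℕ} (α : Fin N → Fin n → ℤ) (γ : Fin n → ℤ) : ℕ :=
  Nat.card {a : Fin N → ℕ // ∑ i, (a i : ℤ) • α i = γ}

open Classical in
/-- The basic quasinumber `τ_{M,c,d}`, on its lattice of definition. -/
def quasinumber {m n : ℕ} (M : Matrix (Fin m) (Fin n) ℤ) (c : Fin m → ℤ) (d : ℕ)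
    (γ : Fin n → ℤ) : ℚ :=
  if ∀ i, M.mulVec γ i ≡ c i [ZMOD d] then 1 else 0

/-- The ring of quasipolynomials: generated over `ℚ` by the basic quasinumbers and the
coordinate functions. -/
def quasipolynomials (n : ℕ) : Subalgebra ℚ ((Fin n → ℤ) → ℚ) :=
  Algebra.adjoin ℚ
    ({f | ∃ (m : ℕ) (M : Matrix (Fin m) (Fin n) ℤ) (c : Fin m → ℤ) (d : ℕ),
        0 < d ∧ f = quasinumber M c d} ∪
      {f | ∃ k : Fin n, f = fun γ => (γ k : ℚ)})

/-- `P` coincides with a quasipolynomial at all lattice points of `C`. -/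
def IsQuasipolynomialOn {n : ℕ} (P : (Fin n → ℤ) → ℕ) (C : Set (Fin n → ℝ)) : Prop :=
  ∃ q ∈ quasipolynomials n, ∀ γ : Fin n → ℤ, toR γ ∈ C → (P γ : ℚ) = q γ

/-! ### The wall-crossing algorithm

The vectors are added one at a time.  When the vector `a` is added, a new list of cones is
obtained from the old one by first covering the newly reached region, and then replacing the
cones of the list, one after another, by subcones with a unique choice of exit walls along the
rays `γ - t a`, `t ≥ 0`. -/

/-- `γ` lies on no supporting hyperplane of a cone of the list. -/
def InGeneralPosition {n : ℕ} (L : Set (Set (Fin n → ℝ))) (γ : Fin n → ℝ) : Prop :=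
  ∀ C ∈ L, ∀ ν, IsSupporting C ν → ν ⬝ᵥ γ ≠ 0

/-- The time at which the ray `γ - t a` meets the hyperplane with normal `ν`. -/
def hitTime {n : ℕ} (a ν γ : Fin n → ℝ) : ℝ := (ν ⬝ᵥ γ) / (ν ⬝ᵥ a)

/-- The subcone `C'` of the member `C` of the list `L` has a unique choice of exit walls:
there are cones `c 0 = C, c 1, …, c r` of the list and hyperplanes with normals `ν 0, …, ν r`
such that, for every `γ ∈ C'` in general position, the ray `γ - t a`, `t ≥ 0`, runs
successively through `c 0, …, c r`, passing from `c j` to `c (j+1)` through a wall in the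
hyperplane `ν j` shared by the two cones, and leaves `c r` through a wall in the hyperplane
`ν r`, which supports the union of the list. -/
def HasUniqueExitWalls {n : ℕ} (L : Set (Set (Fin n → ℝ))) (a : Fin n → ℝ)
    (C C' : Set (Fin n → ℝ)) : Prop :=
  ∃ (r : ℕ) (c : ℕ → Set (Fin n → ℝ)) (ν : ℕ → Fin n → ℝ),
    c 0 = C ∧
    (∀ j ≤ r, c j ∈ L ∧ IsSupporting (c j) (ν j) ∧ 0 < ν j ⬝ᵥ a) ∧
    (∀ j < r, IsSupporting (c (j + 1)) (-ν j)) ∧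
    IsSupporting (⋃₀ L) (ν r) ∧
    ∀ γ ∈ C', InGeneralPosition L γ →
      (∀ j ≤ r, γ - hitTime a (ν j) γ • a ∈ c j) ∧
      (∀ j < r, γ - hitTime a (ν j) γ • a ∈ c (j + 1) ∧
        hitTime a (ν j) γ ≤ hitTime a (ν (j + 1)) γ)

/-- The part of the wall-crossing algorithm in which the vector `a` is processed, started from
the list `L₀`; the current list consists of the pending cones and of the computed cones. -/
inductive Stage {n : ℕ} (L₀ : Set (Set (Fin n → ℝ))) (a : Fin n → ℝ) :
    Set (Set (Fin n → ℝ)) → Set (Set (Fin n → ℝ)) → Prop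
  | start : Stage L₀ a L₀ ∅
  | process (pending computed L : Set (Set (Fin n → ℝ))) (C : Set (Fin n → ℝ)) :
      Stage L₀ a pending computed → C ∈ pending → IsSubdivision C L →
      (∀ C' ∈ L, HasUniqueExitWalls (pending ∪ computed) a C C') →
      Stage L₀ a (pending \ {C}) (computed ∪ L)

/-- `WallCrossing α S 𝒞`: after the vectors `α i`, `i ∈ S`, have been processed, the
wall-crossing algorithm may have arrived at the list of cones `𝒞`. -/
inductive WallCrossing {n N : ℕ} (α : Fin N → Fin n → ℤ) :
    Finset (Fin N) → Set (Set (Fin n → ℝ)) → Prop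
  | init (S : Finset (Fin N)) : S.card = n → LinearIndependent ℤ (fun i : S => α i) →
      WallCrossing α S {coneOver S α}
  | add (S : Finset (Fin N)) (i : Fin N) (𝒞 𝒩 𝒞' : Set (Set (Fin n → ℝ))) :
      WallCrossing α S 𝒞 → i ∉ S →
      IsSubdivision (closure (coneOver (insert i S) α \ coneOver S α)) 𝒩 →
      Stage (𝒞 ∪ 𝒩) (toR (α i)) ∅ 𝒞' →
      WallCrossing α (insert i S) 𝒞'

/-! ### Rational functions and partial fraction decompositions -/

/-- Laurent polynomials in `x_1, …, x_n` with rational coefficients. -/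
abbrev Laurent (n : ℕ) : Type := AddMonoidAlgebra ℚ (Fin n → ℤ)

/-- The Laurent monomial `x^γ`. -/
def mono {n : ℕ} (γ : Fin n → ℤ) : Laurent n := AddMonoidAlgebra.single γ 1

/-- The field of rational functions in `x_1, …, x_n`. -/
abbrev RatFun (n : ℕ) : Type := FractionRing (Laurent n)

/-- The rational function `1 / (1 - x^β)`. -/
def geom {n : ℕ} (β : Fin n → ℤ) : RatFun n :=
  (algebraMap (Laurent n) (RatFun n) (1 - mono β))⁻¹

/-- The generating function `∏ 1 / (1 - x^{α_i})` of the vector partition function. -/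
def generatingFunction {n N : ℕ} (α : Fin N → Fin n → ℤ) : RatFun n := ∏ i, geom (α i)

/-- A summand of a partial fraction decomposition: `s` vectors with elongations, multiplicities,
and a Laurent polynomial as numerator. -/
structure PFTerm (n : ℕ) where
  s : ℕ
  vec : Fin s → Fin n → ℤ
  len : Fin s → ℕ
  mult : Fin s → ℕ
  num : Laurent n

/-- The rational function `p ∏ 1 / (1 - x^{l_i α_i})^{m_i}`. -/
def PFTerm.value {n : ℕ} (t : PFTerm n) : RatFun n :=
  algebraMap (Laurent n) (RatFun n) t.num *
    ∏ i, geom ((t.len i : ℤ) • t.vec i) ^ t.mult i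

/-- The cone generated by the vectors of a summand. -/
def PFTerm.cone {n : ℕ} (t : PFTerm n) : Set (Fin n → ℝ) := coneOver Finset.univ t.vec

/-- `T` is a partial fraction decomposition of `q`. -/
def IsPartialFractionDecomposition {n : ℕ} (q : RatFun n) (T : List (PFTerm n)) : Prop :=
  (∀ t ∈ T, 0 < t.s ∧ LinearIndependent ℤ t.vec ∧ ∀ i, 0 < t.len i ∧ 0 < t.mult i) ∧
    q = (T.map PFTerm.value).sum

/-- The cone support of a partial fraction decomposition. -/
def coneSupport {n : ℕ} (T : List (PFTerm n)) : Set (Set (Fin n → ℝ)) :=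
  {D | ∃ t ∈ T, D = t.cone}

/-! ### The partial fraction algorithm -/

/-- A fraction `p ∏ 1 / (1 - x^{l_i α_i})^{m_i}`, where `i` runs over the indices of the given
vectors `α_i`; the support consists of the `i` with `m_i ≠ 0`. -/
structure Fraction (n N : ℕ) where
  num : Laurent n
  len : Fin N → ℕ
  mult : Fin N → ℕ

namespace Fraction

variable {n N : ℕ}

/-- The support of the fraction, as a set of indices. -/
def supp (f : Fraction n N) : Finset (Fin N) := Finset.univ.filter fun i => f.mult i ≠ 0

/-- The exponent `l_i α_i` in the denominators. -/
def vec (α : Fin N → Fin n → ℤ) (f : Fraction n N) (i : Fin N) : Fin n → ℤ :=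
  (f.len i : ℤ) • α i

/-- The cone generated by the support of the fraction. -/
def cone (α : Fin N → Fin n → ℤ) (f : Fraction n N) : Set (Fin n → ℝ) := coneOver f.supp α

end Fraction

/-- A linear dependence `a₀ β_{i₀} = ∑_{j ∈ js} a_j β_j` with distinguished index `i₀`. -/
structure Dependence (N : ℕ) where
  i₀ : Fin N
  a₀ : ℕ
  js : List (Fin N)
  a : Fin N → ℤ

/-- The dependence is a linear dependence, with nonzero coefficients and positive distinguished
coefficient, between the vectors `l_i α_i` in the support of the fraction. -/
def Dependence.IsValid {n N : ℕ} (α : Fin N → Fin n → ℤ) (f : Fraction n N)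
    (r : Dependence N) : Prop :=
  0 < r.a₀ ∧ r.i₀ ∈ f.supp ∧ r.js.Nodup ∧ r.i₀ ∉ r.js ∧
    (∀ j ∈ r.js, j ∈ f.supp ∧ r.a j ≠ 0) ∧
    (r.a₀ : ℤ) • f.vec α r.i₀ = (r.js.map fun j => r.a j • f.vec α j).sum

/-- The data stored with a fraction: nothing, a preferred linear dependence, or the flag
"reduced". -/
inductive Label (N : ℕ) where
  | unreduced : Label N
  | dep (r : Dependence N) : Label N
  | reduced : Label N

/-- The numerator `(1 - x^{aβ}) / (1 - x^β)` of the elongation formula, for `a ≠ 0`. -/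
def elongation {n : ℕ} (a : ℤ) (β : Fin n → ℤ) : Laurent n :=
  if 0 < a then ∑ k ∈ Finset.range a.toNat, mono ((k : ℤ) • β)
  else -∑ k ∈ Finset.range (-a).toNat, mono (-((k : ℤ) + 1) • β)

/-- The fraction that arises from `f` when the elongated Szenes-Vergne formula is applied to the
factors with indices in `r.js`, and the elongation formula to the factors with index `r.i₀`, in
the summand in which the factor with index `j` disappears; `pre` is the part of the list `r.js`
before `j`. -/
def newFraction {n N : ℕ} (α : Fin N → Fin n → ℤ) (f : Fraction n N) (r : Dependence N)
    (pre : List (Fin N)) (j : Fin N) : Fraction n N where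
  num := f.num * mono (pre.map fun i => r.a i • f.vec α i).sum *
    elongation (r.a j) (f.vec α j) * elongation r.a₀ (f.vec α r.i₀) ^ f.mult r.i₀
  len := Function.update f.len r.i₀ (r.a₀ * f.len r.i₀)
  mult := Function.update (Function.update f.mult j (f.mult j - 1)) r.i₀ (f.mult r.i₀ + 1)

/-- The label of the new fraction.  If its support has not changed, it inherits the preferred
linear dependence, rewritten for the elongated vector `a₀ l_{i₀} α_{i₀}`. -/
def newLabel {N : ℕ} (m : ℕ) (r : Dependence N) : Label N :=
  if m = 1 then Label.unreduced else Label.dep { r with a₀ := 1 }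

/-- The list of fractions that replaces `f`. -/
def newFractions {n N : ℕ} (α : Fin N → Fin n → ℤ) (f : Fraction n N) (r : Dependence N) :
    List (Fraction n N × Label N) :=
  (List.range r.js.length).map fun k =>
    let j := r.js.getD k r.i₀
    (newFraction α f r (r.js.take k) j, newLabel (f.mult j) r)

/-- The state of the partial fraction algorithm: the stored fractions with their labels. -/
abbrev PFState (n N : ℕ) : Type := Multiset (Fraction n N × Label N)

/-- The initial state, for the generating function of the vector partition function. -/
def initialState (n N : ℕ) : PFState n N :=
  {({ num := 1, len := fun _ => 1, mult := fun _ => 1 }, Label.unreduced)}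

/-- No stored fraction has a preferred linear dependence. -/
def NoDependence {n N : ℕ} (s : PFState n N) : Prop := ∀ p ∈ s, ∀ r, p.2 ≠ Label.dep r

/-- One step of the partial fraction algorithm, with arbitrary choices. -/
inductive PFStep {n N : ℕ} (α : Fin N → Fin n → ℤ) : PFState n N → PFState n N → Prop
  | label (f : Fraction n N) (s : PFState n N) :
      NoDependence s → LinearIndependent ℤ (fun i : f.supp => α i) →
      PFStep α ((f, Label.unreduced) ::ₘ s) ((f, Label.reduced) ::ₘ s)
  | choose (f : Fraction n N) (r : Dependence N) (s : PFState n N) :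
      NoDependence s → r.IsValid α f →
      PFStep α ((f, Label.unreduced) ::ₘ s) ((f, Label.dep r) ::ₘ s)
  | reduce (f : Fraction n N) (r : Dependence N) (s : PFState n N) :
      PFStep α ((f, Label.dep r) ::ₘ s) ((newFractions α f r : PFState n N) + s)

/-- The state can be reached by the partial fraction algorithm. -/
def PFReachable {n N : ℕ} (α : Fin N → Fin n → ℤ) (s : PFState n N) : Prop :=
  Relation.ReflTransGen (PFStep α) (initialState n N) s

/-- The algorithm terminates when all fractions are labelled as reduced. -/
def PFFinished {n N : ℕ} (s : PFState n N) : Prop := ∀ p ∈ s, p.2 = Label.reduced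

/-! ### The Brion-Vergne expressions -/

open Classical in
/-- The vector, in the dual basis of `(β k)_{k ∈ S}` for the standard scalar product, that
belongs to the index `i`. -/
def dualVector {ι : Type} {n : ℕ} (S : Finset ι) (β : ι → Fin n → ℤ) (i : ι) : Fin n → ℚ :=
  Classical.epsilon fun b => ∀ k ∈ S, (b ⬝ᵥ fun j => (β k j : ℚ)) = if k = i then 1 else 0

open Classical in
/-- The indicator function of the lattice generated by the `β k`, `k ∈ S`. -/
def latticeIndicator {ι : Type} {n : ℕ} (S : Finset ι) (β : ι → Fin n → ℤ)
    (γ : Fin n → ℤ) : ℚ :=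
  if γ ∈ Submodule.span ℤ (β '' (S : Set ι)) then 1 else 0

/-- The expression
`∑_δ p_δ ∏_i ∏_{l=1}^{m_i - 1} (⟨b_i, γ - δ⟩ / l + 1) · τ(γ - δ)`
attached to the fraction `(∑_δ p_δ x^δ) ∏ 1 / (1 - x^{β_i})^{m_i}`, `β_i = l_i α_i`, where
`(b_i)` is the dual basis of `(β_i)` and `τ` the indicator function of the lattice of the
`β_i`. -/
def Fraction.expression {n N : ℕ} (α : Fin N → Fin n → ℤ) (f : Fraction n N)
    (γ : Fin n → ℤ) : ℚ :=
  f.num.coeff.sum fun δ p => p *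
    (∏ i ∈ f.supp, ∏ l ∈ Finset.Icc 1 (f.mult i - 1),
      ((dualVector f.supp (f.vec α) i ⬝ᵥ fun k => ((γ k - δ k : ℤ) : ℚ)) / (l : ℚ) + 1)) *
    latticeIndicator f.supp (f.vec α) (γ - δ)

open Classical in
/-- The expression for the partition function on the combinatorial chamber indicated by the
vector `v`: only the fractions whose support generates a cone containing `v` contribute. -/
def chamberExpression {n N : ℕ} (α : Fin N → Fin n → ℤ) (s : PFState n N) (v : Fin n → ℝ)
    (γ : Fin n → ℤ) : ℚ :=
  (s.map fun p => if v ∈ p.1.cone α then p.1.expression α γ else 0).sum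

end VPF

end

/-!
Choose a linear form `φ` that is positive on all `α i`.  The theorem rests on two facts.

*Piecewise quasipolynomiality.*  The partition function `P` of the family enlarged by a vector `a`
is obtained from the old one by summing over the points `γ - k a`, `k ≥ 0`
(`subPartition_insert_eq_sum`).  Quasipolynomials have antidifferences in each direction
(`exists_antidifference`), and the times at which a ray `γ - t a` passes from one cone to the next
are quotients `(μ · γ) / d`, whose integer parts are quasipolynomials.  Hence, if the rays starting
in `C` run successively through the same cones, and the old partition function is a quasipolynomial
on each of them, then the new one is a quasipolynomial on `C`.  For the cones of the wall-crossing
algorithm this condition is what `HasUniqueExitWalls` provides (`WallCrossing.isAdaptedList`); the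
boundary of the region reached so far needs care, because the old partition function vanishes
outside of that region only.  For a finite arrangement of hyperplanes that contains with any two
hyperplanes the comparison of their hitting times, the condition holds for all closed cells, which
proves that `P` is a quasipolynomial on the closed cells of some rational arrangement
(`exists_isQuasipolynomialOnCells`).  No information on the arrangement is kept.

*Contributions of cones.*  A rational function whose denominator is a product of factors
`1 - x^β`, `φ(β) > 0`, has only one expansion with support bounded below with respect to `φ`,
because such a denominator acts injectively on these functions (`eq_zero_of_act_eq_zero`,
`IsExpansion.unique`).  So a partial fraction decomposition writes `P` as a sum of the expansions of
its summands.  Such an expansion vanishes far out on all rays with a direction outside of the closed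
cone of the summand, and it coincides far out with the quasipolynomial `Fraction.expression` on the
rays with a direction in the interior (`eventually_act_prodCoeff`).  Two quasipolynomials that
coincide far out on all rays with one fixed direction are equal (`quasipolynomial_ext`).  Therefore
the quasipolynomial which is equal to `P` on a cone `C` must be the sum of the contributions of the
summands whose cones contain a given `v ∈ C`, if `v` is on the boundary of none of them
(`IsConicDecomposition.eq_conicSum`).  This is (a).  Moreover this sum is the same for all points of
a connected set that avoids the boundaries; as the closure of a connected component is covered by
finitely many closed cells with an interior point in the component, the same quasipolynomial
describes `P` on all of the closure (`IsConicDecomposition.isQuasipolynomialOn_chamber`).  This is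
(c), and (b) follows since the boundary of a simplicial cone is covered by cones spanned by `n - 1`
vectors (`frontier_coneOver_subset`).

The partial fraction algorithm keeps the sum of its fractions (`newFractions_value`).  It stops by
the well-foundedness of the multiset order: fractions are ordered by the size of the support and,
for equal supports, by the total multiplicity of the factors that remain to be cancelled
(`rank_lt_of_mem_newFractions`).
-/

namespace VPF

/-! ### Quasipolynomials -/

theorem quasinumber_mem {m n : ℕ} (M : Matrix (Fin m) (Fin n) ℤ) (c : Fin m → ℤ) {d : ℕ}
    (hd : 0 < d) : quasinumber M c d ∈ quasipolynomials n :=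
  Algebra.subset_adjoin (Or.inl ⟨m, M, c, d, hd, rfl⟩)

theorem coord_mem {n : ℕ} (k : Fin n) :
    (fun γ : Fin n → ℤ => (γ k : ℚ)) ∈ quasipolynomials n :=
  Algebra.subset_adjoin (Or.inr ⟨k, rfl⟩)

/-- A function on `ℤⁿ` that depends only on the residue classes of the coordinates modulo a
positive integer is a quasipolynomial. -/
theorem mem_quasipolynomials_of_periodic {n D : ℕ} (hD : 0 < D) {f : (Fin n → ℤ) → ℚ}
    (hf : ∀ γ γ' : Fin n → ℤ, (∀ k, γ k ≡ γ' k [ZMOD D]) → f γ = f γ') :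
    f ∈ quasipolynomials n := by
  classical
  have key : f = ∑ c : Fin n → Fin D, f (fun k => ((c k : ℕ) : ℤ)) •
      quasinumber (1 : Matrix (Fin n) (Fin n) ℤ) (fun k => ((c k : ℕ) : ℤ)) D := by
    funext γ
    have hD' : (0 : ℤ) < D := by exact_mod_cast hD
    let c₀ : Fin n → Fin D := fun k => ⟨(γ k % D).toNat, by
      have h1 := Int.emod_nonneg (γ k) hD'.ne'
      have h2 := Int.emod_lt_of_pos (γ k) hD'
      omega⟩
    have hc₀ : ∀ k, ((c₀ k : ℕ) : ℤ) = γ k % D := fun k => by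
      simp [c₀, Int.toNat_of_nonneg (Int.emod_nonneg (γ k) hD'.ne')]
    rw [Finset.sum_apply, Finset.sum_eq_single c₀]
    · have h1 : f γ = f (fun k => ((c₀ k : ℕ) : ℤ)) := hf _ _ fun k => by
        rw [hc₀]; exact (Int.mod_modEq _ _).symm
      have h2 : quasinumber (1 : Matrix (Fin n) (Fin n) ℤ) (fun k => ((c₀ k : ℕ) : ℤ)) D γ = 1 := by
        rw [quasinumber, if_pos]
        intro k
        rw [Matrix.one_mulVec, hc₀]
        exact (Int.mod_modEq _ _).symm
      simp [h1, h2]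
    · intro c _ hc
      have h2 : quasinumber (1 : Matrix (Fin n) (Fin n) ℤ) (fun k => ((c k : ℕ) : ℤ)) D γ = 0 := by
        rw [quasinumber, if_neg]
        intro h
        apply hc
        funext k
        apply Fin.ext
        have h3 := h k
        rw [Matrix.one_mulVec] at h3
        have h4 : γ k % D = ((c k : ℕ) : ℤ) := by
          rw [h3, Int.emod_eq_of_lt (by positivity) (by exact_mod_cast (c k).2)]
        have h5 := hc₀ k
        rw [h4] at h5
        exact_mod_cast h5.symm
      simp [h2]
    · simp
  rw [key]
  exact Subalgebra.sum_mem _ fun c _ => Subalgebra.smul_mem _ (quasinumber_mem _ _ hD) _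

theorem const_mem {n : ℕ} (r : ℚ) : (fun _ : Fin n → ℤ => r) ∈ quasipolynomials n :=
  mem_quasipolynomials_of_periodic one_pos fun _ _ _ => rfl

theorem quasinumber_periodic {m n : ℕ} (M : Matrix (Fin m) (Fin n) ℤ) (c : Fin m → ℤ) (d : ℕ)
    (γ γ' : Fin n → ℤ) (h : ∀ k, γ k ≡ γ' k [ZMOD d]) :
    quasinumber M c d γ = quasinumber M c d γ' := by
  have : ∀ i, M.mulVec γ i ≡ M.mulVec γ' i [ZMOD d] := fun i => by
    simp only [Matrix.mulVec, dotProduct]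
    exact Int.ModEq.sum fun k _ => (h k).mul_left _
  simp only [quasinumber]
  congr 1
  exact propext (forall_congr' fun i =>
    ⟨fun h' => (this i).symm.trans h', fun h' => (this i).trans h'⟩)

/-- The quasipolynomials are generated by the periodic functions and the coordinates. -/
theorem quasipolynomials_induction {n : ℕ} {p : ((Fin n → ℤ) → ℚ) → Prop}
    (periodic : ∀ (D : ℕ) (f : (Fin n → ℤ) → ℚ), 0 < D →
      (∀ γ γ' : Fin n → ℤ, (∀ k, γ k ≡ γ' k [ZMOD D]) → f γ = f γ') → p f)
    (coord : ∀ k : Fin n, p fun γ => (γ k : ℚ))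
    (add : ∀ f g, p f → p g → p (f + g)) (mul : ∀ f g, p f → p g → p (f * g))
    {q : (Fin n → ℤ) → ℚ} (hq : q ∈ quasipolynomials n) : p q := by
  induction hq using Algebra.adjoin_induction with
  | mem f hf =>
    rcases hf with ⟨m, M, c, d, hd, rfl⟩ | ⟨k, rfl⟩
    · exact periodic d _ hd (quasinumber_periodic M c d)
    · exact coord k
  | algebraMap r => exact periodic 1 _ one_pos fun _ _ _ => rfl
  | add f g _ _ hf hg => exact add f g hf hg
  | mul f g _ _ hf hg => exact mul f g hf hg

theorem linear_mem {n : ℕ} (ν : Fin n → ℚ) :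
    (fun γ : Fin n → ℤ => ν ⬝ᵥ fun k => (γ k : ℚ)) ∈ quasipolynomials n := by
  have : (fun γ : Fin n → ℤ => ν ⬝ᵥ fun k => (γ k : ℚ)) =
      ∑ k, ν k • (fun γ : Fin n → ℤ => (γ k : ℚ)) := by
    funext γ
    simp [dotProduct, Finset.sum_apply]
  rw [this]
  exact Subalgebra.sum_mem _ fun k _ => Subalgebra.smul_mem _ (coord_mem k) _

/-- A self-map of `ℤⁿ` whose coordinates are quasipolynomials, and which preserves congruences
in the weak sense below, pulls quasipolynomials back to quasipolynomials. -/
theorem comp_mem {n : ℕ} {e : (Fin n → ℤ) → Fin n → ℤ}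
    (hcoord : ∀ k, (fun γ => (e γ k : ℚ)) ∈ quasipolynomials n)
    (hper : ∀ D : ℕ, 0 < D → ∃ D' : ℕ, 0 < D' ∧ ∀ γ γ' : Fin n → ℤ,
      (∀ k, γ k ≡ γ' k [ZMOD D']) → ∀ k, e γ k ≡ e γ' k [ZMOD D])
    {q : (Fin n → ℤ) → ℚ} (hq : q ∈ quasipolynomials n) :
    (fun γ => q (e γ)) ∈ quasipolynomials n := by
  refine quasipolynomials_induction (p := fun q => (fun γ => q (e γ)) ∈ quasipolynomials n)
    ?_ ?_ ?_ ?_ hq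
  · intro D f hD hf
    obtain ⟨D', hD', h⟩ := hper D hD
    exact mem_quasipolynomials_of_periodic hD' fun γ γ' hγ => hf _ _ (h γ γ' hγ)
  · exact hcoord
  · intro f g hf hg
    exact Subalgebra.add_mem _ hf hg
  · intro f g hf hg
    exact Subalgebra.mul_mem _ hf hg

theorem shift_mem {n : ℕ} {q : (Fin n → ℤ) → ℚ} (hq : q ∈ quasipolynomials n) (δ : Fin n → ℤ) :
    (fun γ => q (γ - δ)) ∈ quasipolynomials n := by
  refine comp_mem (e := fun γ => γ - δ) (fun k => ?_) (fun D hD => ⟨D, hD, ?_⟩) hq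
  · have := Subalgebra.sub_mem _ (coord_mem k) (const_mem (n := n) (δ k : ℚ))
    convert this using 1
    funext γ
    simp
  · intro γ γ' h k
    exact (h k).sub_right _

/-- Along a line, a quasipolynomial is a polynomial on a suitable arithmetic progression. -/
theorem exists_polynomial_on_line {n : ℕ} {q : (Fin n → ℤ) → ℚ} (hq : q ∈ quasipolynomials n)
    (γ w : Fin n → ℤ) :
    ∃ D : ℕ, 0 < D ∧ ∀ E : ℕ, D ∣ E → ∃ p : Polynomial ℚ, ∀ t : ℕ,
      q (γ + (t * E : ℤ) • w) = p.eval (t : ℚ) := by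
  refine quasipolynomials_induction (p := fun q => ∃ D : ℕ, 0 < D ∧ ∀ E : ℕ, D ∣ E →
    ∃ p : Polynomial ℚ, ∀ t : ℕ, q (γ + (t * E : ℤ) • w) = p.eval (t : ℚ)) ?_ ?_ ?_ ?_ hq
  · intro D f hD hf
    refine ⟨D, hD, fun E hE => ⟨Polynomial.C (f γ), fun t => ?_⟩⟩
    rw [Polynomial.eval_C]
    refine hf _ _ fun k => ?_
    have : (D : ℤ) ∣ (t * E : ℤ) * w k :=
      Dvd.dvd.mul_right (Dvd.dvd.mul_left (by exact_mod_cast hE) _) _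
    simpa [Int.modEq_iff_dvd] using this
  · intro k
    refine ⟨1, one_pos, fun E _ =>
      ⟨Polynomial.C (γ k : ℚ) + Polynomial.C (E * w k : ℚ) * Polynomial.X, fun t => ?_⟩⟩
    simp
    ring
  · rintro f g ⟨D, hD, hf⟩ ⟨D', hD', hg⟩
    refine ⟨D * D', Nat.mul_pos hD hD', fun E hE => ?_⟩
    obtain ⟨p, hp⟩ := hf E ((Nat.dvd_mul_right _ _).trans hE)
    obtain ⟨p', hp'⟩ := hg E ((Nat.dvd_mul_left _ _).trans hE)
    exact ⟨p + p', fun t => by rw [Pi.add_apply, hp, hp', Polynomial.eval_add]⟩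
  · rintro f g ⟨D, hD, hf⟩ ⟨D', hD', hg⟩
    refine ⟨D * D', Nat.mul_pos hD hD', fun E hE => ?_⟩
    obtain ⟨p, hp⟩ := hf E ((Nat.dvd_mul_right _ _).trans hE)
    obtain ⟨p', hp'⟩ := hg E ((Nat.dvd_mul_left _ _).trans hE)
    exact ⟨p * p', fun t => by rw [Pi.mul_apply, hp, hp', Polynomial.eval_mul]⟩

/-- Two quasipolynomials are equal if on each line with direction `w` they agree from some
point on. -/
theorem quasipolynomial_ext {n : ℕ} {q q' : (Fin n → ℤ) → ℚ} (hq : q ∈ quasipolynomials n)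
    (hq' : q' ∈ quasipolynomials n) (w : Fin n → ℤ)
    (h : ∀ γ : Fin n → ℤ, ∀ᶠ t : ℕ in Filter.atTop, q (γ + (t : ℤ) • w) = q' (γ + (t : ℤ) • w)) :
    q = q' := by
  funext γ
  obtain ⟨D, hD, hp⟩ := exists_polynomial_on_line (Subalgebra.sub_mem _ hq hq') γ w
  obtain ⟨p, hp⟩ := hp D dvd_rfl
  obtain ⟨t₀, ht₀⟩ := Filter.eventually_atTop.1 (h γ)
  have hz : p = 0 := by
    refine Polynomial.eq_zero_of_infinite_isRoot p ?_
    refine Set.Infinite.mono (s := (fun t : ℕ => (t : ℚ)) '' Set.Ici t₀) ?_ ?_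
    · rintro _ ⟨t, ht, rfl⟩
      have h1 : t₀ ≤ t * D := le_trans ht (Nat.le_mul_of_pos_right t hD)
      have h2 := ht₀ _ h1
      rw [Set.mem_ofPred_eq, Polynomial.IsRoot, ← hp t, Pi.sub_apply, sub_eq_zero]
      exact_mod_cast h2
    · exact (Set.Ici_infinite t₀).image (fun a _ b _ hab => by exact_mod_cast hab)
  have h0 := hp 0
  rw [hz] at h0
  simpa [sub_eq_zero] using h0

/-! ### Summation of quasipolynomials in a direction -/

/-- Quasipolynomials can be summed in a direction `a ≠ 0`.  With respect to a coordinate `k` with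
`a k ≠ 0`, a quasipolynomial is a combination of products `g · γ k ^ i`, where `g` is invariant
under translation by a multiple `D • a`; the powers are summed by the Bernoulli polynomials. -/
theorem exists_antidifference {n : ℕ} {a : Fin n → ℤ} (ha : a ≠ 0) {q : (Fin n → ℤ) → ℚ}
    (hq : q ∈ quasipolynomials n) :
    ∃ Q ∈ quasipolynomials n, ∀ γ, Q γ - Q (γ - a) = q γ := by
  obtain ⟨k, hk⟩ : ∃ k, a k ≠ 0 := by
    by_contra! h
    exact ha (funext h)
  have hkQ : (a k : ℚ) ≠ 0 := by exact_mod_cast hk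
  let G : Set ((Fin n → ℤ) → ℚ) := {g | g ∈ quasipolynomials n ∧
    ∃ D : ℕ, 0 < D ∧ ∀ γ (j : ℤ), g (γ - (j * D) • a) = g γ}
  let x : (Fin n → ℤ) → ℚ := fun γ => (γ k : ℚ)
  have hG_mul : ∀ g ∈ G, ∀ g' ∈ G, g * g' ∈ G := by
    rintro g ⟨hg, D, hD, h⟩ g' ⟨hg', D', hD', h'⟩
    refine ⟨Subalgebra.mul_mem _ hg hg', D * D', Nat.mul_pos hD hD', fun γ j => ?_⟩
    have h1 := h γ (j * D')
    have h2 := h' γ (j * D)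
    have e1 : j * D' * D = j * ((D * D' : ℕ) : ℤ) := by push_cast; ring
    have e2 : j * D * D' = j * ((D * D' : ℕ) : ℤ) := by push_cast; ring
    rw [e1] at h1
    rw [e2] at h2
    rw [Pi.mul_apply, Pi.mul_apply, h1, h2]
  have hG_one : (1 : (Fin n → ℤ) → ℚ) ∈ G :=
    ⟨Subalgebra.one_mem _, 1, one_pos, fun γ j => rfl⟩
  -- every quasipolynomial is in the algebra generated by the invariant ones and one coordinate
  have hadj : q ∈ Algebra.adjoin ℚ (G ∪ {x}) := by
    refine quasipolynomials_induction (p := fun q => q ∈ Algebra.adjoin ℚ (G ∪ {x}))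
      ?_ ?_ ?_ ?_ hq
    · intro D f hD hf
      refine Algebra.subset_adjoin (Or.inl ⟨mem_quasipolynomials_of_periodic hD hf, D, hD,
        fun γ j => hf _ _ fun k => ?_⟩)
      have : (D : ℤ) ∣ (j * D : ℤ) * a k := Dvd.dvd.mul_right (Dvd.intro_left _ rfl) _
      simpa [Int.modEq_iff_dvd] using this
    · intro l
      have h1 : (fun γ : Fin n → ℤ => (γ l : ℚ)) =
          ((fun γ : Fin n → ℤ => (γ l : ℚ)) - ((a l : ℚ) / a k) • x) + ((a l : ℚ) / a k) • x := by
        simp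
      have hx : x ∈ Algebra.adjoin ℚ (G ∪ {x}) := Algebra.subset_adjoin (Or.inr rfl)
      rw [h1]
      refine Subalgebra.add_mem _ (Algebra.subset_adjoin (Or.inl ⟨?_, 1, one_pos, ?_⟩))
        (Subalgebra.smul_mem _ hx _)
      · exact Subalgebra.sub_mem _ (coord_mem l) (Subalgebra.smul_mem _ (coord_mem k) _)
      · intro γ j
        simp [x]
        field_simp
        ring
    · exact fun f g hf hg => Subalgebra.add_mem _ hf hg
    · exact fun f g hf hg => Subalgebra.mul_mem _ hf hg
  rw [← Subalgebra.mem_toSubmodule, Algebra.adjoin_eq_span] at hadj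
  clear hq
  induction hadj using Submodule.span_induction with
  | zero => exact ⟨0, Subalgebra.zero_mem _, fun γ => by simp⟩
  | add f g _ _ hf hg =>
    obtain ⟨F, hF, hF'⟩ := hf
    obtain ⟨F', hF₂, hF₂'⟩ := hg
    refine ⟨F + F', Subalgebra.add_mem _ hF hF₂, fun γ => ?_⟩
    rw [Pi.add_apply, Pi.add_apply, Pi.add_apply, ← hF' γ, ← hF₂' γ]
    ring
  | smul r f _ hf =>
    obtain ⟨F, hF, hF'⟩ := hf
    refine ⟨r • F, Subalgebra.smul_mem _ hF r, fun γ => ?_⟩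
    rw [Pi.smul_apply, Pi.smul_apply, Pi.smul_apply, ← hF' γ, smul_sub]
  | mem f hf =>
    have hform : ∃ g ∈ G, ∃ i : ℕ, f = g * x ^ i := by
      induction hf using Submonoid.closure_induction with
      | mem y hy =>
        rcases hy with hy | rfl
        · exact ⟨y, hy, 0, by simp⟩
        · exact ⟨1, hG_one, 1, by simp⟩
      | one => exact ⟨1, hG_one, 0, by simp⟩
      | mul y z _ _ hy hz =>
        obtain ⟨g, hg, i, rfl⟩ := hy
        obtain ⟨g', hg', i', rfl⟩ := hz
        exact ⟨g * g', hG_mul g hg g' hg', i + i', by rw [pow_add]; ring⟩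
    obtain ⟨g, ⟨hg, D, hD, hinv⟩, i, rfl⟩ := hform
    have hDQ : (D : ℚ) ≠ 0 := by exact_mod_cast hD.ne'
    -- `R` is the antidifference for the step `D • a`
    let u : (Fin n → ℤ) → ℚ := fun γ => (γ k : ℚ) / (D * a k)
    let B : Polynomial ℚ := Polynomial.bernoulli (i + 1)
    let r : ℚ := (D * a k : ℚ) ^ i / (i + 1 : ℚ)
    let R : (Fin n → ℤ) → ℚ := fun γ => r * (g γ * B.eval (1 + u γ))
    have hu : u ∈ quasipolynomials n := by
      have := Subalgebra.smul_mem _ (coord_mem k) ((D * a k : ℚ)⁻¹)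
      convert this using 1
      funext γ
      simp [u, div_eq_inv_mul]
    have hR : R ∈ quasipolynomials n := by
      have h1 : Polynomial.aeval (1 + u) B ∈ quasipolynomials n :=
        Algebra.adjoin_le (Set.singleton_subset_iff.2
          (Subalgebra.add_mem _ (Subalgebra.one_mem _) hu))
          (Polynomial.aeval_mem_adjoin_singleton ℚ _)
      have h2 := Subalgebra.smul_mem _ (Subalgebra.mul_mem _ hg h1) r
      convert h2 using 1
      funext γ
      have h3 : (Polynomial.aeval (1 + u) B) γ = B.eval (1 + u γ) := by
        have := Polynomial.aeval_algHom_apply (Pi.evalAlgHom ℚ (fun _ : Fin n → ℤ => ℚ) γ) (1 + u) B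
        simp only [Pi.evalAlgHom_apply] at this
        rw [← this]
        simp [Polynomial.aeval_def, Polynomial.eval₂_eq_eval_map]
      simp [R, h3]
    have hRdiff : ∀ γ, R γ - R (γ - (D : ℤ) • a) = g γ * x γ ^ i := by
      intro γ
      have e1 : g (γ - (D : ℤ) • a) = g γ := by simpa using hinv γ 1
      have e2 : 1 + u (γ - (D : ℤ) • a) = u γ := by
        simp [u]
        field_simp
        ring
      simp only [R]
      rw [e1, e2, Polynomial.bernoulli_eval_one_add]
      have hi : (i + 1 : ℚ) ≠ 0 := by positivity
      simp only [r, u, x, Nat.add_sub_cancel, div_pow]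
      push_cast
      field_simp
      ring
    refine ⟨fun γ => ∑ j ∈ Finset.range D, R (γ - (j : ℤ) • a), ?_, fun γ => ?_⟩
    · have := Subalgebra.sum_mem (quasipolynomials n) (t := Finset.range D)
        (f := fun (j : ℕ) γ => R (γ - (j : ℤ) • a)) fun j _ => shift_mem hR _
      convert this using 1
      funext γ
      simp
    · rw [← Finset.sum_sub_distrib]
      have := Finset.sum_range_sub' (fun j : ℕ => R (γ - (j : ℤ) • a)) D
      simp only [Pi.mul_apply, Pi.pow_apply]
      rw [← hRdiff γ]
      simp only [Nat.cast_zero, zero_smul, sub_zero] at this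
      rw [← this]
      refine Finset.sum_congr rfl fun j _ => ?_
      congr 2
      push_cast
      module

/-- The integer-valued function `⌊(ν · γ + c) / d⌋` of `γ`.  For `c = d - 1` it is the least
integer `k` with `ν · γ ≤ k d`, and for `c = d` the least integer `k` with `ν · γ < k d`. -/
def floorForm {n : ℕ} (ν : Fin n → ℤ) (c d : ℤ) (γ : Fin n → ℤ) : ℤ := (ν ⬝ᵥ γ + c) / d

theorem floorForm_mem {n : ℕ} (ν : Fin n → ℤ) (c : ℤ) {d : ℤ} (hd : 0 < d) :
    (fun γ => (floorForm ν c d γ : ℚ)) ∈ quasipolynomials n := by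
  lift d to ℕ using hd.le
  have hd' : 0 < d := by exact_mod_cast hd
  -- the remainder of the division is periodic
  have h1 : (fun γ : Fin n → ℤ => (((ν ⬝ᵥ γ + c) % d : ℤ) : ℚ)) ∈ quasipolynomials n := by
    refine mem_quasipolynomials_of_periodic hd' fun γ γ' h => ?_
    have : ν ⬝ᵥ γ + c ≡ ν ⬝ᵥ γ' + c [ZMOD d] := by
      refine Int.ModEq.add_right _ ?_
      simp only [dotProduct]
      exact Int.ModEq.sum fun k _ => (h k).mul_left _
    rw [this]
  have h2 := Subalgebra.smul_mem _ (Subalgebra.sub_mem _ (Subalgebra.add_mem _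
    (linear_mem (fun k => (ν k : ℚ))) (const_mem (c : ℚ))) h1) ((d : ℚ)⁻¹)
  convert h2 using 1
  funext γ
  have h3 := Int.emod_add_mul_ediv (ν ⬝ᵥ γ + c) d
  have h4 : ((ν ⬝ᵥ γ : ℤ) : ℚ) = (fun k => (ν k : ℚ)) ⬝ᵥ fun k => (γ k : ℚ) := by
    simp [dotProduct]
  have h5 : ((ν ⬝ᵥ γ : ℤ) : ℚ) + c = ((ν ⬝ᵥ γ + c) % d : ℤ) + d * floorForm ν c d γ := by
    rw [floorForm]; exact_mod_cast h3.symm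
  have hdQ : (d : ℚ) ≠ 0 := by exact_mod_cast hd'.ne'
  simp only [Pi.smul_apply, Pi.sub_apply, Pi.add_apply, smul_eq_mul]
  rw [← h4, h5]
  field_simp
  ring

theorem comp_floorForm_mem {n : ℕ} (a ν : Fin n → ℤ) (c : ℤ) {d : ℤ} (hd : 0 < d)
    {q : (Fin n → ℤ) → ℚ} (hq : q ∈ quasipolynomials n) :
    (fun γ => q (γ - floorForm ν c d γ • a)) ∈ quasipolynomials n := by
  refine comp_mem (e := fun γ => γ - floorForm ν c d γ • a) (fun k => ?_) (fun D hD => ?_) hq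
  · have := Subalgebra.sub_mem _ (coord_mem k)
      (Subalgebra.smul_mem _ (floorForm_mem ν c hd) (a k : ℚ))
    convert this using 1
    funext γ
    simp [mul_comm]
  · lift d to ℕ using hd.le
    have hd' : 0 < d := by exact_mod_cast hd
    refine ⟨d * D, Nat.mul_pos hd' hD, fun γ γ' h k => ?_⟩
    have h1 : ∀ k, γ k ≡ γ' k [ZMOD D] := fun k =>
      (h k).of_dvd (by push_cast; exact Dvd.intro_left _ rfl)
    have h2 : ν ⬝ᵥ γ + c ≡ ν ⬝ᵥ γ' + c [ZMOD (d * D : ℕ)] := by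
      refine Int.ModEq.add_right _ ?_
      simp only [dotProduct]
      exact Int.ModEq.sum fun k _ => (h k).mul_left _
    have h3 : floorForm ν c d γ ≡ floorForm ν c d γ' [ZMOD D] := by
      obtain ⟨z, hz⟩ := Int.modEq_iff_dvd.1 h2
      have : ν ⬝ᵥ γ' + c = (ν ⬝ᵥ γ + c) + d * (D * z) := by
        push_cast at hz; linarith
      rw [floorForm, floorForm, this, Int.add_mul_ediv_left _ _ hd.ne']
      simp [Int.modEq_iff_dvd]
    exact (h1 k).sub (h3.mul_right _)

/-- The sums `∑ f (γ - k a)` over `e γ ≤ k < e' γ` are given by a quasipolynomial at the lattice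
points `γ` of `C`. -/
def SumQuasipolynomialOn {n : ℕ} (f : (Fin n → ℤ) → ℚ) (a : Fin n → ℤ)
    (C : Set (Fin n → ℝ)) (e e' : (Fin n → ℤ) → ℤ) : Prop :=
  ∃ q ∈ quasipolynomials n, ∀ γ : Fin n → ℤ, toR γ ∈ C →
    ∑ k ∈ Finset.Ico (e γ) (e' γ), f (γ - k • a) = q γ

theorem sum_Ico_sub_shift {n : ℕ} (Q : (Fin n → ℤ) → ℚ) (a γ : Fin n → ℤ) {x y : ℤ}
    (h : x ≤ y) :
    ∑ k ∈ Finset.Ico x y, (Q (γ - k • a) - Q (γ - k • a - a)) =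
      Q (γ - x • a) - Q (γ - y • a) := by
  induction y, h using Int.leInduction with
  | base => simp
  | succ y hy ih =>
    have : Finset.Ico x (y + 1) = insert y (Finset.Ico x y) := by
      ext k; simp; omega
    rw [this, Finset.sum_insert (by simp), ih, show γ - (y + 1) • a = γ - y • a - a by module]
    ring

/-- The summation of a quasipolynomial between two walls. -/
theorem sumQuasipolynomialOn_of_eq {n : ℕ} {f q : (Fin n → ℤ) → ℚ} {a : Fin n → ℤ} (ha : a ≠ 0)
    {C : Set (Fin n → ℝ)} (hq : q ∈ quasipolynomials n) {ν ν' : Fin n → ℤ} {c d c' d' : ℤ}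
    (hd : 0 < d) (hd' : 0 < d')
    (hle : ∀ γ, toR γ ∈ C → floorForm ν c d γ ≤ floorForm ν' c' d' γ)
    (hf : ∀ γ, toR γ ∈ C → ∀ k, floorForm ν c d γ ≤ k → k < floorForm ν' c' d' γ →
      f (γ - k • a) = q (γ - k • a)) :
    SumQuasipolynomialOn f a C (floorForm ν c d) (floorForm ν' c' d') := by
  obtain ⟨Q, hQ, hQq⟩ := exists_antidifference ha hq
  refine ⟨_, Subalgebra.sub_mem _ (comp_floorForm_mem a ν c hd hQ)
    (comp_floorForm_mem a ν' c' hd' hQ), fun γ hγ => ?_⟩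
  rw [Pi.sub_apply, ← sum_Ico_sub_shift Q a γ (hle γ hγ)]
  refine Finset.sum_congr rfl fun k hk => ?_
  rw [Finset.mem_Ico] at hk
  rw [hf γ hγ k hk.1 hk.2, hQq]

theorem SumQuasipolynomialOn.trans {n : ℕ} {f : (Fin n → ℤ) → ℚ} {a : Fin n → ℤ}
    {C : Set (Fin n → ℝ)} {e e' e'' : (Fin n → ℤ) → ℤ}
    (h : SumQuasipolynomialOn f a C e e') (h' : SumQuasipolynomialOn f a C e' e'')
    (hle : ∀ γ, toR γ ∈ C → e γ ≤ e' γ) (hle' : ∀ γ, toR γ ∈ C → e' γ ≤ e'' γ) :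
    SumQuasipolynomialOn f a C e e'' := by
  obtain ⟨q, hq, hqf⟩ := h
  obtain ⟨q', hq', hqf'⟩ := h'
  refine ⟨q + q', Subalgebra.add_mem _ hq hq', fun γ hγ => ?_⟩
  rw [Pi.add_apply, ← hqf γ hγ, ← hqf' γ hγ, ← Finset.sum_union
    (Finset.Ico_disjoint_Ico_consecutive _ _ _),
    Finset.Ico_union_Ico_eq_Ico (hle γ hγ) (hle' γ hγ)]

/-! ### Partition functions of subfamilies -/

/-- The partition function of the subfamily `α i`, `i ∈ S`. -/
noncomputable def subPartition {n N : ℕ} (α : Fin N → Fin n → ℤ) (S : Finset (Fin N))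
    (γ : Fin n → ℤ) : ℕ :=
  Set.ncard {a : Fin N → ℕ | (∀ i ∉ S, a i = 0) ∧ ∑ i, (a i : ℤ) • α i = γ}

theorem subPartition_univ {n N : ℕ} (α : Fin N → Fin n → ℤ) :
    subPartition α Finset.univ = partitionFunction α := by
  funext γ
  rw [subPartition, partitionFunction, ← Nat.card_coe_set_eq]
  simp only [Finset.mem_univ, not_true_eq_false, false_implies, implies_true, true_and]
  rfl

section SubPartition

variable {n N : ℕ} {α : Fin N → Fin n → ℤ} {φ : Fin n → ℤ}

theorem dotProduct_sum_smul (φ : Fin n → ℤ) (α : Fin N → Fin n → ℤ) (a : Fin N → ℕ) :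
    φ ⬝ᵥ ∑ i, (a i : ℤ) • α i = ∑ i, (a i : ℤ) * (φ ⬝ᵥ α i) := by
  simp only [dotProduct_sum, dotProduct_smul, smul_eq_mul]

theorem finite_representations (hφ : ∀ i, 0 < φ ⬝ᵥ α i) (S : Finset (Fin N)) (γ : Fin n → ℤ) :
    {a : Fin N → ℕ | (∀ i ∉ S, a i = 0) ∧ ∑ i, (a i : ℤ) • α i = γ}.Finite := by
  refine Set.Finite.subset (Set.finite_Iic (fun _ => (φ ⬝ᵥ γ).toNat)) ?_
  rintro a ⟨-, ha⟩ i
  have h1 := dotProduct_sum_smul φ α a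
  rw [ha] at h1
  have h2 : (a i : ℤ) * (φ ⬝ᵥ α i) ≤ ∑ i, (a i : ℤ) * (φ ⬝ᵥ α i) :=
    Finset.single_le_sum (f := fun i => (a i : ℤ) * (φ ⬝ᵥ α i))
      (fun j _ => mul_nonneg (by positivity) (hφ j).le) (Finset.mem_univ i)
  have h3 : (a i : ℤ) ≤ (a i : ℤ) * (φ ⬝ᵥ α i) :=
    le_mul_of_one_le_right (by positivity) (hφ i)
  show a i ≤ (φ ⬝ᵥ γ).toNat
  omega

/-- Splitting off one copy of `α i`. -/
theorem subPartition_insert (hφ : ∀ i, 0 < φ ⬝ᵥ α i) {S : Finset (Fin N)} {i : Fin N}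
    (hi : i ∉ S) (γ : Fin n → ℤ) :
    subPartition α (insert i S) γ =
      subPartition α S γ + subPartition α (insert i S) (γ - α i) := by
  classical
  let sh : (Fin N → ℕ) → Fin N → ℕ := fun a => a + Pi.single i 1
  have hsh : Function.Injective sh := add_left_injective _
  have hsum : ∀ a : Fin N → ℕ,
      ∑ j, ((sh a j : ℕ) : ℤ) • α j = (∑ j, (a j : ℤ) • α j) + α i := fun a => by
    simp [sh, add_smul, Finset.sum_add_distrib, Pi.single_apply, ite_smul]
  have key : {a : Fin N → ℕ | (∀ j ∉ insert i S, a j = 0) ∧ ∑ j, (a j : ℤ) • α j = γ} =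
      {a : Fin N → ℕ | (∀ j ∉ S, a j = 0) ∧ ∑ j, (a j : ℤ) • α j = γ} ∪
      sh '' {a : Fin N → ℕ | (∀ j ∉ insert i S, a j = 0) ∧
        ∑ j, (a j : ℤ) • α j = γ - α i} := by
    ext a
    constructor
    · rintro ⟨h1, h2⟩
      by_cases hai : a i = 0
      · refine Or.inl ⟨fun j hj => ?_, h2⟩
        by_cases hji : j = i
        · rw [hji, hai]
        · exact h1 j (by simp [hji, hj])
      · have hle : Pi.single i 1 ≤ a := by
          intro j
          by_cases hji : j = i
          · subst hji; simp; omega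
          · simp [hji]
        have ha : sh (a - Pi.single i 1) = a := tsub_add_cancel_of_le hle
        refine Or.inr ⟨a - Pi.single i 1, ⟨fun j hj => ?_, ?_⟩, ha⟩
        · simp [h1 j hj]
        · rw [eq_sub_iff_add_eq, ← hsum, ha, h2]
    · rintro (⟨h1, h2⟩ | ⟨b, ⟨h1, h2⟩, rfl⟩)
      · exact ⟨fun j hj => h1 j fun h => hj (Finset.mem_insert_of_mem h), h2⟩
      · refine ⟨fun j hj => ?_, by rw [hsum, h2]; simp⟩
        have : j ≠ i := fun h => hj (by simp [h])
        simp [sh, h1 j hj, this]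
  rw [subPartition, key, Set.ncard_union_eq ?_ (finite_representations hφ _ _)
    ((finite_representations hφ _ _).image _), Set.ncard_image_of_injective _ hsh]
  · rfl
  · rw [Set.disjoint_left]
    rintro _ ⟨h1, -⟩ ⟨b, -, rfl⟩
    have := h1 i hi
    simp [sh] at this

theorem toR_sum {ι : Type} (s : Finset ι) (f : ι → Fin n → ℤ) :
    toR (∑ i ∈ s, f i) = ∑ i ∈ s, toR (f i) := by
  funext k
  simp [toR, Finset.sum_apply]

theorem toR_smul (z : ℤ) (γ : Fin n → ℤ) : toR (z • γ) = (z : ℝ) • toR γ := by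
  funext k; simp [toR]

theorem toR_add (γ δ : Fin n → ℤ) : toR (γ + δ) = toR γ + toR δ := by
  funext k; simp [toR]

theorem toR_sub (γ δ : Fin n → ℤ) : toR (γ - δ) = toR γ - toR δ := by
  funext k; simp [toR]

theorem toR_dotProduct (ν γ : Fin n → ℤ) : toR ν ⬝ᵥ toR γ = ((ν ⬝ᵥ γ : ℤ) : ℝ) := by
  simp [toR, dotProduct]

theorem toR_injective : Function.Injective (toR (n := n)) := fun γ δ h => by
  funext k
  have := congrFun h k
  simpa [toR] using this

theorem mem_cone_of_subPartition_ne_zero {S : Finset (Fin N)} {γ : Fin n → ℤ}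
    (h : subPartition α S γ ≠ 0) : toR γ ∈ coneOver S α := by
  obtain ⟨a, ha, rfl⟩ := Set.nonempty_of_ncard_ne_zero h
  refine ⟨fun i => a i, fun i => by positivity, ?_⟩
  rw [toR_sum, ← Finset.sum_subset (Finset.subset_univ S)]
  · exact Finset.sum_congr rfl fun i _ => by rw [toR_smul]; simp
  · intro i _ hi
    rw [ha i hi, toR_smul]
    simp

theorem dot_nonneg_of_mem_cone {S : Finset (Fin N)} {x : Fin n → ℝ} {ν : Fin n → ℝ}
    (hν : ∀ i ∈ S, 0 ≤ ν ⬝ᵥ toR (α i)) (hx : x ∈ coneOver S α) : 0 ≤ ν ⬝ᵥ x := by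
  obtain ⟨c, hc, rfl⟩ := hx
  rw [dotProduct_sum]
  exact Finset.sum_nonneg fun i hi => by
    rw [dotProduct_smul]; exact mul_nonneg (hc i) (hν i hi)

/-- The partition function of an enlarged family, as a sum along the ray in the direction of the
new vector. -/
theorem subPartition_insert_eq_sum (hφ : ∀ i, 0 < φ ⬝ᵥ α i) {S : Finset (Fin N)} {i : Fin N}
    (hi : i ∉ S) (γ : Fin n → ℤ) {x y : ℤ} (hx : 0 ≤ x) (hxy : x ≤ y)
    (h0 : ∀ k : ℤ, 0 ≤ k → k < x → subPartition α S (γ - k • α i) = 0)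
    (h1 : ∀ k : ℤ, y ≤ k → subPartition α S (γ - k • α i) = 0) :
    (subPartition α (insert i S) γ : ℚ) =
      ∑ k ∈ Finset.Ico x y, (subPartition α S (γ - k • α i) : ℚ) := by
  let Q : (Fin n → ℤ) → ℚ := fun γ => subPartition α (insert i S) γ
  have hQ : ∀ γ, (subPartition α S γ : ℚ) = Q γ - Q (γ - α i) := fun γ => by
    simp only [Q]
    rw [subPartition_insert hφ hi γ]
    push_cast
    ring
  obtain ⟨z, hz, hyz⟩ : ∃ z : ℤ, Q (γ - z • α i) = 0 ∧ y ≤ z := by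
    refine ⟨max y (φ ⬝ᵥ γ + 1), ?_, le_max_left _ _⟩
    by_contra hne
    have h2 : subPartition α (insert i S) (γ - max y (φ ⬝ᵥ γ + 1) • α i) ≠ 0 :=
      fun h => hne (by simp only [Q, h, Nat.cast_zero])
    have h3 := dot_nonneg_of_mem_cone (ν := toR φ)
      (fun j _ => by rw [toR_dotProduct]; exact_mod_cast (hφ j).le)
      (mem_cone_of_subPartition_ne_zero h2)
    rw [toR_dotProduct, dotProduct_sub, dotProduct_smul] at h3
    have h4 : 0 ≤ φ ⬝ᵥ γ - max y (φ ⬝ᵥ γ + 1) • (φ ⬝ᵥ α i) := by exact_mod_cast h3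
    have h5 := hφ i
    have h6 : φ ⬝ᵥ γ + 1 ≤ max y (φ ⬝ᵥ γ + 1) := le_max_right _ _
    have h7 : max y (φ ⬝ᵥ γ + 1) ≤ max y (φ ⬝ᵥ γ + 1) * (φ ⬝ᵥ α i) :=
      le_mul_of_one_le_right (by omega) h5
    rw [smul_eq_mul] at h4
    omega
  have h2 := sum_Ico_sub_shift Q (α i) γ (hx.trans (hxy.trans hyz))
  rw [hz, zero_smul, sub_zero, sub_zero] at h2
  rw [show (subPartition α (insert i S) γ : ℚ) = Q γ from rfl, ← h2]
  symm
  refine Finset.sum_subset_zero_on_sdiff (Finset.Ico_subset_Ico hx hyz) (fun k hk => ?_)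
    (fun k _ => hQ _)
  rw [Finset.mem_sdiff, Finset.mem_Ico, Finset.mem_Ico] at hk
  rw [← hQ]
  rcases lt_or_ge k x with h | h
  · rw [h0 k hk.1.1 h, Nat.cast_zero]
  · rw [h1 k (by by_contra h'; exact hk.2 ⟨h, by omega⟩), Nat.cast_zero]

end SubPartition

/-! ### Cones -/

section Cones

variable {ι : Type} {n : ℕ} {S : Finset ι} {β : ι → Fin n → ℤ}

theorem add_mem_coneOver {x y : Fin n → ℝ} (hx : x ∈ coneOver S β) (hy : y ∈ coneOver S β) :
    x + y ∈ coneOver S β := by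
  obtain ⟨c, hc, rfl⟩ := hx
  obtain ⟨c', hc', rfl⟩ := hy
  exact ⟨c + c', fun i => add_nonneg (hc i) (hc' i), by
    simp [add_smul, Finset.sum_add_distrib]⟩

theorem smul_mem_coneOver {x : Fin n → ℝ} {r : ℝ} (hr : 0 ≤ r) (hx : x ∈ coneOver S β) :
    r • x ∈ coneOver S β := by
  obtain ⟨c, hc, rfl⟩ := hx
  exact ⟨fun i => r * c i, fun i => mul_nonneg hr (hc i), by
    simp [Finset.smul_sum, mul_smul]⟩

theorem convex_coneOver : Convex ℝ (coneOver S β) := fun _ hx _ hy _ _ ha hb _ =>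
  add_mem_coneOver (smul_mem_coneOver ha hx) (smul_mem_coneOver hb hy)

theorem gen_mem_coneOver {i : ι} (hi : i ∈ S) : toR (β i) ∈ coneOver S β := by
  classical
  refine ⟨Pi.single i 1, fun j => ?_, ?_⟩
  · rw [Pi.single_apply]; split_ifs <;> norm_num
  · rw [Finset.sum_eq_single i] <;> simp +contextual [hi]

theorem coneOver_mono {S' : Finset ι} (h : S ⊆ S') : coneOver S β ⊆ coneOver S' β := by
  classical
  rintro x ⟨c, hc, rfl⟩
  refine ⟨fun i => if i ∈ S then c i else 0, fun i => ?_, ?_⟩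
  · dsimp only; split_ifs
    · exact hc i
    · exact le_rfl
  · rw [← Finset.sum_subset h (fun i _ hi => by simp [hi])]
    exact Finset.sum_congr rfl fun i hi => by simp [hi]

theorem mem_coneOver_insert [DecidableEq ι] {i : ι} (hi : i ∉ S) {x : Fin n → ℝ} :
    x ∈ coneOver (insert i S) β ↔
      ∃ s ∈ coneOver S β, ∃ t : ℝ, 0 ≤ t ∧ x = s + t • toR (β i) := by
  constructor
  · rintro ⟨c, hc, rfl⟩
    exact ⟨_, ⟨c, hc, rfl⟩, c i, hc i, by rw [Finset.sum_insert hi, add_comm]⟩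
  · rintro ⟨s, hs, t, ht, rfl⟩
    exact add_mem_coneOver (coneOver_mono (Finset.subset_insert i S) hs)
      (smul_mem_coneOver ht (gen_mem_coneOver (Finset.mem_insert_self i S)))

theorem coneOver_smul {l : ι → ℕ} (hl : ∀ i ∈ S, 0 < l i) :
    coneOver S (fun i => (l i : ℤ) • β i) = coneOver S β := by
  classical
  ext x
  constructor
  · rintro ⟨c, hc, rfl⟩
    refine ⟨fun i => c i * l i, fun i => mul_nonneg (hc i) (by positivity), ?_⟩
    exact Finset.sum_congr rfl fun i _ => by rw [toR_smul, mul_smul]; simp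
  · rintro ⟨c, hc, rfl⟩
    refine ⟨fun i => c i / l i, fun i => div_nonneg (hc i) (by positivity), ?_⟩
    refine Finset.sum_congr rfl fun i hi => ?_
    have : (l i : ℝ) ≠ 0 := by exact_mod_cast (hl i hi).ne'
    rw [toR_smul, smul_smul]
    congr 1
    push_cast
    field_simp

theorem continuous_dot (ν : Fin n → ℝ) : Continuous fun x : Fin n → ℝ => ν ⬝ᵥ x := by
  simp only [dotProduct]; fun_prop

/-- A cone is closed if its generators lie in an open half-space: the coefficients that occur in
a bounded region are bounded, so that compactness applies. -/
theorem isClosed_coneOver {φ : Fin n → ℤ} (hφ : ∀ i ∈ S, 0 < φ ⬝ᵥ β i) :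
    IsClosed (coneOver S β) := by
  classical
  rw [← closure_subset_iff_isClosed]
  intro x hx
  let R : ℝ := toR φ ⬝ᵥ x + 1
  let f : (S → ℝ) → Fin n → ℝ := fun c => ∑ i : S, c i • toR (β i)
  have hf : Continuous f := by fun_prop
  have hK : IsCompact (f '' (Set.Icc (fun _ => 0) (fun _ => R))) := isCompact_Icc.image hf
  have hsub : {y | toR φ ⬝ᵥ y < R} ∩ coneOver S β ⊆ f '' (Set.Icc (fun _ => 0) (fun _ => R)) := by
    rintro _ ⟨hy, c, hc, rfl⟩
    refine ⟨fun i => c i, ⟨fun i => hc i, fun i => ?_⟩, ?_⟩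
    · have h1 : toR φ ⬝ᵥ ∑ i ∈ S, c i • toR (β i) = ∑ i ∈ S, c i * ((φ ⬝ᵥ β i : ℤ) : ℝ) := by
        simp only [dotProduct_sum, dotProduct_smul, smul_eq_mul, toR_dotProduct]
      have h2 : c i * ((φ ⬝ᵥ β i : ℤ) : ℝ) ≤ ∑ i ∈ S, c i * ((φ ⬝ᵥ β i : ℤ) : ℝ) :=
        Finset.single_le_sum (f := fun i => c i * ((φ ⬝ᵥ β i : ℤ) : ℝ))
          (fun j hj => mul_nonneg (hc j) (by exact_mod_cast (hφ j hj).le)) i.2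
      have h3 : (1 : ℝ) ≤ ((φ ⬝ᵥ β i : ℤ) : ℝ) := by exact_mod_cast hφ i i.2
      have h4 : c i ≤ c i * ((φ ⬝ᵥ β i : ℤ) : ℝ) := le_mul_of_one_le_right (hc i) h3
      have h5 : toR φ ⬝ᵥ ∑ i ∈ S, c i • toR (β i) < R := hy
      show c i ≤ R
      linarith
    · exact Finset.sum_coe_sort S fun i => c i • toR (β i)
  have hopen : IsOpen {y : Fin n → ℝ | toR φ ⬝ᵥ y < R} :=
    isOpen_lt (continuous_dot _) continuous_const
  have hx' : x ∈ closure ({y | toR φ ⬝ᵥ y < R} ∩ coneOver S β) :=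
    hopen.inter_closure ⟨by show toR φ ⬝ᵥ x < toR φ ⬝ᵥ x + 1; linarith, hx⟩
  obtain ⟨c, hc, rfl⟩ := closure_minimal hsub hK.isClosed hx'
  refine ⟨fun i => if h : i ∈ S then c ⟨i, h⟩ else 0, fun i => ?_, ?_⟩
  · dsimp only; split_ifs with h
    · exact hc.1 ⟨i, h⟩
    · exact le_rfl
  · simp only [f]
    rw [← Finset.sum_coe_sort S]
    exact Finset.sum_congr rfl fun i _ => by simp

/-! ### Dual bases -/

/-- An integer multiple of the dual basis, for `n` linearly independent vectors in `ℤⁿ`: it is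
read off from the adjugate matrix. -/
structure IsDualBasis (S : Finset ι) (β : ι → Fin n → ℤ) (d : ℤ) (ν : ι → Fin n → ℤ) : Prop where
  pos : 0 < d
  dot : ∀ i ∈ S, ∀ k ∈ S, i ≠ k → ν i ⬝ᵥ β k = 0
  dot_self : ∀ i ∈ S, ν i ⬝ᵥ β i = d
  sum : ∀ k l, ∑ i ∈ S, ν i k * β i l = if k = l then d else 0

theorem exists_isDualBasis (hS : S.card = n) (hli : LinearIndependent ℤ (fun i : S => β i)) :
    ∃ d ν, IsDualBasis S β d ν := by
  classical
  let e : Fin n ≃ S := (finCongr hS.symm).trans S.equivFin.symm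
  let A : Matrix (Fin n) (Fin n) ℤ := Matrix.of fun j => β (e j)
  have hA : A.det ≠ 0 := by
    intro h
    rw [← Matrix.det_transpose] at h
    obtain ⟨v, hv, hv'⟩ := Matrix.exists_mulVec_eq_zero_iff.2 h
    apply hv
    have h2 := Fintype.linearIndependent_iff.1 hli (fun i => v (e.symm i)) ?_
    · funext j
      simpa using h2 (e j)
    · rw [← e.sum_comp]
      funext l
      have := congrFun hv' l
      simp only [Matrix.mulVec, dotProduct, Matrix.transpose_apply, A, Matrix.of_apply] at this
      simp only [Finset.sum_apply, Pi.smul_apply, smul_eq_mul, Equiv.symm_apply_apply]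
      rw [← this]
      exact Finset.sum_congr rfl fun j _ => mul_comm _ _
  let ν : ι → Fin n → ℤ := fun i m =>
    if h : i ∈ S then A.det * A.adjugate m (e.symm ⟨i, h⟩) else 0
  have hν : ∀ j m, ν (e j) m = A.det * A.adjugate m j := fun j m => by
    simp [ν]
  have hdot : ∀ j k, ν (e j) ⬝ᵥ β (e k) = if j = k then A.det * A.det else 0 := fun j k => by
    have h1 := congrFun (congrFun (Matrix.mul_adjugate A) k) j
    rw [Matrix.mul_apply] at h1
    simp only [dotProduct, hν]
    have h2 : ∑ m, A.det * A.adjugate m j * β (e k) m = A.det * ∑ m, A k m * A.adjugate m j := by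
      rw [Finset.mul_sum]
      exact Finset.sum_congr rfl fun m _ => by simp only [A, Matrix.of_apply]; ring
    rw [h2, h1]
    simp [Matrix.one_apply, eq_comm]
  refine ⟨A.det * A.det, ν, mul_self_pos.2 hA, ?_, ?_, ?_⟩
  · intro i hi k hk hik
    have := hdot (e.symm ⟨i, hi⟩) (e.symm ⟨k, hk⟩)
    simpa [hik] using this
  · intro i hi
    have := hdot (e.symm ⟨i, hi⟩) (e.symm ⟨i, hi⟩)
    simpa using this
  · intro k l
    rw [← Finset.sum_coe_sort S, ← e.sum_comp]
    have h1 := congrFun (congrFun (Matrix.adjugate_mul A) k) l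
    rw [Matrix.mul_apply] at h1
    simp only [hν]
    have h2 : ∑ j, A.det * A.adjugate k j * β (e j) l = A.det * ∑ j, A.adjugate k j * A j l := by
      rw [Finset.mul_sum]
      exact Finset.sum_congr rfl fun m _ => by simp only [A, Matrix.of_apply]; ring
    rw [h2, h1]
    simp [Matrix.one_apply]

variable {d : ℤ} {ν : ι → Fin n → ℤ}

theorem IsDualBasis.smul_eq (h : IsDualBasis S β d ν) (γ : Fin n → ℤ) :
    d • γ = ∑ i ∈ S, (ν i ⬝ᵥ γ) • β i := by
  funext l
  simp only [Finset.sum_apply, Pi.smul_apply, smul_eq_mul, dotProduct, Finset.sum_mul]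
  rw [Finset.sum_comm]
  have : ∀ m, ∑ i ∈ S, ν i m * γ m * β i l = if m = l then d * γ m else 0 := fun m => by
    have h1 := h.sum m l
    calc ∑ i ∈ S, ν i m * γ m * β i l = (∑ i ∈ S, ν i m * β i l) * γ m := by
          rw [Finset.sum_mul]; exact Finset.sum_congr rfl fun i _ => by ring
      _ = _ := by rw [h1]; split_ifs <;> simp
  simp [this]

theorem IsDualBasis.smul_eq_real (h : IsDualBasis S β d ν) (x : Fin n → ℝ) :
    (d : ℝ) • x = ∑ i ∈ S, (toR (ν i) ⬝ᵥ x) • toR (β i) := by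
  funext l
  simp only [Finset.sum_apply, Pi.smul_apply, smul_eq_mul, dotProduct, Finset.sum_mul]
  rw [Finset.sum_comm]
  have : ∀ m, ∑ i ∈ S, toR (ν i) m * x m * toR (β i) l = if m = l then (d : ℝ) * x m else 0 :=
    fun m => by
      have h1 : ∑ i ∈ S, toR (ν i) m * toR (β i) l = if m = l then (d : ℝ) else 0 := by
        have := h.sum m l
        simp only [toR]
        exact_mod_cast congrArg (Int.cast (R := ℝ)) this
      calc ∑ i ∈ S, toR (ν i) m * x m * toR (β i) l
          = (∑ i ∈ S, toR (ν i) m * toR (β i) l) * x m := by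
            rw [Finset.sum_mul]; exact Finset.sum_congr rfl fun i _ => by ring
        _ = _ := by rw [h1]; split_ifs <;> simp
  simp [this]

theorem IsDualBasis.dot_sum (h : IsDualBasis S β d ν) (c : ι → ℤ) {i : ι} (hi : i ∈ S) :
    ν i ⬝ᵥ ∑ k ∈ S, c k • β k = d * c i := by
  rw [dotProduct_sum, Finset.sum_eq_single i]
  · rw [dotProduct_smul, h.dot_self i hi, smul_eq_mul, mul_comm]
  · intro k hk hki
    rw [dotProduct_smul, h.dot i hi k hk (Ne.symm hki), smul_zero]
  · exact fun h => absurd hi h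

theorem IsDualBasis.coneOver_eq (h : IsDualBasis S β d ν) :
    coneOver S β = {x | ∀ i ∈ S, 0 ≤ toR (ν i) ⬝ᵥ x} := by
  have hd : (0 : ℝ) < d := by exact_mod_cast h.pos
  ext x
  constructor
  · rintro ⟨c, hc, rfl⟩ i hi
    rw [dotProduct_sum]
    refine Finset.sum_nonneg fun k hk => ?_
    rw [dotProduct_smul, toR_dotProduct]
    by_cases hik : i = k
    · subst hik
      rw [h.dot_self i hi]
      exact mul_nonneg (hc i) hd.le
    · rw [h.dot i hi k hk hik]; simp
  · intro hx
    have h1 : x = (d : ℝ)⁻¹ • ∑ i ∈ S, (toR (ν i) ⬝ᵥ x) • toR (β i) := by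
      rw [← h.smul_eq_real, smul_smul, inv_mul_cancel₀ hd.ne', one_smul]
    rw [h1]
    refine smul_mem_coneOver (inv_nonneg.2 hd.le) ?_
    classical
    refine ⟨fun i => if i ∈ S then toR (ν i) ⬝ᵥ x else 0, fun i => ?_, ?_⟩
    · dsimp only; split_ifs with hi
      · exact hx i hi
      · exact le_rfl
    · exact Finset.sum_congr rfl fun i hi => by simp [hi]

theorem IsDualBasis.subset_interior (h : IsDualBasis S β d ν) :
    {x | ∀ i ∈ S, 0 < toR (ν i) ⬝ᵥ x} ⊆ interior (coneOver S β) := by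
  refine interior_maximal ?_ ?_
  · rw [h.coneOver_eq]
    exact fun x hx i hi => (hx i hi).le
  · have : {x : Fin n → ℝ | ∀ i ∈ S, 0 < toR (ν i) ⬝ᵥ x} =
        ⋂ i ∈ S, {x : Fin n → ℝ | 0 < toR (ν i) ⬝ᵥ x} := by
      ext; simp
    rw [this]
    exact isOpen_biInter_finset fun i _ => isOpen_lt continuous_const (continuous_dot _)

theorem IsDualBasis.nonempty_interior (h : IsDualBasis S β d ν) :
    (interior (coneOver S β)).Nonempty := by
  refine ⟨toR (∑ k ∈ S, (1 : ℤ) • β k), h.subset_interior fun i hi => ?_⟩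
  rw [toR_dotProduct, h.dot_sum (fun _ => 1) hi, mul_one]
  exact_mod_cast h.pos

theorem isClosedPointedCone_coneOver (hS : S.card = n)
    (hli : LinearIndependent ℤ (fun i : S => β i)) : IsClosedPointedCone (coneOver S β) := by
  classical
  obtain ⟨d, ν, h⟩ := exists_isDualBasis hS hli
  refine ⟨⟨S.image ν, ?_⟩, h.nonempty_interior⟩
  rw [h.coneOver_eq]
  ext x
  simp

/-- The indicator function of a lattice of full rank is a quasipolynomial. -/
theorem IsDualBasis.latticeIndicator_mem (h : IsDualBasis S β d ν) :
    latticeIndicator S β ∈ quasipolynomials n := by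
  have hd := h.pos
  obtain ⟨D, rfl⟩ : ∃ D : ℕ, d = D := ⟨d.toNat, by omega⟩
  refine mem_quasipolynomials_of_periodic (D := D) (by exact_mod_cast hd) fun γ γ' hγ => ?_
  have hmem : γ' - γ ∈ Submodule.span ℤ (β '' (S : Set ι)) := by
    choose z hz using fun k => Int.modEq_iff_dvd.1 (hγ k)
    have h1 : γ' - γ = (D : ℤ) • z := by
      funext k
      simpa using hz k
    rw [h1, h.smul_eq]
    exact Submodule.sum_mem _ fun i hi => Submodule.smul_mem _ _
      (Submodule.subset_span ⟨i, hi, rfl⟩)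
  have hiff : γ ∈ Submodule.span ℤ (β '' (S : Set ι)) ↔
      γ' ∈ Submodule.span ℤ (β '' (S : Set ι)) := by
    constructor
    · intro hm
      simpa using Submodule.add_mem _ hmem hm
    · intro hm
      simpa using Submodule.sub_mem _ hm hmem
  unfold latticeIndicator
  congr 1
  exact propext hiff

end Cones

theorem mem_span_image_iff {ι : Type} {n : ℕ} {S : Finset ι} {β : ι → Fin n → ℤ}
    {γ : Fin n → ℤ} :
    γ ∈ Submodule.span ℤ (β '' (S : Set ι)) ↔ ∃ c : ι → ℤ, γ = ∑ i ∈ S, c i • β i := by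
  rw [Submodule.mem_span_image_finset_iff_exists_fun']
  simp only [eq_comm]

/-- The partition function of a basis is the indicator function of its lattice, on its cone. -/
theorem IsDualBasis.subPartition_eq {n N : ℕ} {α : Fin N → Fin n → ℤ} {S : Finset (Fin N)} {d : ℤ}
    {ν : Fin N → Fin n → ℤ} (h : IsDualBasis S α d ν) {γ : Fin n → ℤ}
    (hγ : toR γ ∈ coneOver S α) : (subPartition α S γ : ℚ) = latticeIndicator S α γ := by
  classical
  have hd := h.pos
  have hsum : ∀ a : Fin N → ℕ, (∀ i ∉ S, a i = 0) →
      ∑ i, (a i : ℤ) • α i = ∑ i ∈ S, (a i : ℤ) • α i := fun a ha =>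
    (Finset.sum_subset (Finset.subset_univ S) fun i _ hi => by rw [ha i hi]; simp).symm
  rw [latticeIndicator]
  split_ifs with hm
  · obtain ⟨c, rfl⟩ := mem_span_image_iff.1 hm
    have hc : ∀ i ∈ S, 0 ≤ c i := fun i hi => by
      rw [h.coneOver_eq] at hγ
      have h1 := hγ i hi
      rw [toR_dotProduct, h.dot_sum c hi] at h1
      have h2 : 0 ≤ d * c i := by exact_mod_cast h1
      exact nonneg_of_mul_nonneg_right h2 hd
    have hset : {a : Fin N → ℕ | (∀ i ∉ S, a i = 0) ∧
        ∑ i, (a i : ℤ) • α i = ∑ i ∈ S, c i • α i} =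
        {fun i => if i ∈ S then (c i).toNat else 0} := by
      ext a
      constructor
      · rintro ⟨h1, h2⟩
        rw [hsum a h1] at h2
        show a = _
        funext i
        split_ifs with hi
        · have h3 := h.dot_sum c hi
          rw [← h2, h.dot_sum (fun i => (a i : ℤ)) hi] at h3
          have h4 := mul_left_cancel₀ hd.ne' h3
          omega
        · exact h1 i hi
      · intro ha
        have ha : a = fun i => if i ∈ S then (c i).toNat else 0 := ha
        have h1 : ∀ i ∉ S, a i = 0 := fun i hi => by simp [ha, hi]
        refine ⟨h1, ?_⟩
        rw [hsum a h1]
        exact Finset.sum_congr rfl fun i hi => by simp [ha, hi, hc i hi]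
    rw [subPartition, hset, Set.ncard_singleton, Nat.cast_one]
  · have hset : {a : Fin N → ℕ | (∀ i ∉ S, a i = 0) ∧ ∑ i, (a i : ℤ) • α i = γ} = ∅ := by
      rw [Set.eq_empty_iff_forall_notMem]
      rintro a ⟨h1, h2⟩
      exact hm (mem_span_image_iff.2 ⟨fun i => a i, by rw [← h2, hsum a h1]⟩)
    rw [subPartition, hset, Set.ncard_empty, Nat.cast_zero]

/-! ### Points in general position -/

theorem isOpen_generic {n : ℕ} (M : Finset (Fin n → ℝ)) :
    IsOpen {x : Fin n → ℝ | ∀ μ ∈ M, μ ⬝ᵥ x ≠ 0} := by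
  have : {x : Fin n → ℝ | ∀ μ ∈ M, μ ⬝ᵥ x ≠ 0} = ⋂ μ ∈ M, {x : Fin n → ℝ | μ ⬝ᵥ x ≠ 0} := by
    ext; simp
  rw [this]
  exact isOpen_biInter_finset fun μ _ => isOpen_ne_fun (continuous_dot _) continuous_const

/-- Finitely many hyperplanes through the origin have a dense complement. -/
theorem dense_generic {n : ℕ} (M : Finset (Fin n → ℝ)) (hM : 0 ∉ M) :
    Dense {x : Fin n → ℝ | ∀ μ ∈ M, μ ⬝ᵥ x ≠ 0} := by
  classical
  induction M using Finset.induction_on with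
  | empty => simp
  | insert μ M _ ih =>
    have hμ : μ ≠ 0 := fun h => hM (by simp [h])
    have h1 : Dense {x : Fin n → ℝ | μ ⬝ᵥ x ≠ 0} := by
      rw [dense_iff_closure_eq, Set.eq_univ_iff_forall]
      intro x
      by_cases hx : μ ⬝ᵥ x = 0
      · have hμμ : μ ⬝ᵥ μ ≠ 0 := by rwa [Ne, dotProduct_self_eq_zero]
        have hlim : Filter.Tendsto (fun t : ℝ => x + t • μ) (nhdsWithin 0 {0}ᶜ) (nhds x) := by
          have : Continuous fun t : ℝ => x + t • μ := by fun_prop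
          have := this.tendsto 0
          simp only [zero_smul, add_zero] at this
          exact this.mono_left nhdsWithin_le_nhds
        refine mem_closure_of_tendsto hlim ?_
        filter_upwards [self_mem_nhdsWithin] with t ht
        show μ ⬝ᵥ (x + t • μ) ≠ 0
        rw [dotProduct_add, dotProduct_smul, hx, zero_add, smul_eq_mul]
        exact mul_ne_zero ht hμμ
      · exact subset_closure hx
    have h2 := h1.inter_of_isOpen_right (ih fun h => hM (by simp [h])) (isOpen_generic M)
    refine h2.mono ?_
    rintro x ⟨hx1, hx2⟩ ν hν
    rcases Finset.mem_insert.1 hν with rfl | hν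
    · exact hx1
    · exact hx2 ν hν

/-- Every non-empty open set contains a rational point, here written as `toR w / m`. -/
theorem exists_rational_mem {n : ℕ} {U : Set (Fin n → ℝ)} (hU : IsOpen U) {x : Fin n → ℝ}
    (hx : x ∈ U) : ∃ (w : Fin n → ℤ) (m : ℕ), 0 < m ∧ (m : ℝ)⁻¹ • toR w ∈ U := by
  obtain ⟨ε, hε, hball⟩ := Metric.isOpen_iff.1 hU x hx
  obtain ⟨m, hm⟩ := exists_nat_one_div_lt hε
  refine ⟨fun k => ⌊((m + 1 : ℕ) : ℝ) * x k⌋, m + 1, m.succ_pos, hball ?_⟩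
  have hm0 : (0 : ℝ) < ((m + 1 : ℕ) : ℝ) := by positivity
  rw [Metric.mem_ball, dist_pi_lt_iff hε]
  intro k
  refine lt_of_le_of_lt ?_ hm
  rw [Real.dist_eq, Pi.smul_apply, smul_eq_mul, toR]
  have h1 := Int.floor_le (((m + 1 : ℕ) : ℝ) * x k)
  have h2 := Int.lt_floor_add_one (((m + 1 : ℕ) : ℝ) * x k)
  have h3 : (((m + 1 : ℕ) : ℝ))⁻¹ * (⌊((m + 1 : ℕ) : ℝ) * x k⌋ : ℝ) - x k =
      (((m + 1 : ℕ) : ℝ))⁻¹ * ((⌊((m + 1 : ℕ) : ℝ) * x k⌋ : ℝ) - ((m + 1 : ℕ) : ℝ) * x k) := by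
    field_simp
  rw [h3, abs_mul, abs_of_pos (inv_pos.2 hm0), one_div]
  have h4 : |(⌊((m + 1 : ℕ) : ℝ) * x k⌋ : ℝ) - ((m + 1 : ℕ) : ℝ) * x k| ≤ 1 := by
    rw [abs_le]; constructor <;> linarith
  calc (((m + 1 : ℕ) : ℝ))⁻¹ * |(⌊((m + 1 : ℕ) : ℝ) * x k⌋ : ℝ) - ((m + 1 : ℕ) : ℝ) * x k|
      ≤ (((m + 1 : ℕ) : ℝ))⁻¹ * 1 := by gcongr
    _ = _ := by push_cast; ring

/-- The intersection of a line with a convex set is an interval. -/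
theorem mem_of_between {n : ℕ} {C : Set (Fin n → ℝ)} (hC : Convex ℝ C) {x a : Fin n → ℝ}
    {s s' t : ℝ} (hs : x - s • a ∈ C) (hs' : x - s' • a ∈ C) (h : s ≤ t) (h' : t ≤ s') :
    x - t • a ∈ C := by
  rcases eq_or_lt_of_le (h.trans h') with h'' | h''
  · rwa [le_antisymm (h''.symm ▸ h') h]
  · have h3 : s' - s ≠ 0 := by linarith
    have h4 := hC hs hs' (div_nonneg (sub_nonneg.2 h') (sub_nonneg.2 h''.le))
      (div_nonneg (sub_nonneg.2 h) (sub_nonneg.2 h''.le)) (by field_simp; ring)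
    convert h4 using 1
    rw [smul_sub, smul_sub, smul_smul, smul_smul, sub_add_sub_comm, ← add_smul, ← add_smul]
    congr 2
    · rw [show (s' - t) / (s' - s) + (t - s) / (s' - s) = 1 by field_simp; ring, one_smul]
    · field_simp
      ring

/-! ### Closed pointed cones and their supporting hyperplanes -/

section Pointed

variable {n : ℕ} {C : Set (Fin n → ℝ)}

theorem IsClosedPointedCone.isClosed (hC : IsClosedPointedCone C) : IsClosed C := by
  obtain ⟨⟨F, rfl⟩, -⟩ := hC
  have : {x : Fin n → ℝ | ∀ ν ∈ F, 0 ≤ toR ν ⬝ᵥ x} =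
      ⋂ ν ∈ F, {x : Fin n → ℝ | 0 ≤ toR ν ⬝ᵥ x} := by
    ext; simp
  rw [this]
  exact isClosed_biInter fun ν _ => isClosed_le continuous_const (continuous_dot _)

theorem IsClosedPointedCone.add_mem (hC : IsClosedPointedCone C) {x y : Fin n → ℝ}
    (hx : x ∈ C) (hy : y ∈ C) : x + y ∈ C := by
  obtain ⟨⟨F, rfl⟩, -⟩ := hC
  intro ν hν
  rw [dotProduct_add]
  exact add_nonneg (hx ν hν) (hy ν hν)

theorem IsClosedPointedCone.smul_mem (hC : IsClosedPointedCone C) {x : Fin n → ℝ} {r : ℝ}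
    (hr : 0 ≤ r) (hx : x ∈ C) : r • x ∈ C := by
  obtain ⟨⟨F, rfl⟩, -⟩ := hC
  intro ν hν
  rw [dotProduct_smul]
  exact mul_nonneg hr (hx ν hν)

theorem IsClosedPointedCone.convex (hC : IsClosedPointedCone C) : Convex ℝ C :=
  fun _ hx _ hy _ _ ha hb _ => hC.add_mem (hC.smul_mem ha hx) (hC.smul_mem hb hy)

theorem IsClosedPointedCone.subset_closure_interior (hC : IsClosedPointedCone C) :
    C ⊆ closure (interior C) := by
  rw [hC.convex.closure_interior_eq_closure_of_nonempty_interior hC.2]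
  exact subset_closure

/-- A nonzero linear form that is nonnegative on `C` is positive on the interior of `C`. -/
theorem dot_pos_of_mem_interior {ν : Fin n → ℝ} (hν : ν ≠ 0) (hC : ∀ x ∈ C, 0 ≤ ν ⬝ᵥ x)
    {x : Fin n → ℝ} (hx : x ∈ interior C) : 0 < ν ⬝ᵥ x := by
  have hlim : Filter.Tendsto (fun t : ℝ => x - t • ν) (nhdsWithin 0 (Set.Ioi 0)) (nhds x) := by
    have : Continuous fun t : ℝ => x - t • ν := by fun_prop
    have := this.tendsto 0
    simp only [zero_smul, sub_zero] at this
    exact this.mono_left nhdsWithin_le_nhds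
  obtain ⟨t, ht, ht0⟩ := ((hlim.eventually (isOpen_interior.mem_nhds hx)).and
    self_mem_nhdsWithin).exists
  have h1 := hC _ (interior_subset ht)
  rw [dotProduct_sub, dotProduct_smul, smul_eq_mul] at h1
  have h2 : 0 < ν ⬝ᵥ ν := lt_of_le_of_ne (Finset.sum_nonneg fun i _ => mul_self_nonneg _)
    (Ne.symm (by rwa [Ne, dotProduct_self_eq_zero]))
  have h3 : 0 < t := ht0
  have := mul_pos h3 h2
  linarith

/-- The supporting hyperplanes of a cone given by linear inequalities are among the hyperplanes
that belong to the inequalities. -/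
theorem IsSupporting.exists_pos_smul {F : Finset (Fin n → ℤ)}
    (hF : C = {x | ∀ ν ∈ F, 0 ≤ toR ν ⬝ᵥ x}) {ν : Fin n → ℝ} (hν : IsSupporting C ν)
    (hint : (interior C).Nonempty) :
    ∃ μ ∈ F, μ ≠ 0 ∧ ∃ r : ℝ, 0 < r ∧ ν = r • toR μ := by
  classical
  obtain ⟨hν0, hνC, hspan⟩ := hν
  -- the face cut out by `ν` contains a point on which as few `μ` as possible vanish
  have key : ∃ μ ∈ F, μ ≠ 0 ∧ ∀ x ∈ C, ν ⬝ᵥ x = 0 → toR μ ⬝ᵥ x = 0 := by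
    by_contra! hcon
    choose! g hgC hgν hgμ using hcon
    let x : Fin n → ℝ := ∑ μ ∈ F.filter (· ≠ 0), g μ
    have hxν : ν ⬝ᵥ x = 0 := by
      rw [dotProduct_sum]
      exact Finset.sum_eq_zero fun μ hμ => hgν μ (Finset.mem_filter.1 hμ).1
        (Finset.mem_filter.1 hμ).2
    have hx : ∀ μ ∈ F.filter (· ≠ 0), 0 < toR μ ⬝ᵥ x := by
      intro μ hμ
      rw [dotProduct_sum]
      have hnn : ∀ μ' ∈ F.filter (· ≠ 0), 0 ≤ toR μ ⬝ᵥ g μ' := fun μ' hμ' => by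
        have := hgC μ' (Finset.mem_filter.1 hμ').1 (Finset.mem_filter.1 hμ').2
        rw [hF] at this
        exact this μ (Finset.mem_filter.1 hμ).1
      refine Finset.sum_pos' hnn ⟨μ, hμ, lt_of_le_of_ne (hnn μ hμ) (Ne.symm ?_)⟩
      exact hgμ μ (Finset.mem_filter.1 hμ).1 (Finset.mem_filter.1 hμ).2
    have hxint : x ∈ interior C := by
      refine interior_maximal (s := C)
        (t := ⋂ μ ∈ F.filter (· ≠ 0), {y : Fin n → ℝ | 0 < toR μ ⬝ᵥ y}) ?_ ?_ ?_
      · intro y hy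
        rw [hF]
        intro μ hμ
        by_cases h0 : μ = 0
        · subst h0; simp [toR, dotProduct]
        · exact (Set.mem_iInter₂.1 hy μ (Finset.mem_filter.2 ⟨hμ, h0⟩)).le
      · exact isOpen_biInter_finset fun i _ => isOpen_lt continuous_const (continuous_dot _)
      · exact Set.mem_iInter₂.2 hx
    exact absurd hxν (dot_pos_of_mem_interior hν0 hνC hxint).ne'
  obtain ⟨μ, hμF, hμ0, hμ⟩ := key
  have hker : ∀ y : Fin n → ℝ, ν ⬝ᵥ y = 0 → toR μ ⬝ᵥ y = 0 := by
    have hs : ∀ y ∈ Submodule.span ℝ {x | x ∈ C ∧ ν ⬝ᵥ x = 0}, toR μ ⬝ᵥ y = 0 := by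
      intro y hy
      induction hy using Submodule.span_induction with
      | mem x hx => exact hμ x hx.1 hx.2
      | zero => exact dotProduct_zero _
      | add x y _ _ hx hy => rw [dotProduct_add, hx, hy, add_zero]
      | smul r x _ hx => rw [dotProduct_smul, hx, smul_zero]
    exact fun y hy => hs y (hspan y hy)
  have hνν : ν ⬝ᵥ ν ≠ 0 := by rwa [Ne, dotProduct_self_eq_zero]
  obtain ⟨c, hc⟩ : ∃ c : ℝ, toR μ = c • ν := by
    refine ⟨(ν ⬝ᵥ toR μ) / (ν ⬝ᵥ ν), ?_⟩
    have h1 : ν ⬝ᵥ (toR μ - ((ν ⬝ᵥ toR μ) / (ν ⬝ᵥ ν)) • ν) = 0 := by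
      rw [dotProduct_sub, dotProduct_smul, smul_eq_mul, div_mul_cancel₀ _ hνν, sub_self]
    rw [← sub_eq_zero, ← dotProduct_self_eq_zero, sub_dotProduct, hker _ h1, smul_dotProduct, h1]
    simp
  obtain ⟨x, hx⟩ := hint
  have hx1 := dot_pos_of_mem_interior hν0 hνC hx
  have hμ0' : toR μ ≠ 0 := fun h => hμ0 (toR_injective (by rw [h]; funext k; simp [toR]))
  have hx2 := dot_pos_of_mem_interior (C := C) hμ0'
    (fun y hy => by rw [hF] at hy; exact hy μ hμF) hx
  rw [hc, smul_dotProduct, smul_eq_mul] at hx2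
  have hc0 : 0 < c := pos_of_mul_pos_left hx2 hx1.le
  exact ⟨μ, hμF, hμ0, c⁻¹, inv_pos.2 hc0, by rw [hc, smul_smul, inv_mul_cancel₀ hc0.ne', one_smul]⟩

end Pointed

/-! ### Piecewise quasipolynomiality on an arrangement of hyperplanes -/

section Arrangement

variable {n N : ℕ}

/-- The point `x` lies on none of the hyperplanes with normals in `H`. -/
def IsGeneric (H : Finset (Fin n → ℤ)) (x : Fin n → ℝ) : Prop := ∀ ν ∈ H, toR ν ⬝ᵥ x ≠ 0

/-- The closed cell of the arrangement `H` that contains the generic point `x`. -/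
def cell (H : Finset (Fin n → ℤ)) (x : Fin n → ℝ) : Set (Fin n → ℝ) :=
  {y | ∀ ν ∈ H, 0 ≤ (toR ν ⬝ᵥ x) * (toR ν ⬝ᵥ y)}

/-- The cone of the `α i`, `i ∈ S`, is a union of closed cells of the arrangement `H`, up to
points that are not generic, and the partition function is a quasipolynomial on each of these
closed cells. -/
def IsQuasipolynomialOnCells (α : Fin N → Fin n → ℤ) (S : Finset (Fin N))
    (H : Finset (Fin n → ℤ)) : Prop :=
  0 ∉ H ∧ ∀ x ∈ coneOver S α, IsGeneric H x →
    cell H x ⊆ coneOver S α ∧ IsQuasipolynomialOn (subPartition α S) (cell H x)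

theorem dense_isGeneric {H : Finset (Fin n → ℤ)} (hH : 0 ∉ H) :
    Dense {x : Fin n → ℝ | IsGeneric H x} := by
  classical
  have := dense_generic (H.image toR) (fun h => by
    obtain ⟨ν, hν, h0⟩ := Finset.mem_image.1 h
    apply hH
    rwa [← toR_injective (a₁ := ν) (a₂ := 0) (by rw [h0]; funext k; simp [toR])])
  convert this using 1
  ext x
  simp [IsGeneric]

theorem cell_congr {H : Finset (Fin n → ℤ)} {x x' : Fin n → ℝ}
    (h : ∀ ν ∈ H, 0 < (toR ν ⬝ᵥ x) * (toR ν ⬝ᵥ x')) : cell H x = cell H x' := by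
  have hs : ∀ a b c : ℝ, 0 < a * b → (0 ≤ a * c ↔ 0 ≤ b * c) := fun a b c hab => by
    rcases mul_pos_iff.1 hab with ⟨ha, hb⟩ | ⟨ha, hb⟩
    · rw [mul_nonneg_iff_of_pos_left ha, mul_nonneg_iff_of_pos_left hb]
    · rw [← neg_mul_neg a, ← neg_mul_neg b, mul_nonneg_iff_of_pos_left (neg_pos.2 ha),
        mul_nonneg_iff_of_pos_left (neg_pos.2 hb)]
  ext y
  exact forall₂_congr fun ν hν => hs _ _ _ (h ν hν)

theorem self_mem_cell {H : Finset (Fin n → ℤ)} {x : Fin n → ℝ} : x ∈ cell H x :=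
  fun _ _ => mul_self_nonneg _

theorem cell_smul_mem {H : Finset (Fin n → ℤ)} {x y : Fin n → ℝ} {r : ℝ} (hr : 0 ≤ r)
    (hy : y ∈ cell H x) : r • y ∈ cell H x := fun ν hν => by
  rw [dotProduct_smul, smul_eq_mul, mul_left_comm]
  exact mul_nonneg hr (hy ν hν)

theorem isOpen_same_side (H : Finset (Fin n → ℤ)) (x : Fin n → ℝ) :
    IsOpen {y : Fin n → ℝ | ∀ ν ∈ H, 0 < (toR ν ⬝ᵥ x) * (toR ν ⬝ᵥ y)} := by
  have : {y : Fin n → ℝ | ∀ ν ∈ H, 0 < (toR ν ⬝ᵥ x) * (toR ν ⬝ᵥ y)} =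
      ⋂ ν ∈ H, {y : Fin n → ℝ | 0 < (toR ν ⬝ᵥ x) * (toR ν ⬝ᵥ y)} := by
    ext; simp
  rw [this]
  exact isOpen_biInter_finset fun ν _ =>
    isOpen_lt continuous_const (continuous_const.mul (continuous_dot _))

theorem self_mem_interior_cell {H : Finset (Fin n → ℤ)} {x : Fin n → ℝ} (hx : IsGeneric H x) :
    x ∈ interior (cell H x) :=
  interior_maximal (fun _ hy ν hν => (hy ν hν).le) (isOpen_same_side H x)
    fun ν hν => mul_self_pos.2 (hx ν hν)

theorem isClosed_cell (H : Finset (Fin n → ℤ)) (x : Fin n → ℝ) : IsClosed (cell H x) := by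
  have : cell H x = ⋂ ν ∈ H, {y : Fin n → ℝ | 0 ≤ (toR ν ⬝ᵥ x) * (toR ν ⬝ᵥ y)} := by
    ext; simp [cell]
  rw [this]
  exact isClosed_biInter fun ν _ =>
    isClosed_le continuous_const (continuous_const.mul (continuous_dot _))

/-- Only finitely many sets occur as cells. -/
theorem finite_cells (H : Finset (Fin n → ℤ)) : (Set.range (cell H)).Finite := by
  classical
  -- a cell is determined by the signs of the linear forms
  refine Set.Finite.subset (Set.finite_range fun s : H → SignType =>
    {y : Fin n → ℝ | ∀ ν : H, 0 ≤ ((s ν : SignType) : ℝ) * (toR (ν : Fin n → ℤ) ⬝ᵥ y)}) ?_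
  rintro _ ⟨x, rfl⟩
  refine ⟨fun ν => SignType.sign (toR (ν : Fin n → ℤ) ⬝ᵥ x), ?_⟩
  ext y
  have hs : ∀ a c : ℝ, 0 ≤ ((SignType.sign a : SignType) : ℝ) * c ↔ 0 ≤ a * c := fun a c => by
    rcases lt_trichotomy a 0 with h | h | h
    · rw [sign_neg h]
      constructor <;> intro h' <;> simp at h' ⊢ <;> nlinarith
    · simp [h]
    · rw [sign_pos h]
      simp [mul_nonneg_iff_of_pos_left h]
  constructor
  · intro h ν hν
    exact (hs _ _).1 (h ⟨ν, hν⟩)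
  · intro h ν
    exact (hs _ _).2 (h ν ν.2)

theorem IsDualBasis.isQuasipolynomialOnCells {α : Fin N → Fin n → ℤ} {S : Finset (Fin N)} {d : ℤ}
    {ν : Fin N → Fin n → ℤ} (h : IsDualBasis S α d ν) [DecidableEq (Fin n → ℤ)] :
    IsQuasipolynomialOnCells α S (S.image ν) := by
  refine ⟨fun h0 => ?_, fun x hx hgen => ?_⟩
  · obtain ⟨i, hi, hi0⟩ := Finset.mem_image.1 h0
    have := h.dot_self i hi
    rw [hi0, zero_dotProduct] at this
    exact h.pos.ne this
  · have hcell : cell (S.image ν) x ⊆ coneOver S α := by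
      intro y hy
      rw [h.coneOver_eq] at hx ⊢
      intro i hi
      have h1 := hy (ν i) (Finset.mem_image_of_mem _ hi)
      have h2 := hgen (ν i) (Finset.mem_image_of_mem _ hi)
      exact nonneg_of_mul_nonneg_right h1 (lt_of_le_of_ne (hx i hi) h2.symm)
    exact ⟨hcell, _, h.latticeIndicator_mem, fun γ hγ => h.subPartition_eq (hcell hγ)⟩

end Arrangement

/-! ### The ray through a generic point -/

section Enlarge

variable {n N : ℕ}

open Classical in
/-- The normals of the arrangement, with both orientations. -/
noncomputable def oriented (H : Finset (Fin n → ℤ)) : Finset (Fin n → ℤ) := H ∪ H.image Neg.neg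

open Classical in
/-- The refined arrangement contains, together with any two hyperplanes of `H`, the hyperplane of
those points `x` for which the line `x - t a` meets the two hyperplanes at the same time. -/
noncomputable def refineArrangement (H : Finset (Fin n → ℤ)) (a : Fin n → ℤ) :
    Finset (Fin n → ℤ) :=
  (H ∪ Finset.image₂ (fun μ μ' => (μ ⬝ᵥ a) • μ' - (μ' ⬝ᵥ a) • μ) (oriented H) (oriented H)).erase 0

variable {H : Finset (Fin n → ℤ)} {a : Fin n → ℤ} {x y : Fin n → ℝ}

theorem mem_oriented {μ : Fin n → ℤ} : μ ∈ oriented H ↔ μ ∈ H ∨ -μ ∈ H := by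
  simp only [oriented, Finset.mem_union, Finset.mem_image]
  constructor
  · rintro (h | ⟨ν, hν, rfl⟩)
    · exact Or.inl h
    · exact Or.inr (by rwa [neg_neg])
  · rintro (h | h)
    · exact Or.inl h
    · exact Or.inr ⟨_, h, neg_neg _⟩

theorem toR_neg (γ : Fin n → ℤ) : toR (-γ) = -toR γ := by
  funext k; simp [toR]

theorem oriented_ne_zero (hx : IsGeneric H x) {μ : Fin n → ℤ} (hμ : μ ∈ oriented H) :
    toR μ ⬝ᵥ x ≠ 0 := by
  rcases mem_oriented.1 hμ with h | h
  · exact hx μ h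
  · have := hx _ h
    rwa [toR_neg, neg_dotProduct, neg_ne_zero] at this

theorem oriented_nonneg (hy : y ∈ cell H x) {μ : Fin n → ℤ} (hμ : μ ∈ oriented H) :
    0 ≤ (toR μ ⬝ᵥ x) * (toR μ ⬝ᵥ y) := by
  rcases mem_oriented.1 hμ with h | h
  · exact hy μ h
  · have := hy _ h
    rwa [toR_neg, neg_dotProduct, neg_dotProduct, neg_mul_neg] at this

theorem subset_refineArrangement (hH : 0 ∉ H) : H ⊆ refineArrangement H a := by
  intro ν hν
  rw [refineArrangement, Finset.mem_erase]
  exact ⟨fun h => hH (h ▸ hν), Finset.mem_union_left _ hν⟩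

theorem IsGeneric.mono {H' : Finset (Fin n → ℤ)} (h : H ⊆ H') (hx : IsGeneric H' x) :
    IsGeneric H x := fun ν hν => hx ν (h hν)

theorem cell_anti {H' : Finset (Fin n → ℤ)} (h : H ⊆ H') : cell H' x ⊆ cell H x :=
  fun _ hy ν hν => hy ν (h hν)

/-- If two hyperplanes of the arrangement are met at the same time by the line through a generic
point, then they are equal. -/
theorem comparison_eq_zero (hx : IsGeneric (refineArrangement H a) x) {μ μ' : Fin n → ℤ}
    (hμ : μ ∈ oriented H) (hμ' : μ' ∈ oriented H)
    (h : toR ((μ ⬝ᵥ a) • μ' - (μ' ⬝ᵥ a) • μ) ⬝ᵥ x = 0) :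
    (μ ⬝ᵥ a) • μ' - (μ' ⬝ᵥ a) • μ = 0 := by
  by_contra h0
  refine hx _ ?_ h
  rw [refineArrangement, Finset.mem_erase]
  exact ⟨h0, Finset.mem_union_right _ (Finset.mem_image₂_of_mem hμ hμ')⟩

theorem comparison_nonneg (hx : IsGeneric (refineArrangement H a) x)
    (hy : y ∈ cell (refineArrangement H a) x) {μ μ' : Fin n → ℤ}
    (hμ : μ ∈ oriented H) (hμ' : μ' ∈ oriented H)
    (h : 0 ≤ toR ((μ ⬝ᵥ a) • μ' - (μ' ⬝ᵥ a) • μ) ⬝ᵥ x) :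
    0 ≤ toR ((μ ⬝ᵥ a) • μ' - (μ' ⬝ᵥ a) • μ) ⬝ᵥ y := by
  by_cases h0 : (μ ⬝ᵥ a) • μ' - (μ' ⬝ᵥ a) • μ = 0
  · rw [h0]; simp [toR, dotProduct]
  · have hmem : (μ ⬝ᵥ a) • μ' - (μ' ⬝ᵥ a) • μ ∈ refineArrangement H a := by
      rw [refineArrangement, Finset.mem_erase]
      exact ⟨h0, Finset.mem_union_right _ (Finset.mem_image₂_of_mem hμ hμ')⟩
    exact nonneg_of_mul_nonneg_right (hy _ hmem) (lt_of_le_of_ne h (hx _ hmem).symm)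

theorem comparison_dot (μ μ' : Fin n → ℤ) (z : Fin n → ℝ) :
    toR ((μ ⬝ᵥ a) • μ' - (μ' ⬝ᵥ a) • μ) ⬝ᵥ z =
      ((μ ⬝ᵥ a : ℤ) : ℝ) * (toR μ' ⬝ᵥ z) - ((μ' ⬝ᵥ a : ℤ) : ℝ) * (toR μ ⬝ᵥ z) := by
  rw [toR_sub, toR_smul, toR_smul, sub_dotProduct, smul_dotProduct, smul_dotProduct,
    smul_eq_mul, smul_eq_mul]

/-- A distinguished time `τ` on the ray `x - t a`: either the ray meets at the time `τ` a
hyperplane of the arrangement, with normal `μ` and `d = μ · a > 0`, or `τ = 0` is the starting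
time.  In both cases `τ = (μ · x) / d`. -/
def IsTimer (H : Finset (Fin n → ℤ)) (a : Fin n → ℤ) (x : Fin n → ℝ) (μ : Fin n → ℤ) (d : ℤ)
    (τ : ℝ) : Prop :=
  (μ ∈ oriented H ∧ 0 < d ∧ d = μ ⬝ᵥ a ∧ toR μ ⬝ᵥ x = τ * d) ∨ (μ = 0 ∧ d = 1 ∧ τ = 0)

theorem IsTimer.pos {μ : Fin n → ℤ} {d : ℤ} {τ : ℝ} (h : IsTimer H a x μ d τ) : 0 < d := by
  rcases h with ⟨_, h, _⟩ | ⟨_, rfl, _⟩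
  · exact h
  · exact one_pos

/-- The order of the distinguished times is the same, in the weak sense, for all points of the
cell of `x`. -/
theorem IsTimer.le (hH : 0 ∉ H) (hx : IsGeneric (refineArrangement H a) x)
    (hy : y ∈ cell (refineArrangement H a) x) {μ μ' : Fin n → ℤ} {d d' : ℤ} {τ τ' : ℝ}
    (h : IsTimer H a x μ d τ) (h' : IsTimer H a x μ' d' τ') (hle : τ ≤ τ') :
    (toR μ ⬝ᵥ y) * d' ≤ (toR μ' ⬝ᵥ y) * d := by
  have hx' := hx.mono (subset_refineArrangement (a := a) hH)
  have hy' := cell_anti (subset_refineArrangement (a := a) hH) hy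
  have hz : ∀ z : Fin n → ℝ, toR (0 : Fin n → ℤ) ⬝ᵥ z = 0 := fun z => by simp [toR, dotProduct]
  rcases h with ⟨hμ, hd, hda, hτ⟩ | ⟨rfl, rfl, rfl⟩
  · have hdR : (0 : ℝ) < d := by exact_mod_cast hd
    rcases h' with ⟨hμ', hd', hda', hτ'⟩ | ⟨rfl, rfl, rfl⟩
    · have hdR' : (0 : ℝ) < d' := by exact_mod_cast hd'
      have h1 : 0 ≤ toR ((μ ⬝ᵥ a) • μ' - (μ' ⬝ᵥ a) • μ) ⬝ᵥ x := by
        rw [comparison_dot, ← hda, ← hda', hτ, hτ']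
        have := mul_nonneg (sub_nonneg.2 hle) (mul_pos hdR hdR').le
        linarith
      have h2 := comparison_nonneg hx hy hμ hμ' h1
      rw [comparison_dot, ← hda, ← hda'] at h2
      linarith
    · rw [hz, zero_mul, Int.cast_one, mul_one]
      have h1 : toR μ ⬝ᵥ x < 0 :=
        lt_of_le_of_ne (by rw [hτ]; exact mul_nonpos_of_nonpos_of_nonneg hle hdR.le)
          (oriented_ne_zero hx' hμ)
      have h2 := oriented_nonneg hy' hμ
      exact nonpos_of_mul_nonneg_right h2 h1
  · rcases h' with ⟨hμ', hd', hda', hτ'⟩ | ⟨rfl, rfl, -⟩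
    · have hdR' : (0 : ℝ) < d' := by exact_mod_cast hd'
      rw [hz, zero_mul, Int.cast_one, mul_one]
      have h1 : 0 < toR μ' ⬝ᵥ x :=
        lt_of_le_of_ne (by rw [hτ']; exact mul_nonneg hle hdR'.le) (oriented_ne_zero hx' hμ').symm
      have h2 := oriented_nonneg hy' hμ'
      exact nonneg_of_mul_nonneg_right h2 h1
    · exact le_rfl

/-- The position of the line `y - k a` between two consecutive distinguished times, for all points
`y` of the cell of `x` at once. -/
theorem mem_cell_between (hH : 0 ∉ H) (hx : IsGeneric (refineArrangement H a) x)
    (hy : y ∈ cell (refineArrangement H a) x) {μ₁ μ₂ : Fin n → ℤ} {d₁ d₂ : ℤ} {τ₁ τ₂ m k : ℝ}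
    (h₁ : IsTimer H a x μ₁ d₁ τ₁) (h₂ : IsTimer H a x μ₂ d₂ τ₂) (hm₁ : τ₁ < m) (hm₂ : m < τ₂)
    (hno : ∀ μ d τ, IsTimer H a x μ d τ → τ ≤ τ₁ ∨ τ₂ ≤ τ)
    (hk₁ : toR μ₁ ⬝ᵥ y ≤ k * d₁) (hk₂ : k * d₂ ≤ toR μ₂ ⬝ᵥ y) :
    IsGeneric H (x - m • toR a) ∧ y - k • toR a ∈ cell H (x - m • toR a) := by
  have hx' := hx.mono (subset_refineArrangement (a := a) hH)
  have hy' := cell_anti (subset_refineArrangement (a := a) hH) hy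
  have hd₁ : (0 : ℝ) < d₁ := by exact_mod_cast h₁.pos
  have hd₂ : (0 : ℝ) < d₂ := by exact_mod_cast h₂.pos
  have key : ∀ μ ∈ oriented H, 0 < μ ⬝ᵥ a → toR μ ⬝ᵥ (x - m • toR a) ≠ 0 ∧
      0 ≤ (toR μ ⬝ᵥ (x - m • toR a)) * (toR μ ⬝ᵥ (y - k • toR a)) := by
    intro μ hμ hpos
    have hposR : (0 : ℝ) < ((μ ⬝ᵥ a : ℤ) : ℝ) := by exact_mod_cast hpos
    have ht : IsTimer H a x μ (μ ⬝ᵥ a) ((toR μ ⬝ᵥ x) / ((μ ⬝ᵥ a : ℤ) : ℝ)) :=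
      Or.inl ⟨hμ, hpos, rfl, by field_simp⟩
    rw [dotProduct_sub, dotProduct_sub, dotProduct_smul, dotProduct_smul, toR_dotProduct,
      smul_eq_mul, smul_eq_mul]
    rcases hno _ _ _ ht with h | h
    · have h3 := ht.le hH hx hy h₁ h
      have h4 : (toR μ ⬝ᵥ x) / ((μ ⬝ᵥ a : ℤ) : ℝ) < m := lt_of_le_of_lt h hm₁
      rw [div_lt_iff₀ hposR] at h4
      have h5 : (toR μ ⬝ᵥ y) * d₁ ≤ (k * ((μ ⬝ᵥ a : ℤ) : ℝ)) * d₁ := by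
        have := mul_le_mul_of_nonneg_right hk₁ hposR.le
        linarith
      have h6 := le_of_mul_le_mul_right h5 hd₁
      exact ⟨by linarith, mul_nonneg_of_nonpos_of_nonpos (by linarith) (by linarith)⟩
    · have h3 := h₂.le hH hx hy ht h
      have h4 : m < (toR μ ⬝ᵥ x) / ((μ ⬝ᵥ a : ℤ) : ℝ) := lt_of_lt_of_le hm₂ h
      rw [lt_div_iff₀ hposR] at h4
      have h5 : (k * ((μ ⬝ᵥ a : ℤ) : ℝ)) * d₂ ≤ (toR μ ⬝ᵥ y) * d₂ := by
        have := mul_le_mul_of_nonneg_right hk₂ hposR.le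
        linarith
      have h6 := le_of_mul_le_mul_right h5 hd₂
      exact ⟨by linarith, mul_nonneg (by linarith) (by linarith)⟩
  have key' : ∀ ν ∈ H, toR ν ⬝ᵥ (x - m • toR a) ≠ 0 ∧
      0 ≤ (toR ν ⬝ᵥ (x - m • toR a)) * (toR ν ⬝ᵥ (y - k • toR a)) := by
    intro ν hν
    rcases lt_trichotomy (ν ⬝ᵥ a) 0 with h | h | h
    · have := key (-ν) (mem_oriented.2 (Or.inr (by rwa [neg_neg])))
        (by rw [neg_dotProduct]; omega)
      rwa [toR_neg, neg_dotProduct, neg_dotProduct, neg_mul_neg, neg_ne_zero] at this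
    · rw [dotProduct_sub, dotProduct_sub, dotProduct_smul, dotProduct_smul, toR_dotProduct, h]
      simpa using ⟨hx' ν hν, hy' ν hν⟩
    · exact key ν (mem_oriented.2 (Or.inl hν)) h
  exact ⟨fun ν hν => (key' ν hν).1, fun ν hν => (key' ν hν).2⟩

variable {α : Fin N → Fin n → ℤ} {S : Finset (Fin N)}

/-- The line `x - t a` cannot leave the cone of the `α i`, `i ∈ S`, at a point of the cone that
lies on no hyperplane of the arrangement. -/
theorem eventually_mem_of_generic (hQ : IsQuasipolynomialOnCells α S H) {τ : ℝ}
    (hτ : x - τ • toR a ∈ coneOver S α) (hgen : IsGeneric H (x - τ • toR a)) (σ : ℝ) :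
    ∀ᶠ s in nhdsWithin (0 : ℝ) (Set.Ioi 0), x - (τ + σ * s) • toR a ∈ coneOver S α := by
  have h1 : Continuous fun s : ℝ => x - (τ + σ * s) • toR a := by fun_prop
  have h2 := h1.tendsto 0
  simp only [mul_zero, add_zero] at h2
  have h3 := h2.eventually (isOpen_interior.mem_nhds (self_mem_interior_cell hgen))
  filter_upwards [nhdsWithin_le_nhds h3] with s hs
  exact (hQ.2 _ hτ hgen).1 (interior_subset hs)

/-- The line leaves the cone in the direction `σ` only through a supporting hyperplane: if there
were a point `z` of the cone on the other side, then near the wall the cone would contain generic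
points of the cell that the line enters. -/
theorem eventually_mem_of_wall (hQ : IsQuasipolynomialOnCells α S H)
    (hx : IsGeneric (refineArrangement H a) x) {τ : ℝ} (hτ : x - τ • toR a ∈ coneOver S α)
    {μ : Fin n → ℤ} (hμ : μ ∈ oriented H) (hpos : 0 < μ ⬝ᵥ a)
    (hwall : toR μ ⬝ᵥ (x - τ • toR a) = 0) {z : Fin n → ℝ} (hz : z ∈ coneOver S α) {σ : ℝ}
    (hσ : σ * (toR μ ⬝ᵥ z) < 0) :
    ∀ᶠ s in nhdsWithin (0 : ℝ) (Set.Ioi 0), x - (τ + σ * s) • toR a ∈ coneOver S α := by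
  have hposR : (0 : ℝ) < ((μ ⬝ᵥ a : ℤ) : ℝ) := by exact_mod_cast hpos
  let u : Fin n → ℝ := x - τ • toR a
  have key : ∀ ν ∈ H, ∀ᶠ s in nhdsWithin (0 : ℝ) (Set.Ioi 0),
      0 < (toR ν ⬝ᵥ ((1 - s) • u + s • z)) * (toR ν ⬝ᵥ (x - (τ + σ * s) • toR a)) := by
    intro ν hν
    by_cases hνu : toR ν ⬝ᵥ u = 0
    · have h0 : ∀ ρ : Fin n → ℤ, toR ρ ⬝ᵥ u = 0 → toR ρ ⬝ᵥ x = τ * ((ρ ⬝ᵥ a : ℤ) : ℝ) := by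
        intro ρ hρ
        simp only [u] at hρ
        rw [dotProduct_sub, dotProduct_smul, toR_dotProduct, smul_eq_mul] at hρ
        linarith
      -- only multiples of `μ` vanish at the point where the line meets the wall
      have h1 := comparison_eq_zero hx hμ (mem_oriented.2 (Or.inl hν)) (by
        rw [comparison_dot, h0 ν hνu, h0 μ hwall]; ring)
      have hνa : ν ⬝ᵥ a ≠ 0 := by
        intro h2
        rw [h2, zero_smul, sub_zero, smul_eq_zero] at h1
        rcases h1 with h1 | h1
        · exact hpos.ne' h1
        · exact hQ.1 (h1 ▸ hν)
      have hνaR : ((ν ⬝ᵥ a : ℤ) : ℝ) ≠ 0 := by exact_mod_cast hνa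
      have h2 : ((μ ⬝ᵥ a : ℤ) : ℝ) * (toR ν ⬝ᵥ z) = ((ν ⬝ᵥ a : ℤ) : ℝ) * (toR μ ⬝ᵥ z) := by
        have := comparison_dot (a := a) μ ν z
        rw [h1] at this
        simp only [toR, dotProduct, Pi.zero_apply, Int.cast_zero, zero_mul,
          Finset.sum_const_zero] at this ⊢
        linarith
      filter_upwards [self_mem_nhdsWithin] with s hs
      have hs : 0 < s := hs
      have e1 : toR ν ⬝ᵥ ((1 - s) • u + s • z) = s * (toR ν ⬝ᵥ z) := by
        rw [dotProduct_add, dotProduct_smul, dotProduct_smul, hνu]; simp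
      have e2 : toR ν ⬝ᵥ (x - (τ + σ * s) • toR a) = -(σ * s * ((ν ⬝ᵥ a : ℤ) : ℝ)) := by
        rw [dotProduct_sub, dotProduct_smul, toR_dotProduct, h0 ν hνu, smul_eq_mul]; ring
      rw [e1, e2]
      have e3 : toR ν ⬝ᵥ z = ((ν ⬝ᵥ a : ℤ) : ℝ) * (toR μ ⬝ᵥ z) / ((μ ⬝ᵥ a : ℤ) : ℝ) := by
        rw [eq_div_iff hposR.ne', ← h2, mul_comm]
      have e4 : s * (toR ν ⬝ᵥ z) * -(σ * s * ((ν ⬝ᵥ a : ℤ) : ℝ)) =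
          (s * ((ν ⬝ᵥ a : ℤ) : ℝ)) ^ 2 * (-(σ * (toR μ ⬝ᵥ z))) / ((μ ⬝ᵥ a : ℤ) : ℝ) := by
        rw [e3]; ring
      rw [e4]
      exact div_pos (mul_pos (sq_pos_of_ne_zero (mul_ne_zero hs.ne' hνaR)) (neg_pos.2 hσ)) hposR
    · have h1 : Continuous fun s : ℝ =>
          (toR ν ⬝ᵥ ((1 - s) • u + s • z)) * (toR ν ⬝ᵥ (x - (τ + σ * s) • toR a)) :=
        ((continuous_dot _).comp (by fun_prop)).mul ((continuous_dot _).comp (by fun_prop))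
      have h2 := h1.tendsto 0
      simp only [sub_zero, one_smul, zero_smul, add_zero, mul_zero] at h2
      exact nhdsWithin_le_nhds (h2.eventually (lt_mem_nhds (mul_self_pos.2 hνu)))
  have key' := (Filter.eventually_all_finset H).2 key
  have hs1 : ∀ᶠ s in nhdsWithin (0 : ℝ) (Set.Ioi 0), s < 1 :=
    nhdsWithin_le_nhds (gt_mem_nhds one_pos)
  filter_upwards [key', hs1, self_mem_nhdsWithin] with s hs hs1 hs0
  have hy : (1 - s) • u + s • z ∈ coneOver S α :=
    add_mem_coneOver (smul_mem_coneOver (by linarith) hτ)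
      (smul_mem_coneOver (le_of_lt hs0) hz)
  have hygen : IsGeneric H ((1 - s) • u + s • z) := fun ν hν => left_ne_zero_of_mul (hs ν hν).ne'
  exact (hQ.2 _ hy hygen).1 fun ν hν => (hs ν hν).le

end Enlarge

/-! ### Adding a vector to the family -/

section EnlargeStep

variable {n N : ℕ} {H : Finset (Fin n → ℤ)} {a : Fin n → ℤ} {x : Fin n → ℝ}
  {α : Fin N → Fin n → ℤ} {S : Finset (Fin N)}

theorem floorForm_le_iff {n : ℕ} (μ γ : Fin n → ℤ) {d : ℤ} (hd : 0 < d) (k : ℤ) :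
    floorForm μ d d γ ≤ k ↔ μ ⬝ᵥ γ < k * d := by
  rw [floorForm, ← not_lt, Int.lt_iff_add_one_le, Int.le_ediv_iff_mul_le hd, not_le, add_mul,
    one_mul]
  omega

theorem le_of_floorForm_le {n : ℕ} {μ γ : Fin n → ℤ} {c d : ℤ} (hd : 0 < d) (hc : d - 1 ≤ c)
    {k : ℤ} (h : floorForm μ c d γ ≤ k) : μ ⬝ᵥ γ ≤ k * d := by
  rw [floorForm, ← not_lt, Int.lt_iff_add_one_le, Int.le_ediv_iff_mul_le hd, not_le, add_mul,
    one_mul] at h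
  omega

theorem lt_of_lt_floorForm {n : ℕ} {μ γ : Fin n → ℤ} {d : ℤ} (hd : 0 < d)
    {k : ℤ} (h : k < floorForm μ (d - 1) d γ) : k * d < μ ⬝ᵥ γ := by
  rw [floorForm, Int.lt_iff_add_one_le, Int.le_ediv_iff_mul_le hd, add_mul, one_mul] at h
  omega

theorem floorForm_le_floorForm {n : ℕ} {μ μ' γ : Fin n → ℤ} {c d d' : ℤ} (hd : 0 < d)
    (hd' : 0 < d') (hc : c ≤ d) (h : (μ ⬝ᵥ γ) * d' ≤ (μ' ⬝ᵥ γ) * d) :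
    floorForm μ c d γ ≤ floorForm μ' d' d' γ := by
  have h1 : floorForm μ c d γ ≤ floorForm μ d d γ :=
    Int.ediv_le_ediv hd (by omega)
  refine h1.trans ?_
  rw [floorForm_le_iff _ _ hd]
  have h2 := (floorForm_le_iff μ' γ hd' (floorForm μ' d' d' γ)).1 le_rfl
  have h3 := mul_lt_mul_of_pos_right h2 hd
  have h4 : (μ ⬝ᵥ γ) * d' < (floorForm μ' d' d' γ * d) * d' := by linarith
  exact lt_of_mul_lt_mul_right h4 hd'.le

theorem IsTimer.le_int {γ : Fin n → ℤ} (hH : 0 ∉ H) (hx : IsGeneric (refineArrangement H a) x)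
    (hγ : toR γ ∈ cell (refineArrangement H a) x) {μ μ' : Fin n → ℤ} {d d' : ℤ} {τ τ' : ℝ}
    (h : IsTimer H a x μ d τ) (h' : IsTimer H a x μ' d' τ') (hle : τ ≤ τ') :
    (μ ⬝ᵥ γ) * d' ≤ (μ' ⬝ᵥ γ) * d := by
  have := h.le hH hx hγ h' hle
  rw [toR_dotProduct, toR_dotProduct] at this
  exact_mod_cast this

theorem isTimer_start : IsTimer H a x 0 1 0 := Or.inr ⟨rfl, rfl, rfl⟩

/-- The times strictly between `τ₁` and `τ₂` at which the line `x - t a` meets the arrangement. -/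
noncomputable def timesBetween (H : Finset (Fin n → ℤ)) (a : Fin n → ℤ) (x : Fin n → ℝ)
    (τ₁ τ₂ : ℝ) : Finset ℝ :=
  ((oriented H).image fun μ => (toR μ ⬝ᵥ x) / ((μ ⬝ᵥ a : ℤ) : ℝ)).filter fun τ => τ₁ < τ ∧ τ < τ₂

theorem IsTimer.mem_timesBetween {μ : Fin n → ℤ} {d : ℤ} {τ τ₁ τ₂ : ℝ} (h : IsTimer H a x μ d τ)
    (h0 : 0 ≤ τ₁) (h₁ : τ₁ < τ) (h₂ : τ < τ₂) : τ ∈ timesBetween H a x τ₁ τ₂ := by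
  rcases h with ⟨hμ, hd, rfl, hτ⟩ | ⟨-, -, rfl⟩
  · have hdR : (((μ ⬝ᵥ a : ℤ)) : ℝ) ≠ 0 := by exact_mod_cast hd.ne'
    exact Finset.mem_filter.2 ⟨Finset.mem_image.2 ⟨μ, hμ, by rw [hτ]; field_simp⟩, h₁, h₂⟩
  · linarith

/-- A time in between splits the set of times into two smaller sets. -/
theorem card_timesBetween_lt {τ τ₁ τ₂ τ₁' τ₂' : ℝ} (hτ : τ ∈ timesBetween H a x τ₁ τ₂)
    (h₁ : τ₁ ≤ τ₁') (h₂ : τ₂' ≤ τ₂) (h : ¬ (τ₁' < τ ∧ τ < τ₂')) :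
    (timesBetween H a x τ₁' τ₂').card < (timesBetween H a x τ₁ τ₂).card := by
  refine Finset.card_lt_card ((Finset.ssubset_iff_of_subset fun t ht => ?_).2 ⟨τ, hτ, fun h' => ?_⟩)
  · rw [timesBetween, Finset.mem_filter] at ht ⊢
    exact ⟨ht.1, h₁.trans_lt ht.2.1, ht.2.2.trans_le h₂⟩
  · rw [timesBetween, Finset.mem_filter] at h'
    exact h h'.2

/-- Summation along the part of a ray that runs inside the cone of the `α i`, `i ∈ S`, by
induction on the number of walls met in between.  The constant `c` may be `d₁ - 1` or `d₁`, since
the point where a ray enters the cone is to be counted, but the points on the walls in between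
must not be counted twice. -/
theorem sum_along_segment (ha : a ≠ 0) (hQ : IsQuasipolynomialOnCells α S H)
    (hx : IsGeneric (refineArrangement H a) x) (m : ℕ) :
    ∀ {μ₁ μ₂ : Fin n → ℤ} {c d₁ d₂ : ℤ} {τ₁ τ₂ : ℝ}, IsTimer H a x μ₁ d₁ τ₁ →
      IsTimer H a x μ₂ d₂ τ₂ → 0 ≤ τ₁ → τ₁ < τ₂ → d₁ - 1 ≤ c → c ≤ d₁ →
      (∀ t, τ₁ ≤ t → t ≤ τ₂ → x - t • toR a ∈ coneOver S α) →
      (timesBetween H a x τ₁ τ₂).card < m →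
      SumQuasipolynomialOn (fun γ => (subPartition α S γ : ℚ)) a (cell (refineArrangement H a) x)
        (floorForm μ₁ c d₁) (floorForm μ₂ d₂ d₂) ∧
      ∀ y ∈ cell (refineArrangement H a) x, ∃ k : ℝ, 0 ≤ k ∧ y - k • toR a ∈ coneOver S α := by
  induction m with
  | zero => exact fun _ _ _ _ _ _ _ h => absurd h (Nat.not_lt_zero _)
  | succ m ih =>
    intro μ₁ μ₂ c d₁ d₂ τ₁ τ₂ h₁ h₂ h0 hlt hc hc' hin hcard
    by_cases hno : ∃ μ d τ, IsTimer H a x μ d τ ∧ τ₁ < τ ∧ τ < τ₂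
    · obtain ⟨μ, d, τ, h, hτ₁, hτ₂⟩ := hno
      have hτmem := h.mem_timesBetween h0 hτ₁ hτ₂
      have hlt₁ := card_timesBetween_lt (τ₁' := τ₁) (τ₂' := τ) hτmem le_rfl hτ₂.le
        fun h => lt_irrefl _ h.2
      have hlt₂ := card_timesBetween_lt (τ₁' := τ) (τ₂' := τ₂) hτmem hτ₁.le le_rfl
        fun h => lt_irrefl _ h.1
      have i₁ := ih h₁ h h0 hτ₁ hc hc' (fun t ht ht' => hin t ht (ht'.trans hτ₂.le)) (by omega)
      have i₂ := ih h h₂ (h0.trans hτ₁.le) hτ₂ (by omega : d - 1 ≤ d) le_rfl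
        (fun t ht ht' => hin t (hτ₁.le.trans ht) ht') (by omega)
      exact ⟨i₁.1.trans i₂.1
        (fun γ hγ => floorForm_le_floorForm h₁.pos h.pos hc' (h₁.le_int hQ.1 hx hγ h hτ₁.le))
        (fun γ hγ => floorForm_le_floorForm h.pos h₂.pos le_rfl (h.le_int hQ.1 hx hγ h₂ hτ₂.le)),
        i₁.2⟩
    · replace hno : ∀ μ d τ, IsTimer H a x μ d τ → τ ≤ τ₁ ∨ τ₂ ≤ τ := fun μ d τ h => by
        by_contra! hcon
        exact hno ⟨μ, d, τ, h, hcon⟩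
      have hm₁ : τ₁ < (τ₁ + τ₂) / 2 := by linarith
      have hm₂ : (τ₁ + τ₂) / 2 < τ₂ := by linarith
      have hd₁ : (0 : ℝ) < d₁ := by exact_mod_cast h₁.pos
      have hgen : IsGeneric H (x - ((τ₁ + τ₂) / 2) • toR a) := by
        refine (mem_cell_between (k := (toR μ₁ ⬝ᵥ x) / d₁) hQ.1 hx self_mem_cell h₁ h₂ hm₁ hm₂ hno
          ?_ ?_).1
        · field_simp; rfl
        · have h3 := h₁.le hQ.1 hx self_mem_cell h₂ hlt.le
          rw [div_mul_eq_mul_div, div_le_iff₀ hd₁]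
          exact h3
      obtain ⟨hsub, q, hq, hqf⟩ := hQ.2 _ (hin _ hm₁.le hm₂.le) hgen
      refine ⟨sumQuasipolynomialOn_of_eq ha hq h₁.pos h₂.pos (fun γ hγ => ?_)
        (fun γ hγ k hk hk' => ?_),
        fun y hy => ⟨(toR μ₁ ⬝ᵥ y) / d₁, ?_, ?_⟩⟩
      · exact floorForm_le_floorForm h₁.pos h₂.pos hc' (h₁.le_int hQ.1 hx hγ h₂ hlt.le)
      · have h3 := le_of_floorForm_le h₁.pos hc hk
        have h4 : k * d₂ ≤ μ₂ ⬝ᵥ γ := not_lt.1 fun h =>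
          absurd hk' (not_lt.2 ((floorForm_le_iff μ₂ γ h₂.pos k).2 h))
        have h5 := (mem_cell_between (k := k) hQ.1 hx hγ h₁ h₂ hm₁ hm₂ hno
          (by rw [toR_dotProduct]; exact_mod_cast h3) (by rw [toR_dotProduct]; exact_mod_cast h4)).2
        exact hqf _ (by rwa [toR_sub, toR_smul])
      · refine div_nonneg ?_ hd₁.le
        have := isTimer_start.le hQ.1 hx hy h₁ h0
        simpa [toR, dotProduct] using this
      · refine hsub (mem_cell_between hQ.1 hx hy h₁ h₂ hm₁ hm₂ hno ?_ ?_).2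
        · field_simp; rfl
        · have h3 := h₁.le hQ.1 hx hy h₂ hlt.le
          rw [div_mul_eq_mul_div, div_le_iff₀ hd₁]
          exact h3

/-- The induction step, for the cell of a point `x` whose ray `x - t a`, `a = α i`, passes through
a generic point of the cone of the `α j`, `j ∈ S`.  The new partition function is the sum of the
old one between the times at which the rays enter and leave this cone.  These times are determined
by the same hyperplanes for all points of the cell. -/
theorem quasipolynomial_of_ray {φ : Fin n → ℤ} (hφ : ∀ i, 0 < φ ⬝ᵥ α i) {i : Fin N} (hi : i ∉ S)
    (hQ : IsQuasipolynomialOnCells α S H) (hx : IsGeneric (refineArrangement H (α i)) x)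
    {t₀ : ℝ} (ht₀ : 0 ≤ t₀) (hmem : x - t₀ • toR (α i) ∈ coneOver S α)
    (hgen : IsGeneric H (x - t₀ • toR (α i))) :
    cell (refineArrangement H (α i)) x ⊆ coneOver (insert i S) α ∧
      IsQuasipolynomialOn (subPartition α (insert i S)) (cell (refineArrangement H (α i)) x) := by
  have ha : α i ≠ 0 := fun h => by have := hφ i; rw [h, dotProduct_zero] at this; omega
  have hx' := hx.mono (subset_refineArrangement (a := α i) hQ.1)
  let I : Set ℝ := {t | x - t • toR (α i) ∈ coneOver S α}
  have hIcl : IsClosed I :=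
    (isClosed_coneOver fun j _ => hφ j).preimage (by fun_prop)
  have hIconv : ∀ s ∈ I, ∀ s' ∈ I, ∀ t, s ≤ t → t ≤ s' → t ∈ I :=
    fun s hs s' hs' t h h' => mem_of_between convex_coneOver hs hs' h h'
  have hIbdd : BddAbove I := by
    refine ⟨(toR φ ⬝ᵥ x) / ((φ ⬝ᵥ α i : ℤ) : ℝ), fun t ht => ?_⟩
    have h1 := dot_nonneg_of_mem_cone (ν := toR φ)
      (fun j _ => by rw [toR_dotProduct]; exact_mod_cast (hφ j).le) ht
    have h2 : (0 : ℝ) < ((φ ⬝ᵥ α i : ℤ) : ℝ) := by exact_mod_cast hφ i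
    rw [dotProduct_sub, dotProduct_smul, toR_dotProduct, smul_eq_mul] at h1
    rw [le_div_iff₀ h2]
    linarith
  -- an end of the interval of times inside the cone is a time at which a wall is met
  have hwall : ∀ t ∈ I, ∀ σ : ℝ,
      (¬ ∀ᶠ s in nhdsWithin (0 : ℝ) (Set.Ioi 0), x - (t + σ * s) • toR (α i) ∈ coneOver S α) →
      ∃ μ, IsTimer H (α i) x μ (μ ⬝ᵥ α i) t ∧
        ∀ z ∈ coneOver S α, 0 ≤ σ * (toR μ ⬝ᵥ z) := by
    intro t ht σ hσ
    have hng : ¬ IsGeneric H (x - t • toR (α i)) := fun h =>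
      hσ (eventually_mem_of_generic hQ ht h σ)
    simp only [IsGeneric] at hng
    push Not at hng
    obtain ⟨ν, hν, hν0⟩ := hng
    have hνx := hν0
    rw [dotProduct_sub, dotProduct_smul, toR_dotProduct, smul_eq_mul, sub_eq_zero] at hνx
    have hνa : ν ⬝ᵥ α i ≠ 0 := fun h => hx' ν hν (by rw [hνx, h]; simp)
    obtain ⟨μ, hμ, hpos, hμ0⟩ : ∃ μ ∈ oriented H, 0 < μ ⬝ᵥ α i ∧
        toR μ ⬝ᵥ (x - t • toR (α i)) = 0 := by
      rcases lt_or_gt_of_ne hνa with h | h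
      · exact ⟨-ν, mem_oriented.2 (Or.inr (by rwa [neg_neg])), by rw [neg_dotProduct]; omega, by
          rw [toR_neg, neg_dotProduct, hν0, neg_zero]⟩
      · exact ⟨ν, mem_oriented.2 (Or.inl hν), h, hν0⟩
    refine ⟨μ, Or.inl ⟨hμ, hpos, rfl, ?_⟩, fun z hz => ?_⟩
    · rw [dotProduct_sub, dotProduct_smul, toR_dotProduct, smul_eq_mul] at hμ0
      linarith
    · by_contra! hcon
      exact hσ (eventually_mem_of_wall hQ hx ht hμ hpos hμ0 hz hcon)
  -- the time at which the ray leaves the cone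
  have hhi := hIcl.csSup_mem ⟨t₀, hmem⟩ hIbdd
  set hi' := sSup I with hhi'
  obtain ⟨μ₂, hμ₂, hμ₂pos⟩ := hwall hi' hhi 1 (fun h => by
    obtain ⟨s, hs, hs0⟩ := (h.and self_mem_nhdsWithin).exists
    have hs0 : 0 < s := hs0
    have := le_csSup hIbdd hs
    linarith)
  have ht₀hi : t₀ < hi' := by
    obtain ⟨s, hs, hs0⟩ :=
      ((eventually_mem_of_generic hQ hmem hgen 1).and self_mem_nhdsWithin).exists
    have hs0 : 0 < s := hs0
    have := le_csSup hIbdd hs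
    linarith
  -- the time at which the ray enters the cone
  obtain ⟨lo, μ₁, d₁, hlo0, hlolt, hloI, hμ₁, hμ₁neg⟩ : ∃ (lo : ℝ) (μ₁ : Fin n → ℤ) (d₁ : ℤ),
      0 ≤ lo ∧ lo ≤ t₀ ∧ lo ∈ I ∧ IsTimer H (α i) x μ₁ d₁ lo ∧
      ∀ γ : Fin n → ℤ, ∀ k : ℤ, 0 ≤ k → k * d₁ < μ₁ ⬝ᵥ γ →
        toR (γ - k • α i) ∉ coneOver S α := by
    by_cases h0 : (0 : ℝ) ∈ I
    · refine ⟨0, 0, 1, le_rfl, ht₀, h0, isTimer_start, fun γ k hk hlt => ?_⟩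
      rw [zero_dotProduct] at hlt
      omega
    · have hIpos : ∀ t ∈ I, 0 < t := fun t ht => by
        by_contra! hle
        exact h0 (hIconv t ht t₀ hmem 0 hle ht₀)
      have hIbdd' : BddBelow I := ⟨0, fun t ht => (hIpos t ht).le⟩
      have hlo := hIcl.csInf_mem ⟨t₀, hmem⟩ hIbdd'
      obtain ⟨μ₁, hμ₁, hμ₁neg⟩ := hwall _ hlo (-1) (fun h => by
        obtain ⟨s, hs, hs0⟩ := (h.and self_mem_nhdsWithin).exists
        have hs0 : 0 < s := hs0
        have := csInf_le hIbdd' hs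
        linarith)
      refine ⟨sInf I, μ₁, _, (hIpos _ hlo).le, csInf_le hIbdd' hmem, hlo, hμ₁,
        fun γ k _ hlt hmem => ?_⟩
      have h1 := hμ₁neg _ hmem
      rw [toR_dotProduct, dotProduct_sub, dotProduct_smul, smul_eq_mul] at h1
      have h2 : ((μ₁ ⬝ᵥ γ - k * (μ₁ ⬝ᵥ α i) : ℤ) : ℝ) ≤ 0 := by linarith
      have h3 : μ₁ ⬝ᵥ γ - k * (μ₁ ⬝ᵥ α i) ≤ 0 := by exact_mod_cast h2
      omega
  have hlt : lo < hi' := lt_of_le_of_lt hlolt ht₀hi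
  obtain ⟨⟨q, hq, hqf⟩, hcell⟩ := sum_along_segment ha hQ hx
    ((timesBetween H (α i) x lo hi').card + 1) hμ₁ hμ₂ hlo0 hlt le_rfl (by omega)
    (fun t h h' => hIconv _ hloI _ hhi t h h') (Nat.lt_succ_self _)
  refine ⟨fun y hy => ?_, q, hq, fun γ hγ => ?_⟩
  · obtain ⟨k, hk, hky⟩ := hcell y hy
    exact (mem_coneOver_insert hi).2 ⟨_, hky, k, hk, by simp⟩
  · rw [← hqf γ hγ]
    have hzero : ∀ γ, toR γ ∉ coneOver S α → subPartition α S γ = 0 := fun γ h => by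
      by_contra h'
      exact h (mem_cone_of_subPartition_ne_zero h')
    refine subPartition_insert_eq_sum hφ hi γ ?_ ?_ (fun k hk hk' => hzero _ ?_)
      (fun k hk => hzero _ ?_)
    · have h1 := isTimer_start.le_int hQ.1 hx hγ hμ₁ hlo0
      rw [zero_dotProduct, zero_mul, mul_one] at h1
      have := hμ₁.pos
      exact Int.ediv_nonneg (by omega) (by omega)
    · exact floorForm_le_floorForm hμ₁.pos hμ₂.pos (by omega) (hμ₁.le_int hQ.1 hx hγ hμ₂ hlt.le)
    · exact hμ₁neg γ k hk (lt_of_lt_floorForm hμ₁.pos hk')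
    · intro hmem
      have h1 := hμ₂pos _ hmem
      rw [one_mul, toR_dotProduct, dotProduct_sub, dotProduct_smul, smul_eq_mul] at h1
      have h2 : 0 ≤ μ₂ ⬝ᵥ γ - k * (μ₂ ⬝ᵥ α i) := by exact_mod_cast h1
      have h3 := (floorForm_le_iff μ₂ γ hμ₂.pos k).1 hk
      omega

/-- Piecewise quasipolynomiality is preserved when a vector is added to the family. -/
theorem IsQuasipolynomialOnCells.insert {φ : Fin n → ℤ} (hφ : ∀ i, 0 < φ ⬝ᵥ α i) {i : Fin N}
    (hi : i ∉ S) (hint : (interior (coneOver S α)).Nonempty)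
    (hQ : IsQuasipolynomialOnCells α S H) :
    IsQuasipolynomialOnCells α (insert i S) (refineArrangement H (α i)) := by
  refine ⟨by simp [refineArrangement], fun x hx hgen => ?_⟩
  obtain ⟨s₀, hs₀, t, ht, hxs⟩ := (mem_coneOver_insert hi).1 hx
  -- a generic point of the cone near `s₀`
  obtain ⟨s, hs, hsgen, hsx⟩ : ∃ s ∈ coneOver S α, IsGeneric H s ∧
      ∀ ν ∈ refineArrangement H (α i), 0 < (toR ν ⬝ᵥ x) * (toR ν ⬝ᵥ (s + t • toR (α i))) := by
    have hU := (isOpen_same_side (refineArrangement H (α i)) x).preimage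
      (f := fun s : Fin n → ℝ => s + t • toR (α i)) (by fun_prop)
    have hs₀U : s₀ ∈ (fun s : Fin n → ℝ => s + t • toR (α i)) ⁻¹'
        {y | ∀ ν ∈ refineArrangement H (α i), 0 < (toR ν ⬝ᵥ x) * (toR ν ⬝ᵥ y)} := by
      intro ν hν
      show 0 < (toR ν ⬝ᵥ x) * (toR ν ⬝ᵥ (s₀ + t • toR (α i)))
      rw [← hxs]
      exact mul_self_pos.2 (hgen ν hν)
    have hcl : s₀ ∈ closure (interior (coneOver S α)) := by
      rw [convex_coneOver.closure_interior_eq_closure_of_nonempty_interior hint]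
      exact subset_closure hs₀
    obtain ⟨s₁, hs₁U, hs₁⟩ := mem_closure_iff.1 hcl _ hU hs₀U
    obtain ⟨s, ⟨hsU, hsint⟩, hsgen⟩ :=
      (dense_isGeneric hQ.1).inter_open_nonempty _ (hU.inter isOpen_interior) ⟨s₁, hs₁U, hs₁⟩
    exact ⟨s, interior_subset hsint, hsgen, hsU⟩
  rw [cell_congr hsx]
  have e : s + t • toR (α i) - t • toR (α i) = s := by simp
  exact quasipolynomial_of_ray hφ hi hQ (fun ν hν => right_ne_zero_of_mul (hsx ν hν).ne') ht
    (by rwa [e]) (by rwa [e])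

end EnlargeStep

/-- The partition function of a spanning family is a quasipolynomial on the closed cells of an
arrangement of hyperplanes. -/
theorem exists_isQuasipolynomialOnCells {n N : ℕ} {α : Fin N → Fin n → ℤ} {φ : Fin n → ℤ}
    (hφ : ∀ i, 0 < φ ⬝ᵥ α i) {S : Finset (Fin N)} (hS : S.card = n)
    (hli : LinearIndependent ℤ (fun i : S => α i)) :
    ∃ H, IsQuasipolynomialOnCells α Finset.univ H := by
  classical
  obtain ⟨d, ν, h⟩ := exists_isDualBasis hS hli
  have key : ∀ R : Finset (Fin N), ∃ H, IsQuasipolynomialOnCells α (S ∪ R) H := by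
    intro R
    induction R using Finset.induction_on with
    | empty => exact ⟨_, by rw [Finset.union_empty]; exact h.isQuasipolynomialOnCells⟩
    | insert i R _ ih =>
      obtain ⟨H, hH⟩ := ih
      rw [Finset.union_insert]
      by_cases hi : i ∈ S ∪ R
      · exact ⟨H, by rwa [Finset.insert_eq_of_mem hi]⟩
      · exact ⟨_, hH.insert hφ hi
          (h.nonempty_interior.mono (interior_mono (coneOver_mono Finset.subset_union_left)))⟩
  obtain ⟨H, hH⟩ := key Finset.univ
  exact ⟨H, by rwa [Finset.union_eq_right.2 (Finset.subset_univ S)] at hH⟩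

/-! ### The wall-crossing algorithm -/

section WallCrossing

variable {n N : ℕ}

/-- The points in general position with respect to a finite list of cones are dense. -/
theorem subset_closure_inGeneralPosition {L : Set (Set (Fin n → ℝ))} (hL : L.Finite)
    (hcones : ∀ c ∈ L, IsClosedPointedCone c) {C : Set (Fin n → ℝ)} (hC : IsClosedPointedCone C) :
    C ⊆ closure {γ | γ ∈ C ∧ InGeneralPosition L γ} := by
  classical
  choose! F hF using fun c hc => (hcones c hc).1
  let M : Finset (Fin n → ℝ) := hL.toFinset.biUnion fun c => ((F c).filter (· ≠ 0)).image toR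
  have hM : (0 : Fin n → ℝ) ∉ M := by
    intro h
    simp only [M, Finset.mem_biUnion, Finset.mem_image, Finset.mem_filter] at h
    obtain ⟨c, -, μ, ⟨-, hμ⟩, h0⟩ := h
    exact hμ (toR_injective (by rw [h0]; funext k; simp [toR]))
  have hgen : ∀ γ : Fin n → ℝ, (∀ μ ∈ M, μ ⬝ᵥ γ ≠ 0) → InGeneralPosition L γ := by
    intro γ hγ c hc ν hν
    obtain ⟨μ, hμF, hμ0, r, hr, rfl⟩ := hν.exists_pos_smul (hF c hc) (hcones c hc).2
    rw [smul_dotProduct, smul_eq_mul]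
    refine mul_ne_zero hr.ne' (hγ _ ?_)
    exact Finset.mem_biUnion.2 ⟨c, hL.mem_toFinset.2 hc,
      Finset.mem_image_of_mem _ (Finset.mem_filter.2 ⟨hμF, hμ0⟩)⟩
  intro x hx
  rw [mem_closure_iff]
  intro U hU hxU
  obtain ⟨y, hyU, hy⟩ := mem_closure_iff.1 (hC.subset_closure_interior hx) U hU hxU
  obtain ⟨z, ⟨hzU, hz⟩, hzM⟩ :=
    (dense_generic M hM).inter_open_nonempty _ (hU.inter isOpen_interior) ⟨y, hyU, hy⟩
  exact ⟨z, hzU, interior_subset hz, hgen z hzM⟩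

/-- The exit walls of a subcone, with integer normals; the conditions hold for all points of the
subcone, in general position or not, since the cones are closed. -/
theorem HasUniqueExitWalls.exists_int {L : Set (Set (Fin n → ℝ))} (hL : L.Finite)
    (hcones : ∀ c ∈ L, IsClosedPointedCone c) {C C' : Set (Fin n → ℝ)}
    (hC' : IsClosedPointedCone C') {a : Fin n → ℤ} (h : HasUniqueExitWalls L (toR a) C C') :
    ∃ (r : ℕ) (c : ℕ → Set (Fin n → ℝ)) (μ : ℕ → Fin n → ℤ), c 0 = C ∧
      (∀ j ≤ r, c j ∈ L ∧ toR (μ j) ≠ 0 ∧ (∀ x ∈ c j, 0 ≤ toR (μ j) ⬝ᵥ x) ∧ 0 < μ j ⬝ᵥ a) ∧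
      (∀ x ∈ ⋃₀ L, 0 ≤ toR (μ r) ⬝ᵥ x) ∧
      ∀ γ ∈ C', (∀ j ≤ r, γ - hitTime (toR a) (toR (μ j)) γ • toR a ∈ c j) ∧
        ∀ j < r, γ - hitTime (toR a) (toR (μ j)) γ • toR a ∈ c (j + 1) ∧
          hitTime (toR a) (toR (μ j)) γ ≤ hitTime (toR a) (toR (μ (j + 1))) γ := by
  obtain ⟨r, c, ν, hc0, hc, -, hsupp, hray⟩ := h
  have hex : ∀ j, ∃ μ : Fin n → ℤ, j ≤ r → toR μ ≠ 0 ∧ ∃ ρ : ℝ, 0 < ρ ∧ ν j = ρ • toR μ := by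
    intro j
    by_cases hj : j ≤ r
    · obtain ⟨hcL, hs, -⟩ := hc j hj
      obtain ⟨F, hF⟩ := (hcones _ hcL).1
      obtain ⟨μ, -, -, ρ, hρ, hν⟩ := hs.exists_pos_smul hF (hcones _ hcL).2
      exact ⟨μ, fun _ => ⟨fun h => hs.1 (by rw [hν, h, smul_zero]), ρ, hρ, hν⟩⟩
    · exact ⟨0, fun h => absurd h hj⟩
  choose μ hμ using hex
  have hhit : ∀ j ≤ r, ∀ γ, hitTime (toR a) (ν j) γ = hitTime (toR a) (toR (μ j)) γ := by
    intro j hj γ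
    obtain ⟨-, ρ, hρ, hν⟩ := hμ j hj
    rw [hitTime, hitTime, hν, smul_dotProduct, smul_dotProduct, smul_eq_mul, smul_eq_mul,
      mul_div_mul_left _ _ hρ.ne']
  have hnn : ∀ j ≤ r, ∀ x, 0 ≤ ν j ⬝ᵥ x → 0 ≤ toR (μ j) ⬝ᵥ x := by
    intro j hj x hx
    obtain ⟨-, ρ, hρ, hν⟩ := hμ j hj
    rw [hν, smul_dotProduct, smul_eq_mul] at hx
    exact nonneg_of_mul_nonneg_right hx hρ
  have hcont : ∀ ν : Fin n → ℝ, Continuous fun γ => hitTime (toR a) ν γ := fun ν => by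
    simp only [hitTime]
    exact (continuous_dot ν).div_const _
  have hcl : ∀ P : (Fin n → ℝ) → Prop, IsClosed {γ | P γ} →
      (∀ γ ∈ C', InGeneralPosition L γ → P γ) → ∀ γ ∈ C', P γ := fun P hP h γ hγ =>
    closure_minimal (fun γ hγ => h γ hγ.1 hγ.2) hP
      (subset_closure_inGeneralPosition hL hcones hC' hγ)
  have hpos : ∀ j ≤ r, 0 < μ j ⬝ᵥ a := by
    intro j hj
    obtain ⟨-, ρ, hρ, hν⟩ := hμ j hj
    have h1 := (hc j hj).2.2
    rw [hν, smul_dotProduct, smul_eq_mul, toR_dotProduct] at h1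
    exact_mod_cast pos_of_mul_pos_right h1 hρ.le
  refine ⟨r, c, μ, hc0, fun j hj => ⟨(hc j hj).1, (hμ j hj).1,
    fun x hx => hnn j hj x ((hc j hj).2.1.2.1 x hx), hpos j hj⟩,
    fun x hx => hnn r le_rfl x (hsupp.2.1 x hx), fun γ hγ => ⟨fun j hj => ?_, fun j hj => ⟨?_, ?_⟩⟩⟩
  · refine hcl (fun γ => γ - hitTime (toR a) (toR (μ j)) γ • toR a ∈ c j) ?_ ?_ γ hγ
    · exact (hcones _ (hc j hj).1).isClosed.preimage
        (continuous_id.sub ((hcont _).smul continuous_const))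
    · intro γ hγ hgp
      rw [← hhit j hj]
      exact (hray γ hγ hgp).1 j hj
  · refine hcl (fun γ => γ - hitTime (toR a) (toR (μ j)) γ • toR a ∈ c (j + 1)) ?_ ?_ γ hγ
    · exact (hcones _ (hc (j + 1) hj).1).isClosed.preimage
        (continuous_id.sub ((hcont _).smul continuous_const))
    · intro γ hγ hgp
      rw [← hhit j hj.le]
      exact ((hray γ hγ hgp).2 j hj).1
  · refine hcl (fun γ => hitTime (toR a) (toR (μ j)) γ ≤ hitTime (toR a) (toR (μ (j + 1))) γ)
      ?_ ?_ γ hγ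
    · exact isClosed_le (hcont _) (hcont _)
    · intro γ hγ hgp
      rw [← hhit j hj.le, ← hhit (j + 1) hj]
      exact ((hray γ hγ hgp).2 j hj).2

/-- A cone `c` whose wall `μ = 0` contains a neighbourhood of a point `u` in this wall overlaps
with each convex set `K` which contains `u` and has an interior point on the side of `c`. -/
theorem inter_interior_nonempty_of_wall {K c : Set (Fin n → ℝ)} (hK : Convex ℝ K)
    (hc : IsClosedPointedCone c) {μ u p z : Fin n → ℝ} (hu : u ∈ K) (hμu : μ ⬝ᵥ u = 0)
    (hnear : ∀ᶠ y in nhds u, μ ⬝ᵥ y = 0 → y ∈ c) (hp : p ∈ c) (hμp : 0 < μ ⬝ᵥ p)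
    (hz : z ∈ interior K) (hμz : 0 < μ ⬝ᵥ z) : (c ∩ interior K).Nonempty := by
  let τ : ℝ → ℝ := fun s => s * ((μ ⬝ᵥ z) / (μ ⬝ᵥ p))
  have hcont : Continuous fun s : ℝ => (1 - s) • u + s • z - τ s • p := by
    simp only [τ]; fun_prop
  have hlim := hcont.tendsto 0
  simp only [τ, sub_zero, one_smul, zero_smul, add_zero, zero_mul] at hlim
  have h1 : ∀ᶠ s in nhdsWithin (0 : ℝ) (Set.Ioi 0), s < 1 :=
    nhdsWithin_le_nhds (gt_mem_nhds one_pos)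
  have h2 : ∀ᶠ s in nhdsWithin (0 : ℝ) (Set.Ioi 0),
      μ ⬝ᵥ ((1 - s) • u + s • z - τ s • p) = 0 → (1 - s) • u + s • z - τ s • p ∈ c :=
    nhdsWithin_le_nhds (hlim.eventually hnear)
  obtain ⟨s, ⟨hs, hs1⟩, hs0⟩ := ((h2.and h1).and self_mem_nhdsWithin).exists
  have hs0 : 0 < s := hs0
  refine ⟨(1 - s) • u + s • z, ?_, ?_⟩
  · have h2 := hs (by
      rw [dotProduct_sub, dotProduct_add, dotProduct_smul, dotProduct_smul, dotProduct_smul, hμu]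
      simp only [τ, smul_eq_mul, mul_zero, zero_add]
      field_simp
      ring)
    have h3 := hc.add_mem h2 (hc.smul_mem (r := τ s) (by simp only [τ]; positivity) hp)
    simpa [τ] using h3
  · exact hK.combo_self_interior_mem_interior hu hz (by linarith) hs0 (by ring)

/-- If all points of `C'` near `γ₀` are projected in the direction `a` to points of `c` on the
hyperplane `μ = 0`, then `c` contains a neighbourhood of the projection of `γ₀` in this
hyperplane. -/
theorem eventually_mem_of_projection {C' c : Set (Fin n → ℝ)} {a μ γ₀ : Fin n → ℝ}
    (hγ₀ : γ₀ ∈ interior C') (hμa : μ ⬝ᵥ a ≠ 0) (h : ∀ γ ∈ C', γ - hitTime a μ γ • a ∈ c) :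
    ∀ᶠ y in nhds (γ₀ - hitTime a μ γ₀ • a), μ ⬝ᵥ y = 0 → y ∈ c := by
  have hcont : Continuous fun y : Fin n → ℝ => y + hitTime a μ γ₀ • a := by fun_prop
  have hlim := hcont.tendsto (γ₀ - hitTime a μ γ₀ • a)
  rw [sub_add_cancel] at hlim
  filter_upwards [hlim.eventually (isOpen_interior.mem_nhds hγ₀)] with y hy hμy
  have h1 := h _ (interior_subset hy)
  have h2 : hitTime a μ (y + hitTime a μ γ₀ • a) = hitTime a μ γ₀ := by
    conv_lhs => rw [hitTime, dotProduct_add, dotProduct_smul, hμy, zero_add, smul_eq_mul,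
      mul_div_cancel_right₀ _ hμa]
  rwa [h2, add_sub_cancel_right] at h1

theorem dot_projection {a μ γ : Fin n → ℝ} (hμa : μ ⬝ᵥ a ≠ 0) :
    μ ⬝ᵥ (γ - hitTime a μ γ • a) = 0 := by
  rw [hitTime, dotProduct_sub, dotProduct_smul, smul_eq_mul, div_mul_cancel₀ _ hμa, sub_self]

variable {α : Fin N → Fin n → ℤ} {S : Finset (Fin N)} {φ : Fin n → ℤ}

/-- Summation along the part of the rays that runs inside one cone of the list. -/
theorem sum_in_cone {a : Fin n → ℤ} (ha : a ≠ 0) {P : (Fin n → ℤ) → ℕ} {C' c : Set (Fin n → ℝ)}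
    (hc : Convex ℝ c) (hP : IsQuasipolynomialOn P c) {μ₁ μ₂ : Fin n → ℤ} {d₁ d₂ c₁ : ℤ}
    (hd₁ : 0 < d₁) (hd₂ : 0 < d₂) (hc₁ : d₁ - 1 ≤ c₁) (hc₁' : c₁ ≤ d₁)
    (h₁ : ∀ γ ∈ C', γ - ((toR μ₁ ⬝ᵥ γ) / d₁) • toR a ∈ c)
    (h₂ : ∀ γ ∈ C', γ - ((toR μ₂ ⬝ᵥ γ) / d₂) • toR a ∈ c)
    (hle : ∀ γ ∈ C', (toR μ₁ ⬝ᵥ γ) / d₁ ≤ (toR μ₂ ⬝ᵥ γ) / d₂) :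
    SumQuasipolynomialOn (fun γ => (P γ : ℚ)) a C' (floorForm μ₁ c₁ d₁) (floorForm μ₂ d₂ d₂) ∧
      ∀ γ, toR γ ∈ C' → floorForm μ₁ c₁ d₁ γ ≤ floorForm μ₂ d₂ d₂ γ := by
  obtain ⟨q, hq, hqP⟩ := hP
  have hd₁R : (0 : ℝ) < d₁ := by exact_mod_cast hd₁
  have hd₂R : (0 : ℝ) < d₂ := by exact_mod_cast hd₂
  have hle' : ∀ γ, toR γ ∈ C' → floorForm μ₁ c₁ d₁ γ ≤ floorForm μ₂ d₂ d₂ γ := by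
    intro γ hγ
    refine floorForm_le_floorForm hd₁ hd₂ hc₁' ?_
    have h3 := hle _ hγ
    rw [div_le_div_iff₀ hd₁R hd₂R, toR_dotProduct, toR_dotProduct] at h3
    exact_mod_cast h3
  refine ⟨sumQuasipolynomialOn_of_eq ha hq hd₁ hd₂ hle' fun γ hγ k hk hk' => hqP _ ?_, hle'⟩
  rw [toR_sub, toR_smul]
  refine mem_of_between hc (h₁ _ hγ) (h₂ _ hγ) ?_ ?_
  · rw [div_le_iff₀ hd₁R, toR_dotProduct]
    exact_mod_cast le_of_floorForm_le hd₁ hc₁ hk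
  · rw [le_div_iff₀ hd₂R, toR_dotProduct]
    have : k * d₂ ≤ μ₂ ⬝ᵥ γ := not_lt.1 fun h =>
      absurd hk' (not_lt.2 ((floorForm_le_iff μ₂ γ hd₂ k).2 h))
    exact_mod_cast this

/-- A member of the current list is either contained in the region reached before the vector
`α i` was added, and the old partition function is a quasipolynomial on it, or it is contained in
the closure of the newly reached region. -/
def IsOldOrNew (α : Fin N → Fin n → ℤ) (S : Finset (Fin N)) (i : Fin N)
    (c : Set (Fin n → ℝ)) : Prop :=
  (c ⊆ coneOver S α ∧ IsQuasipolynomialOn (subPartition α S) c) ∨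
    (c ⊆ coneOver (insert i S) α ∧ ¬ (c ∩ interior (coneOver S α)).Nonempty)

/-- The partition function of the enlarged family is a quasipolynomial on each cone with a unique
choice of exit walls.  On the part of the rays outside of the old cone the old partition function
vanishes; the boundary points need care, since there it need not vanish. -/
theorem HasUniqueExitWalls.isQuasipolynomialOn (hφ : ∀ i, 0 < φ ⬝ᵥ α i) {i : Fin N} (hi : i ∉ S)
    (hint : (interior (coneOver S α)).Nonempty) {L : Set (Set (Fin n → ℝ))} (hL : L.Finite)
    (hcones : ∀ c ∈ L, IsClosedPointedCone c) (hcover : coneOver S α ⊆ ⋃₀ L)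
    (htype : ∀ c ∈ L, IsOldOrNew α S i c) {C C' : Set (Fin n → ℝ)}
    (hC' : IsClosedPointedCone C') (hsub : C' ⊆ C)
    (h : HasUniqueExitWalls L (toR (α i)) C C') :
    IsQuasipolynomialOn (subPartition α (insert i S)) C' := by
  classical
  have ha : α i ≠ 0 := fun h => by have := hφ i; rw [h, dotProduct_zero] at this; omega
  obtain ⟨r, c, μ, hc0, hc, hsupp, hray⟩ := h.exists_int hL hcones hC'
  obtain ⟨γ₀, hγ₀⟩ := hC'.2
  set K := coneOver S α with hKdef
  have hKconv : Convex ℝ K := convex_coneOver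
  have hpos : ∀ j ≤ r, (0 : ℝ) < toR (μ j) ⬝ᵥ toR (α i) := fun j hj => by
    rw [toR_dotProduct]; exact_mod_cast (hc j hj).2.2.2
  have hcpos : ∀ j ≤ r, ∃ p ∈ c j, 0 < toR (μ j) ⬝ᵥ p := fun j hj => by
    obtain ⟨p, hp⟩ := (hcones _ (hc j hj).1).2
    exact ⟨p, interior_subset hp,
      dot_pos_of_mem_interior (hc j hj).2.1 (hc j hj).2.2.1 hp⟩
  have hnear : ∀ j ≤ r, ∀ᶠ y in nhds (γ₀ - hitTime (toR (α i)) (toR (μ j)) γ₀ • toR (α i)),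
      toR (μ j) ⬝ᵥ y = 0 → y ∈ c j := fun j hj =>
    eventually_mem_of_projection hγ₀ (hpos j hj).ne' fun γ hγ => (hray γ hγ).1 j hj
  let old : ℕ → Prop := fun j => c j ⊆ K ∧ IsQuasipolynomialOn (subPartition α S) (c j)
  -- the last cone on the rays is an old one
  have hlast : old r := by
    rcases htype _ (hc r le_rfl).1 with h | ⟨hsubK', hdisj⟩
    · exact h
    · exfalso
      apply hdisj
      obtain ⟨p, hp, hμp⟩ := hcpos r le_rfl
      obtain ⟨z, hz⟩ := hint
      have hu := (hray γ₀ (interior_subset hγ₀)).1 r le_rfl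
      have huK : γ₀ - hitTime (toR (α i)) (toR (μ r)) γ₀ • toR (α i) ∈ K := by
        obtain ⟨s, hs, t, ht, hst⟩ := (mem_coneOver_insert hi).1 (hsubK' hu)
        have h1 := dot_projection (γ := γ₀) (hpos r le_rfl).ne'
        rw [hst, dotProduct_add, dotProduct_smul, smul_eq_mul] at h1
        have h2 := hsupp s (hcover hs)
        have h3 : t * (toR (μ r) ⬝ᵥ toR (α i)) = 0 :=
          le_antisymm (by linarith) (mul_nonneg ht (hpos r le_rfl).le)
        rcases mul_eq_zero.1 h3 with h4 | h4
        · rw [hst, h4, zero_smul, add_zero]; exact hs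
        · exact absurd h4 (hpos r le_rfl).ne'
      exact inter_interior_nonempty_of_wall hKconv (hcones _ (hc r le_rfl).1) huK
        (dot_projection (hpos r le_rfl).ne') (hnear r le_rfl) hp hμp hz
        (dot_pos_of_mem_interior (hc r le_rfl).2.1 (fun x hx => hsupp x (hcover hx)) hz)
  -- from the index `j₀` on, all cones on the rays are old
  have hex : ∃ j₀, j₀ ≤ r ∧ ∀ j, j₀ ≤ j → j ≤ r → old j :=
    ⟨r, le_rfl, fun j h h' => (le_antisymm h h') ▸ hlast⟩
  obtain ⟨hj₀r, hold⟩ := Nat.find_spec hex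
  have hmin : ∀ j < Nat.find hex, ¬ (j ≤ r ∧ ∀ j', j ≤ j' → j' ≤ r → old j') :=
    fun j hj => Nat.find_min hex hj
  set j₀ := Nat.find hex
  have hhit : ∀ j (γ : Fin n → ℝ), hitTime (toR (α i)) (toR (μ j)) γ =
      (toR (μ j) ⬝ᵥ γ) / ((μ j ⬝ᵥ α i : ℤ) : ℝ) := fun j γ => by
    rw [hitTime, toR_dotProduct (μ j) (α i)]
  -- the place where the rays enter the old cone, or their starting point if it is in the old cone
  obtain ⟨μs, ds, hds, hs₁, hs₂, hs₃, hs₄⟩ : ∃ (μs : Fin n → ℤ) (ds : ℤ), 0 < ds ∧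
      (∀ γ ∈ C', 0 ≤ toR μs ⬝ᵥ γ) ∧
      (∀ γ ∈ C', γ - ((toR μs ⬝ᵥ γ) / ds) • toR (α i) ∈ c j₀) ∧
      (∀ γ ∈ C', (toR μs ⬝ᵥ γ) / ds ≤ hitTime (toR (α i)) (toR (μ j₀)) γ) ∧
      ∀ γ : Fin n → ℤ, ∀ k : ℤ, 0 ≤ k → k * ds < μs ⬝ᵥ γ → toR (γ - k • α i) ∉ K := by
    have hnn : ∀ γ ∈ C', ∀ j ≤ r, 0 ≤ hitTime (toR (α i)) (toR (μ j)) γ := by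
      intro γ hγ j
      induction j with
      | zero =>
        intro h0
        refine div_nonneg ((hc 0 h0).2.2.1 γ ?_) (hpos 0 h0).le
        rw [hc0]; exact hsub hγ
      | succ j ih =>
        intro hj
        exact (ih (by omega)).trans ((hray γ hγ).2 j hj).2
    rcases Nat.eq_zero_or_pos j₀ with h0 | h0
    · have hz : ∀ z : Fin n → ℝ, toR (0 : Fin n → ℤ) ⬝ᵥ z = 0 := fun z => by simp [toR, dotProduct]
      refine ⟨0, 1, one_pos, fun γ _ => by rw [hz], fun γ hγ => ?_, fun γ hγ => ?_,
        fun γ k hk hlt => ?_⟩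
      · rw [hz, zero_div, zero_smul, sub_zero, h0, hc0]
        exact hsub hγ
      · rw [hz, zero_div]
        exact hnn γ hγ j₀ hj₀r
      · rw [zero_dotProduct] at hlt; omega
    · obtain ⟨j, hj⟩ : ∃ j, j₀ = j + 1 := ⟨j₀ - 1, by omega⟩
      have hjr : j < r := by omega
      have hnew : ¬ (c j ∩ interior K).Nonempty := by
        rcases htype _ (hc j hjr.le).1 with h | h
        · exfalso
          refine hmin j (by omega) ⟨hjr.le, fun j' h1 h2 => ?_⟩
          rcases Nat.eq_or_lt_of_le h1 with rfl | h3
          · exact h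
          · exact hold j' (by omega) h2
        · exact h.2
      have hKneg : ∀ z ∈ K, toR (μ j) ⬝ᵥ z ≤ 0 := by
        have hKint : ∀ z ∈ interior K, toR (μ j) ⬝ᵥ z ≤ 0 := by
          intro z hz
          by_contra! hμz
          obtain ⟨p, hp, hμp⟩ := hcpos j hjr.le
          refine hnew (inter_interior_nonempty_of_wall hKconv (hcones _ (hc j hjr.le).1) ?_
            (dot_projection (hpos j hjr.le).ne') (hnear j hjr.le) hp hμp hz hμz)
          refine (hold j₀ le_rfl hj₀r).1 ?_
          rw [hj]
          exact ((hray γ₀ (interior_subset hγ₀)).2 j hjr).1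
        intro z hz
        refine closure_minimal hKint (isClosed_le (continuous_dot _) continuous_const) ?_
        rw [hKconv.closure_interior_eq_closure_of_nonempty_interior hint]
        exact subset_closure hz
      refine ⟨μ j, μ j ⬝ᵥ α i, (hc j hjr.le).2.2.2, fun γ hγ => ?_, fun γ hγ => ?_, fun γ hγ => ?_,
        fun γ k hk hlt hmem => ?_⟩
      · have h1 := hnn γ hγ j hjr.le
        rw [hitTime, div_nonneg_iff] at h1
        rcases h1 with h1 | h1
        · exact h1.1
        · exact absurd h1.2 (not_le.2 (hpos j hjr.le))
      · rw [← hhit, hj]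
        exact ((hray γ hγ).2 j hjr).1
      · rw [← hhit, hj]
        exact ((hray γ hγ).2 j hjr).2
      · have h1 := hKneg _ hmem
        rw [toR_dotProduct, dotProduct_sub, dotProduct_smul, smul_eq_mul] at h1
        have h2 : μ j ⬝ᵥ γ - k * (μ j ⬝ᵥ α i) ≤ 0 := by exact_mod_cast h1
        omega
  have hsum : ∀ m, j₀ + m ≤ r →
      SumQuasipolynomialOn (fun γ => (subPartition α S γ : ℚ)) (α i) C'
        (floorForm μs (ds - 1) ds)
        (floorForm (μ (j₀ + m)) (μ (j₀ + m) ⬝ᵥ α i) (μ (j₀ + m) ⬝ᵥ α i)) ∧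
      ∀ γ, toR γ ∈ C' → floorForm μs (ds - 1) ds γ ≤
        floorForm (μ (j₀ + m)) (μ (j₀ + m) ⬝ᵥ α i) (μ (j₀ + m) ⬝ᵥ α i) γ := by
    intro m
    induction m with
    | zero =>
      intro _
      exact sum_in_cone ha (hcones _ (hc j₀ hj₀r).1).convex (hold j₀ le_rfl hj₀r).2 hds
        (hc j₀ hj₀r).2.2.2 le_rfl (by omega) hs₂
        (fun γ hγ => by rw [← hhit]; exact (hray γ hγ).1 j₀ hj₀r)
        (fun γ hγ => by rw [← hhit]; exact hs₃ γ hγ)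
    | succ m ih =>
      intro hm
      have hm' : j₀ + m < r := by omega
      obtain ⟨i₁, i₂⟩ := ih hm'.le
      have i₃ := sum_in_cone ha (hcones _ (hc (j₀ + m + 1) hm).1).convex
        (hold (j₀ + m + 1) (by omega) hm).2 (hc (j₀ + m) hm'.le).2.2.2
        (hc (j₀ + m + 1) hm).2.2.2 (c₁ := μ (j₀ + m) ⬝ᵥ α i) (by omega) le_rfl
        (fun γ hγ => by rw [← hhit]; exact ((hray γ hγ).2 (j₀ + m) hm').1)
        (fun γ hγ => by rw [← hhit]; exact (hray γ hγ).1 (j₀ + m + 1) hm)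
        (fun γ hγ => by rw [← hhit, ← hhit]; exact ((hray γ hγ).2 (j₀ + m) hm').2)
      exact ⟨i₁.trans i₃.1 i₂ i₃.2, fun γ hγ => (i₂ γ hγ).trans (i₃.2 γ hγ)⟩
  obtain ⟨⟨q, hq, hqf⟩, hle⟩ := hsum (r - j₀) (by omega)
  rw [show j₀ + (r - j₀) = r by omega] at hqf hle
  refine ⟨q, hq, fun γ hγ => ?_⟩
  rw [← hqf γ hγ]
  have hzero : ∀ γ, toR γ ∉ K → subPartition α S γ = 0 := fun γ h => by
    by_contra h'
    exact h (mem_cone_of_subPartition_ne_zero h')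
  refine subPartition_insert_eq_sum hφ hi γ ?_ (hle γ hγ) (fun k hk hk' => hzero _ ?_)
    (fun k hk => hzero _ ?_)
  · have h1 := hs₁ _ hγ
    rw [toR_dotProduct] at h1
    have h2 : 0 ≤ μs ⬝ᵥ γ := by exact_mod_cast h1
    exact Int.ediv_nonneg (by omega) (by omega)
  · exact hs₄ γ k hk (lt_of_lt_floorForm hds hk')
  · intro hmem
    have h1 := hsupp _ (hcover hmem)
    rw [toR_dotProduct, dotProduct_sub, dotProduct_smul, smul_eq_mul] at h1
    have h2 : 0 ≤ μ r ⬝ᵥ γ - k * (μ r ⬝ᵥ α i) := by exact_mod_cast h1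
    have h3 := (floorForm_le_iff (μ r) γ (hc r le_rfl).2.2.2 k).1 hk
    omega

/-- The list of cones of the wall-crossing algorithm covers the region reached so far, and the
partition function is a quasipolynomial on each of its cones. -/
structure IsAdaptedList (α : Fin N → Fin n → ℤ) (S : Finset (Fin N))
    (𝒞 : Set (Set (Fin n → ℝ))) : Prop where
  interior_nonempty : (interior (coneOver S α)).Nonempty
  finite : 𝒞.Finite
  cones : ∀ C ∈ 𝒞, IsClosedPointedCone C
  subset : ∀ C ∈ 𝒞, C ⊆ coneOver S α
  cover : coneOver S α ⊆ ⋃₀ 𝒞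
  quasi : ∀ C ∈ 𝒞, IsQuasipolynomialOn (subPartition α S) C

/-- What is true for the current list at each moment while the vector `α i` is processed. -/
theorem IsAdaptedList.stage (hφ : ∀ i, 0 < φ ⬝ᵥ α i) {i : Fin N} (hi : i ∉ S)
    {𝒞 𝒩 : Set (Set (Fin n → ℝ))} (h𝒞 : IsAdaptedList α S 𝒞)
    (h𝒩 : IsSubdivision (closure (coneOver (insert i S) α \ coneOver S α)) 𝒩)
    {pending computed : Set (Set (Fin n → ℝ))}
    (h : Stage (𝒞 ∪ 𝒩) (toR (α i)) pending computed) :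
    (pending ∪ computed).Finite ∧ (∀ C ∈ pending ∪ computed, IsClosedPointedCone C) ∧
      (∀ C ∈ pending ∪ computed, IsOldOrNew α S i C) ∧
      coneOver (insert i S) α ⊆ ⋃₀ (pending ∪ computed) ∧
      ∀ C ∈ computed, IsQuasipolynomialOn (subPartition α (insert i S)) C := by
  induction h with
  | start =>
    refine ⟨?_, ?_, ?_, ?_, fun C hC => absurd hC (Set.notMem_empty C)⟩
    · rw [Set.union_empty]; exact h𝒞.finite.union h𝒩.1
    · rintro C ((hC | hC) | hC)
      · exact h𝒞.cones C hC
      · exact h𝒩.2.1 C hC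
      · exact absurd hC (Set.notMem_empty C)
    · rintro C ((hC | hC) | hC)
      · exact Or.inl ⟨h𝒞.subset C hC, h𝒞.quasi C hC⟩
      · have hC' : C ⊆ closure (coneOver (insert i S) α \ coneOver S α) := by
          rw [← h𝒩.2.2.1]; exact Set.subset_sUnion_of_mem hC
        refine Or.inr ⟨hC'.trans (closure_minimal Set.sdiff_subset
          (isClosed_coneOver fun j _ => hφ j)), ?_⟩
        rintro ⟨x, hx, hxK⟩
        obtain ⟨y, hy, hy'⟩ := mem_closure_iff.1 (hC' hx) _ isOpen_interior hxK
        exact hy'.2 (interior_subset hy)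
      · exact absurd hC (Set.notMem_empty C)
    · intro x hx
      rw [Set.union_empty, Set.sUnion_union]
      by_cases hxS : x ∈ coneOver S α
      · exact Or.inl (h𝒞.cover hxS)
      · refine Or.inr ?_
        rw [h𝒩.2.2.1]
        exact subset_closure ⟨hx, hxS⟩
  | process pending computed L C _ hCp hL hexit ih =>
    obtain ⟨hfin, hcones, htype, hcover, hquasi⟩ := ih
    have hsub : ∀ C' ∈ L, C' ⊆ C := fun C' hC' => by
      rw [← hL.2.2.1]; exact Set.subset_sUnion_of_mem hC'
    have hmem : ∀ D ∈ pending \ {C} ∪ (computed ∪ L), D ∈ pending ∪ computed ∨ D ∈ L := by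
      rintro D (hD | hD | hD)
      · exact Or.inl (Or.inl hD.1)
      · exact Or.inl (Or.inr hD)
      · exact Or.inr hD
    refine ⟨?_, ?_, ?_, ?_, ?_⟩
    · exact (hfin.union hL.1).subset fun D hD => hmem D hD
    · intro D hD
      rcases hmem D hD with h | h
      · exact hcones D h
      · exact hL.2.1 D h
    · intro D hD
      rcases hmem D hD with h | h
      · exact htype D h
      · rcases htype C (Or.inl hCp) with ⟨h1, q, hq, hqf⟩ | ⟨h1, h2⟩
        · exact Or.inl ⟨(hsub D h).trans h1, q, hq, fun γ hγ => hqf γ (hsub D h hγ)⟩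
        · exact Or.inr ⟨(hsub D h).trans h1,
            fun h3 => h2 (h3.mono (Set.inter_subset_inter_left _ (hsub D h)))⟩
    · intro x hx
      obtain ⟨D, hD, hxD⟩ := hcover hx
      by_cases hDC : D = C
      · subst hDC
        rw [← hL.2.2.1] at hxD
        obtain ⟨D', hD', hxD'⟩ := hxD
        exact ⟨D', Or.inr (Or.inr hD'), hxD'⟩
      · rcases hD with hD | hD
        · exact ⟨D, Or.inl ⟨hD, hDC⟩, hxD⟩
        · exact ⟨D, Or.inr (Or.inl hD), hxD⟩
    · rintro D (hD | hD)
      · exact hquasi D hD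
      · exact (hexit D hD).isQuasipolynomialOn hφ hi h𝒞.interior_nonempty hfin hcones
          ((coneOver_mono (Finset.subset_insert i S)).trans hcover) htype (hL.2.1 D hD) (hsub D hD)

/-- The partition function of the vectors that have been processed is a quasipolynomial on each
cone of the wall-crossing algorithm. -/
theorem WallCrossing.isAdaptedList (hφ : ∀ i, 0 < φ ⬝ᵥ α i) {𝒞 : Set (Set (Fin n → ℝ))}
    (h : WallCrossing α S 𝒞) : IsAdaptedList α S 𝒞 := by
  induction h with
  | init S hS hli =>
    obtain ⟨d, ν, hν⟩ := exists_isDualBasis hS hli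
    refine ⟨hν.nonempty_interior, Set.finite_singleton _, ?_, ?_, ?_, ?_⟩
    · rintro _ rfl; exact isClosedPointedCone_coneOver hS hli
    · rintro _ rfl; exact subset_rfl
    · rw [Set.sUnion_singleton]
    · rintro _ rfl
      exact ⟨_, hν.latticeIndicator_mem, fun γ hγ => hν.subPartition_eq hγ⟩
  | add S i 𝒞 𝒩 𝒞' _ hi h𝒩 hst ih =>
    obtain ⟨hfin, hcones, htype, hcover, hquasi⟩ := ih.stage hφ hi h𝒩 hst
    rw [Set.empty_union] at hfin hcones htype hcover
    refine ⟨ih.interior_nonempty.mono (interior_mono (coneOver_mono (Finset.subset_insert i S))),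
      hfin, hcones, fun C hC => ?_, hcover, hquasi⟩
    rcases htype C hC with h | h
    · exact h.1.trans (coneOver_mono (Finset.subset_insert i S))
    · exact h.1

end WallCrossing

/-! ### The action of Laurent polynomials on functions -/

section Action

variable {n : ℕ}

/-- Translation of functions on `ℤⁿ`, as a representation of the group of monomials. -/
noncomputable def translation (n : ℕ) :
    Multiplicative (Fin n → ℤ) →* Module.End ℚ ((Fin n → ℤ) → ℚ) where
  toFun δ := LinearMap.funLeft ℚ ℚ fun γ => γ - δ.toAdd
  map_one' := by ext f γ; simp [LinearMap.funLeft_apply]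
  map_mul' δ δ' := by
    ext f γ
    simp only [Module.End.mul_apply, LinearMap.funLeft_apply, toAdd_mul, sub_add_eq_sub_sub]

/-- Laurent polynomials act on all functions on `ℤⁿ`, considered as formal series. -/
noncomputable def act (n : ℕ) : Laurent n →ₐ[ℚ] Module.End ℚ ((Fin n → ℤ) → ℚ) :=
  AddMonoidAlgebra.lift ℚ _ _ (translation n)

theorem act_mono (δ : Fin n → ℤ) (f : (Fin n → ℤ) → ℚ) (γ : Fin n → ℤ) :
    act n (mono δ) f γ = f (γ - δ) := by
  rw [act, mono, AddMonoidAlgebra.lift_single, one_smul]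
  rfl

theorem act_apply (p : Laurent n) (f : (Fin n → ℤ) → ℚ) (γ : Fin n → ℤ) :
    act n p f γ = p.coeff.sum fun δ c => c * f (γ - δ) := by
  rw [act, AddMonoidAlgebra.lift_apply, Finsupp.sum, LinearMap.sum_apply, Finset.sum_apply]
  rfl

theorem act_one_sub_mono (β : Fin n → ℤ) (f : (Fin n → ℤ) → ℚ) (γ : Fin n → ℤ) :
    act n (1 - mono β) f γ = f γ - f (γ - β) := by
  rw [map_sub, map_one, LinearMap.sub_apply, Pi.sub_apply, act_mono]
  rfl

/-- The support of `f` is contained in a half-space `φ ≥ B`. -/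
def IsBoundedBelow (φ : Fin n → ℤ) (f : (Fin n → ℤ) → ℚ) : Prop :=
  ∃ B : ℤ, ∀ γ, f γ ≠ 0 → B ≤ φ ⬝ᵥ γ

variable {φ : Fin n → ℤ} {f g : (Fin n → ℤ) → ℚ}

theorem IsBoundedBelow.add (hf : IsBoundedBelow φ f) (hg : IsBoundedBelow φ g) :
    IsBoundedBelow φ (f + g) := by
  obtain ⟨B, hB⟩ := hf
  obtain ⟨B', hB'⟩ := hg
  refine ⟨min B B', fun γ h => ?_⟩
  by_cases h' : f γ = 0
  · exact (min_le_right _ _).trans (hB' γ fun h'' => h (by simp [h', h'']))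
  · exact (min_le_left _ _).trans (hB γ h')

theorem IsBoundedBelow.neg (hf : IsBoundedBelow φ f) : IsBoundedBelow φ (-f) := by
  obtain ⟨B, hB⟩ := hf
  exact ⟨B, fun γ h => hB γ (by simpa using h)⟩

theorem isBoundedBelow_zero : IsBoundedBelow φ 0 := ⟨0, fun _ h => absurd rfl h⟩

theorem IsBoundedBelow.act (hf : IsBoundedBelow φ f) (p : Laurent n) :
    IsBoundedBelow φ (act n p f) := by
  obtain ⟨B, hB⟩ := hf
  obtain ⟨B', hB'⟩ : ∃ B' : ℤ, ∀ δ ∈ p.coeff.support, B' ≤ φ ⬝ᵥ δ := by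
    obtain ⟨B', hB'⟩ := (p.coeff.support.image fun δ => φ ⬝ᵥ δ).bddBelow
    exact ⟨B', fun δ hδ => hB' (Finset.mem_coe.2 (Finset.mem_image_of_mem _ hδ))⟩
  refine ⟨B + B', fun γ h => ?_⟩
  rw [act_apply] at h
  obtain ⟨δ, hδ, hδ0⟩ := Finset.exists_ne_zero_of_sum_ne_zero h
  have h1 := hB _ (right_ne_zero_of_mul hδ0)
  have h2 := hB' δ hδ
  rw [dotProduct_sub] at h1
  omega

/-- The denominators: products of polynomials `1 - x^β` with `φ(β) > 0`. -/
noncomputable def denominators (φ : Fin n → ℤ) : Submonoid (Laurent n) :=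
  Submonoid.closure {p | ∃ β : Fin n → ℤ, 0 < φ ⬝ᵥ β ∧ p = 1 - mono β}

theorem one_sub_mono_mem {β : Fin n → ℤ} (hβ : 0 < φ ⬝ᵥ β) : 1 - mono β ∈ denominators φ :=
  Submonoid.subset_closure ⟨β, hβ, rfl⟩

theorem one_sub_mono_ne_zero {β : Fin n → ℤ} (hβ : β ≠ 0) : (1 - mono β : Laurent n) ≠ 0 := by
  intro h
  rw [sub_eq_zero, AddMonoidAlgebra.one_def, mono,
    AddMonoidAlgebra.single_left_inj one_ne_zero] at h
  exact hβ h.symm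

/-- Denominators act injectively on the functions whose support is bounded below. -/
theorem eq_zero_of_act_eq_zero {d : Laurent n} (hd : d ∈ denominators φ)
    (hf : IsBoundedBelow φ f) (h : act n d f = 0) : f = 0 := by
  induction hd using Submonoid.closure_induction generalizing f with
  | mem p hp =>
    obtain ⟨β, hβ, rfl⟩ := hp
    obtain ⟨B, hB⟩ := hf
    have hper : ∀ γ, ∀ k : ℕ, f γ = f (γ - (k : ℤ) • β) := by
      intro γ k
      induction k with
      | zero => simp
      | succ k ih =>
        have h1 := congrFun h (γ - (k : ℤ) • β)
        rw [act_one_sub_mono, Pi.zero_apply, sub_eq_zero] at h1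
        rw [ih, h1]
        congr 1
        push_cast
        module
    funext γ
    by_contra hne
    have h1 := hB (γ - ((φ ⬝ᵥ γ - B).toNat + 1 : ℕ) • β) (by
      have := hper γ ((φ ⬝ᵥ γ - B).toNat + 1)
      rw [natCast_zsmul] at this
      rwa [← this])
    have h2 : ((φ ⬝ᵥ γ - B).toNat + 1 : ℕ) ≤ (((φ ⬝ᵥ γ - B).toNat + 1 : ℕ) : ℤ) * (φ ⬝ᵥ β) :=
      le_mul_of_one_le_right (by positivity) hβ
    rw [dotProduct_sub, ← natCast_zsmul, dotProduct_smul, smul_eq_mul] at h1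
    push_cast at h1 h2
    omega
  | one => simpa using h
  | mul x y _ _ hx hy =>
    rw [map_mul, Module.End.mul_apply] at h
    exact hy hf (hx (hf.act y) h)

/-- The formal series `1`. -/
noncomputable def delta (n : ℕ) : (Fin n → ℤ) → ℚ := Pi.single 0 1

/-- The function `f`, whose support is bounded below, is the expansion of the rational function
`r`: after multiplication with a common denominator both are the same Laurent polynomial. -/
def IsExpansion (φ : Fin n → ℤ) (r : RatFun n) (f : (Fin n → ℤ) → ℚ) : Prop :=
  IsBoundedBelow φ f ∧ ∃ d ∈ denominators φ, ∃ p : Laurent n,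
    algebraMap (Laurent n) (RatFun n) d * r = algebraMap _ _ p ∧ act n d f = act n p (delta n)

theorem IsExpansion.unique {r : RatFun n} (hf : IsExpansion φ r f) (hg : IsExpansion φ r g) :
    f = g := by
  obtain ⟨hf, d, hd, p, hp, hdf⟩ := hf
  obtain ⟨hg, d', hd', p', hp', hdg⟩ := hg
  have h1 : d' * p = d * p' := by
    apply IsFractionRing.injective (Laurent n) (RatFun n)
    rw [map_mul, map_mul, ← hp, ← hp']
    ring
  have h2 : act n (d * d') (f + -g) = 0 := by
    have h3 : act n (d * d') f = act n (d * p') (delta n) := by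
      rw [mul_comm d d', ← h1, map_mul, map_mul, Module.End.mul_apply, Module.End.mul_apply, hdf]
    have h4 : act n (d * d') g = act n (d * p') (delta n) := by
      rw [map_mul, map_mul, Module.End.mul_apply, Module.End.mul_apply, hdg]
    rw [map_add, map_neg, h3, h4, add_neg_cancel]
  have h3 := eq_zero_of_act_eq_zero (Submonoid.mul_mem _ hd hd') (hf.add hg.neg) h2
  rwa [← sub_eq_add_neg, sub_eq_zero] at h3

theorem IsExpansion.add {r r' : RatFun n} (hf : IsExpansion φ r f) (hg : IsExpansion φ r' g) :
    IsExpansion φ (r + r') (f + g) := by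
  obtain ⟨hf, d, hd, p, hp, hdf⟩ := hf
  obtain ⟨hg, d', hd', p', hp', hdg⟩ := hg
  refine ⟨hf.add hg, d * d', Submonoid.mul_mem _ hd hd', d' * p + d * p', ?_, ?_⟩
  · rw [map_mul, map_add, map_mul, map_mul, ← hp, ← hp']
    ring
  · rw [map_add, map_add, LinearMap.add_apply]
    congr 1
    · rw [mul_comm d d', map_mul, map_mul, Module.End.mul_apply, Module.End.mul_apply, hdf]
    · rw [map_mul, map_mul, Module.End.mul_apply, Module.End.mul_apply, hdg]

theorem isExpansion_zero : IsExpansion φ 0 (0 : (Fin n → ℤ) → ℚ) :=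
  ⟨isBoundedBelow_zero, 1, Submonoid.one_mem _, 0, by simp, by simp⟩

theorem isExpansion_one : IsExpansion φ 1 (delta n) := by
  refine ⟨⟨0, fun γ h => ?_⟩, 1, Submonoid.one_mem _, 1, by simp, rfl⟩
  by_cases hγ : γ = 0
  · rw [hγ, dotProduct_zero]
  · exact absurd (Pi.single_eq_of_ne hγ _) h

theorem IsExpansion.multiset_sum {τ : Type} {s : Multiset τ} {r : τ → RatFun n}
    {E : τ → (Fin n → ℤ) → ℚ} (h : ∀ p ∈ s, IsExpansion φ (r p) (E p)) :
    IsExpansion φ (s.map r).sum (s.map E).sum := by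
  induction s using Multiset.induction_on with
  | empty => exact isExpansion_zero
  | cons p s ih =>
    rw [Multiset.map_cons, Multiset.map_cons, Multiset.sum_cons, Multiset.sum_cons]
    exact (h p (Multiset.mem_cons_self p s)).add
      (ih fun p' hp' => h p' (Multiset.mem_cons_of_mem hp'))

theorem IsExpansion.num_mul {r : RatFun n} (hf : IsExpansion φ r f) (num : Laurent n) :
    IsExpansion φ (algebraMap _ _ num * r) (act n num f) := by
  obtain ⟨hf, d, hd, p, hp, hdf⟩ := hf
  refine ⟨hf.act num, d, hd, num * p, ?_, ?_⟩
  · rw [map_mul, ← hp]; ring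
  · rw [← Module.End.mul_apply, ← map_mul, mul_comm d, map_mul, map_mul, Module.End.mul_apply,
      Module.End.mul_apply, hdf]

theorem algebraMap_one_sub_mono_mul_geom {β : Fin n → ℤ} (hβ : β ≠ 0) :
    algebraMap (Laurent n) (RatFun n) (1 - mono β) * geom β = 1 := by
  refine mul_inv_cancel₀ fun h => one_sub_mono_ne_zero hβ ?_
  exact IsFractionRing.injective (Laurent n) (RatFun n) (by rw [h, map_zero])

/-- The expansion of `r / (1 - x^β)` is recognized by multiplication with `1 - x^β`. -/
theorem IsExpansion.geom_mul {r : RatFun n} {β : Fin n → ℤ} (hβ : 0 < φ ⬝ᵥ β)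
    (hg : IsExpansion φ r g) (hf : IsBoundedBelow φ f) (h : act n (1 - mono β) f = g) :
    IsExpansion φ (geom β * r) f := by
  obtain ⟨-, d, hd, p, hp, hdg⟩ := hg
  refine ⟨hf, d * (1 - mono β), Submonoid.mul_mem _ hd (one_sub_mono_mem hβ), p, ?_, ?_⟩
  · have h1 := algebraMap_one_sub_mono_mul_geom (β := β)
      (fun h => by rw [h, dotProduct_zero] at hβ; omega)
    rw [map_mul, ← hp]
    linear_combination (algebraMap (Laurent n) (RatFun n) d * r) * h1
  · rw [map_mul, Module.End.mul_apply, h, hdg]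

/-- The partition function is the expansion of its generating function. -/
theorem isExpansion_partitionFunction {N : ℕ} {α : Fin N → Fin n → ℤ}
    (hφ : ∀ i, 0 < φ ⬝ᵥ α i) :
    IsExpansion φ (generatingFunction α) fun γ => (partitionFunction α γ : ℚ) := by
  classical
  have key : ∀ S : Finset (Fin N),
      IsExpansion φ (∏ i ∈ S, geom (α i)) fun γ => (subPartition α S γ : ℚ) := by
    intro S
    induction S using Finset.induction_on with
    | empty =>
      rw [Finset.prod_empty]
      convert isExpansion_one (n := n) (φ := φ) using 1
      funext γ
      have h1 : {a : Fin N → ℕ | (∀ i ∉ (∅ : Finset (Fin N)), a i = 0) ∧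
          ∑ i, (a i : ℤ) • α i = γ} = if γ = 0 then {0} else ∅ := by
        ext a
        constructor
        · rintro ⟨h1, h2⟩
          have : a = 0 := funext fun i => h1 i (Finset.notMem_empty i)
          subst this
          have h3 : γ = 0 := by rw [← h2]; simp
          rw [if_pos h3]
          rfl
        · intro h
          split_ifs at h with hγ
          · have h : a = 0 := h
            subst h
            exact ⟨fun _ _ => rfl, by rw [hγ]; simp⟩
          · exact absurd h (Set.notMem_empty _)
      rw [subPartition, h1, delta, Pi.single_apply]
      split_ifs <;> simp
    | insert i S hi ih =>
      rw [Finset.prod_insert hi]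
      refine ih.geom_mul (hφ i) ⟨0, fun γ h => ?_⟩ ?_
      · have h1 := dot_nonneg_of_mem_cone (ν := toR φ)
          (fun j _ => by rw [toR_dotProduct]; exact_mod_cast (hφ j).le)
          (mem_cone_of_subPartition_ne_zero (α := α) (S := insert i S) (γ := γ)
            (fun h' => h (by simp only [h', Nat.cast_zero])))
        rw [toR_dotProduct] at h1
        exact_mod_cast h1
      · funext γ
        rw [act_one_sub_mono, subPartition_insert hφ hi γ]
        push_cast
        ring
  have := key Finset.univ
  rwa [subPartition_univ] at this

end Action

/-! ### The expansion of a fraction with linearly independent denominators -/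

section Simplicial

variable {ι : Type} {n : ℕ} {S : Finset ι} {β : ι → Fin n → ℤ}

/-- The coefficient of `x^c` in the expansion of `1 / (1 - x)^m`. -/
def powCoeff (m : ℕ) (c : ℤ) : ℚ := if 0 ≤ c then (Nat.multichoose m c.toNat : ℚ) else 0

theorem powCoeff_sub (m : ℕ) (c : ℤ) :
    powCoeff (m + 1) c - powCoeff (m + 1) (c - 1) = powCoeff m c := by
  rcases lt_trichotomy c 0 with h | rfl | h
  · simp [powCoeff, not_le.2 h, show ¬ (1 : ℤ) ≤ c by omega]
  · simp [powCoeff]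
  · obtain ⟨k, rfl⟩ : ∃ k : ℕ, c = (k : ℤ) + 1 := ⟨(c - 1).toNat, by omega⟩
    have h1 : ((k : ℤ) + 1).toNat = k + 1 := by omega
    simp [powCoeff, h.le, h1, Nat.multichoose_succ_succ]

theorem powCoeff_zero (c : ℤ) : powCoeff 0 c = if c = 0 then 1 else 0 := by
  rcases lt_trichotomy c 0 with h | rfl | h
  · simp [powCoeff, not_le.2 h, h.ne]
  · simp [powCoeff]
  · obtain ⟨k, rfl⟩ : ∃ k : ℕ, c = (k : ℤ) + 1 := ⟨(c - 1).toNat, by omega⟩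
    have h1 : ((k : ℤ) + 1).toNat = k + 1 := by omega
    simp [powCoeff, h1, h.ne']

theorem powCoeff_eq_prod {m : ℕ} (hm : 0 < m) {c : ℤ} (hc : 0 ≤ c) :
    powCoeff m c = ∏ l ∈ Finset.Icc 1 (m - 1), ((c : ℚ) / (l : ℚ) + 1) := by
  lift c to ℕ using hc
  obtain ⟨m, rfl⟩ : ∃ k, m = k + 1 := ⟨m - 1, by omega⟩
  rw [Nat.add_sub_cancel]
  have h1 : powCoeff (m + 1) c = ((m + c).choose c : ℚ) := by
    simp [powCoeff, Nat.multichoose_eq, show m + 1 + c - 1 = m + c by omega]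
  rw [h1]
  clear h1 hm
  induction m with
  | zero => simp
  | succ m ih =>
    rw [Finset.prod_Icc_succ_top (by omega), ← ih]
    have h2 := Nat.choose_mul_succ_eq (m + c) c
    rw [show m + c + 1 - c = m + 1 by omega, show m + c + 1 = m + 1 + c by omega] at h2
    have h3 : ((m + c).choose c : ℚ) * (m + 1 + c) = (m + 1 + c).choose c * (m + 1) := by
      exact_mod_cast h2
    have h4 : (m + 1 : ℚ) ≠ 0 := by positivity
    push_cast
    field_simp
    linarith

open Classical in
/-- The coefficients of the expansion of `∏ 1 / (1 - x^{β i})^{m i}`, for linearly independent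
vectors `β i`, `i ∈ S`. -/
noncomputable def prodCoeff (S : Finset ι) (β : ι → Fin n → ℤ) (m : ι → ℕ) (γ : Fin n → ℤ) : ℚ :=
  if h : ∃ c : ι → ℤ, γ = ∑ i ∈ S, c i • β i then ∏ i ∈ S, powCoeff (m i) (h.choose i) else 0

theorem coeff_unique (hli : LinearIndependent ℤ (fun i : S => β i)) {c c' : ι → ℤ}
    (h : ∑ i ∈ S, c i • β i = ∑ i ∈ S, c' i • β i) {i : ι} (hi : i ∈ S) : c i = c' i := by
  have h1 := Fintype.linearIndependent_iff.1 hli (fun i => c i - c' i) ?_ ⟨i, hi⟩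
  · exact sub_eq_zero.1 h1
  · rw [Finset.sum_coe_sort S fun i => (c i - c' i) • β i]
    simp only [sub_smul, Finset.sum_sub_distrib, h, sub_self]

theorem prodCoeff_sum (hli : LinearIndependent ℤ (fun i : S => β i)) (m : ι → ℕ) (c : ι → ℤ) :
    prodCoeff S β m (∑ i ∈ S, c i • β i) = ∏ i ∈ S, powCoeff (m i) (c i) := by
  have h : ∃ c' : ι → ℤ, ∑ i ∈ S, c i • β i = ∑ i ∈ S, c' i • β i := ⟨c, rfl⟩
  rw [prodCoeff, dif_pos h]
  exact Finset.prod_congr rfl fun i hi => by rw [coeff_unique hli h.choose_spec hi]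

theorem prodCoeff_eq_zero {m : ι → ℕ} {γ : Fin n → ℤ} (h : ¬ ∃ c : ι → ℤ, γ = ∑ i ∈ S, c i • β i) :
    prodCoeff S β m γ = 0 := dif_neg h

theorem mem_cone_of_prodCoeff_ne_zero (hli : LinearIndependent ℤ (fun i : S => β i))
    {m : ι → ℕ} {γ : Fin n → ℤ} (h : prodCoeff S β m γ ≠ 0) : toR γ ∈ coneOver S β := by
  classical
  by_cases hγ : ∃ c : ι → ℤ, γ = ∑ i ∈ S, c i • β i
  · obtain ⟨c, rfl⟩ := hγ
    rw [prodCoeff_sum hli, Finset.prod_ne_zero_iff] at h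
    have hc : ∀ i ∈ S, 0 ≤ c i := fun i hi => by
      by_contra hneg
      exact h i hi (if_neg hneg)
    refine ⟨fun i => if i ∈ S then (c i : ℝ) else 0, fun i => ?_, ?_⟩
    · dsimp only; split_ifs with hi
      · exact_mod_cast hc i hi
      · exact le_rfl
    · rw [toR_sum]
      exact Finset.sum_congr rfl fun i hi => by
        simp only [toR_smul, if_pos hi]
  · exact absurd (prodCoeff_eq_zero hγ) h

variable {φ : Fin n → ℤ}

theorem isBoundedBelow_prodCoeff (hφ : ∀ i ∈ S, 0 < φ ⬝ᵥ β i)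
    (hli : LinearIndependent ℤ (fun i : S => β i)) (m : ι → ℕ) :
    IsBoundedBelow φ (prodCoeff S β m) := by
  refine ⟨0, fun γ h => ?_⟩
  obtain ⟨c, hc, hcγ⟩ := mem_cone_of_prodCoeff_ne_zero hli h
  have h1 : 0 ≤ toR φ ⬝ᵥ toR γ := by
    rw [hcγ, dotProduct_sum]
    refine Finset.sum_nonneg fun i hi => ?_
    rw [dotProduct_smul, toR_dotProduct]
    exact mul_nonneg (hc i) (by exact_mod_cast (hφ i hi).le)
  rw [toR_dotProduct] at h1
  exact_mod_cast h1

theorem act_prodCoeff [DecidableEq ι] (hli : LinearIndependent ℤ (fun i : S => β i)) (m : ι → ℕ)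
    {j : ι} (hj : j ∈ S) :
    act n (1 - mono (β j)) (prodCoeff S β (Function.update m j (m j + 1))) =
      prodCoeff S β m := by
  have hshift : ∀ c : ι → ℤ, ∑ i ∈ S, c i • β i - β j =
      ∑ i ∈ S, (c i - (Pi.single j 1 : ι → ℤ) i) • β i := by
    intro c
    simp only [sub_smul, Finset.sum_sub_distrib, Pi.single_apply, ite_smul, one_smul, zero_smul]
    rw [Finset.sum_ite_eq' S j, if_pos hj]
  funext γ
  rw [act_one_sub_mono]
  by_cases hγ : ∃ c : ι → ℤ, γ = ∑ i ∈ S, c i • β i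
  · obtain ⟨c, rfl⟩ := hγ
    have h1 : ∀ i ∈ S.erase j, powCoeff (Function.update m j (m j + 1) i) (c i) =
        powCoeff (m i) (c i) := fun i hi => by
      rw [Function.update_of_ne (Finset.ne_of_mem_erase hi)]
    have h2 : ∀ i ∈ S.erase j, powCoeff (Function.update m j (m j + 1) i)
        (c i - (Pi.single j 1 : ι → ℤ) i) = powCoeff (m i) (c i) := fun i hi => by
      have hij := Finset.ne_of_mem_erase hi
      rw [Function.update_of_ne hij, Pi.single_eq_of_ne hij, sub_zero]
    rw [hshift, prodCoeff_sum hli, prodCoeff_sum hli, prodCoeff_sum hli,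
      ← Finset.mul_prod_erase S _ hj, ← Finset.mul_prod_erase S _ hj,
      ← Finset.mul_prod_erase S _ hj, Finset.prod_congr rfl h1, Finset.prod_congr rfl h2,
      Function.update_self, Pi.single_eq_same, ← sub_mul, powCoeff_sub]
  · rw [prodCoeff_eq_zero hγ, prodCoeff_eq_zero hγ, prodCoeff_eq_zero, sub_zero]
    rintro ⟨c, hc⟩
    refine hγ ⟨fun i => c i + (Pi.single j 1 : ι → ℤ) i, ?_⟩
    rw [sub_eq_iff_eq_add] at hc
    rw [hc]
    simp only [add_smul, Finset.sum_add_distrib, Pi.single_apply, ite_smul, one_smul, zero_smul]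
    rw [Finset.sum_ite_eq' S j, if_pos hj]

/-- By induction on the number of factors: multiplication with `1 - x^{β j}` lowers the multiplicity
of `β j` by one. -/
theorem isExpansion_prodCoeff (hφ : ∀ i ∈ S, 0 < φ ⬝ᵥ β i)
    (hli : LinearIndependent ℤ (fun i : S => β i)) (m : ι → ℕ) :
    IsExpansion φ (∏ i ∈ S, geom (β i) ^ m i) (prodCoeff S β m) := by
  classical
  induction hk : ∑ i ∈ S, m i generalizing m with
  | zero =>
    rw [Finset.sum_eq_zero_iff] at hk
    rw [Finset.prod_congr rfl (g := fun _ => 1) fun i hi => by rw [hk i hi, pow_zero],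
      Finset.prod_const_one]
    convert isExpansion_one (n := n) (φ := φ) using 1
    funext γ
    rw [delta, Pi.single_apply]
    by_cases hγ : ∃ c : ι → ℤ, γ = ∑ i ∈ S, c i • β i
    · obtain ⟨c, rfl⟩ := hγ
      rw [prodCoeff_sum hli]
      split_ifs with h0
      · refine Finset.prod_eq_one fun i hi => ?_
        have := coeff_unique hli (c := c) (c' := fun _ => 0) (by simpa using h0) hi
        rw [hk i hi, powCoeff_zero, if_pos this]
      · obtain ⟨i, hi, hci⟩ : ∃ i ∈ S, c i ≠ 0 := by
          by_contra! hall
          exact h0 (Finset.sum_eq_zero fun i hi => by rw [hall i hi, zero_smul])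
        exact Finset.prod_eq_zero hi (by rw [hk i hi, powCoeff_zero, if_neg hci])
    · rw [prodCoeff_eq_zero hγ, if_neg]
      rintro rfl
      exact hγ ⟨0, by simp⟩
  | succ k ih =>
    obtain ⟨j, hj, hmj⟩ : ∃ j ∈ S, m j ≠ 0 :=
      Finset.exists_ne_zero_of_sum_ne_zero (by rw [hk]; exact Nat.succ_ne_zero k)
    obtain ⟨m', hm'⟩ : ∃ m' : ι → ℕ, m' = Function.update m j (m j - 1) := ⟨_, rfl⟩
    have hm'j : m' j = m j - 1 := by rw [hm', Function.update_self]
    have hm : m = Function.update m' j (m' j + 1) := by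
      rw [hm'j, hm', Function.update_idem, Nat.sub_add_cancel (Nat.pos_of_ne_zero hmj),
        Function.update_eq_self]
    have hm'i : ∀ i ∈ S.erase j, m' i = m i := fun i hi => by
      rw [hm', Function.update_of_ne (Finset.ne_of_mem_erase hi)]
    have hsum : ∑ i ∈ S, m' i = k := by
      have h1 := Finset.add_sum_erase S (fun i => m i) hj
      have h2 := Finset.add_sum_erase S (fun i => m' i) hj
      have h3 : ∑ i ∈ S.erase j, m' i = ∑ i ∈ S.erase j, m i := Finset.sum_congr rfl hm'i
      omega
    have hprod : ∏ i ∈ S, geom (β i) ^ m i = geom (β j) * ∏ i ∈ S, geom (β i) ^ m' i := by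
      rw [← Finset.mul_prod_erase S _ hj, ← Finset.mul_prod_erase S (fun i => geom (β i) ^ m' i) hj,
        Finset.prod_congr rfl fun i hi => by rw [← hm'i i hi]]
      rw [← mul_assoc, ← pow_succ']
      congr 2
      omega
    rw [hprod]
    refine (ih m' hsum).geom_mul (hφ j hj) (isBoundedBelow_prodCoeff hφ hli m) ?_
    rw [hm]
    exact act_prodCoeff hli m' hj

open Classical in
/-- The quasipolynomial that belongs to a fraction `(∑_δ p_δ x^δ) ∏ 1 / (1 - x^{β i})^{m i}`, for
an arbitrary index type; for the fractions of the algorithm it is `Fraction.expression`. -/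
noncomputable def fractionExpression (S : Finset ι) (β : ι → Fin n → ℤ) (m : ι → ℕ)
    (num : Laurent n) (γ : Fin n → ℤ) : ℚ :=
  num.coeff.sum fun δ p => p *
    (∏ i ∈ S, ∏ l ∈ Finset.Icc 1 (m i - 1),
      ((dualVector S β i ⬝ᵥ fun k => ((γ k - δ k : ℤ) : ℚ)) / (l : ℚ) + 1)) *
    latticeIndicator S β (γ - δ)

open Classical in
theorem IsDualBasis.dualVector_dot {d : ℤ} {ν : ι → Fin n → ℤ} (h : IsDualBasis S β d ν) {i : ι}
    (hi : i ∈ S) (c : ι → ℤ) :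
    dualVector S β i ⬝ᵥ (fun l => ((∑ k ∈ S, c k • β k : Fin n → ℤ) l : ℚ)) = c i := by
  have hdQ : (d : ℚ) ≠ 0 := by exact_mod_cast h.pos.ne'
  have hspec : ∀ k ∈ S, (dualVector S β i ⬝ᵥ fun j => (β k j : ℚ)) = if k = i then 1 else 0 := by
    have := Classical.epsilon_spec (p := fun b : Fin n → ℚ =>
      ∀ k ∈ S, (b ⬝ᵥ fun j => (β k j : ℚ)) = if k = i then 1 else 0)
      ⟨fun l => (ν i l : ℚ) / d, fun k hk => ?_⟩
    · intro k hk
      rw [dualVector]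
      convert this k hk
    · have h1 : ((fun l => (ν i l : ℚ) / d) ⬝ᵥ fun j => (β k j : ℚ)) =
          ((ν i ⬝ᵥ β k : ℤ) : ℚ) / d := by
        simp only [dotProduct, Int.cast_sum, Int.cast_mul, Finset.sum_div]
        exact Finset.sum_congr rfl fun l _ => by ring
      rw [h1]
      split_ifs with hki
      · rw [hki, h.dot_self i hi, div_self hdQ]
      · rw [h.dot i hi k hk (Ne.symm hki), Int.cast_zero, zero_div]
  have h2 : (fun l => ((∑ k ∈ S, c k • β k : Fin n → ℤ) l : ℚ)) =
      ∑ k ∈ S, (c k : ℚ) • fun j => (β k j : ℚ) := by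
    funext l
    simp [Finset.sum_apply]
  rw [h2, dotProduct_sum, Finset.sum_eq_single i]
  · rw [dotProduct_smul, hspec i hi, if_pos rfl, smul_eq_mul, mul_one]
  · intro k hk hki
    rw [dotProduct_smul, hspec k hk, if_neg hki, smul_zero]
  · exact fun h => absurd hi h

theorem IsDualBasis.fractionExpression_mem {d : ℤ} {ν : ι → Fin n → ℤ} (h : IsDualBasis S β d ν)
    (m : ι → ℕ) (num : Laurent n) : fractionExpression S β m num ∈ quasipolynomials n := by
  have : fractionExpression S β m num = ∑ δ ∈ num.coeff.support, num.coeff δ •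
      ((∏ i ∈ S, ∏ l ∈ Finset.Icc 1 (m i - 1), fun γ : Fin n → ℤ =>
        ((dualVector S β i ⬝ᵥ fun k => ((γ k - δ k : ℤ) : ℚ)) / (l : ℚ) + 1)) *
      fun γ => latticeIndicator S β (γ - δ)) := by
    funext γ
    rw [fractionExpression, Finsupp.sum, Finset.sum_apply]
    refine Finset.sum_congr rfl fun δ _ => ?_
    simp only [Pi.smul_apply, Pi.mul_apply, Finset.prod_apply, smul_eq_mul]
    ring
  rw [this]
  refine Subalgebra.sum_mem _ fun δ _ => Subalgebra.smul_mem _ (Subalgebra.mul_mem _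
    (Subalgebra.prod_mem _ fun i _ => Subalgebra.prod_mem _ fun l _ => ?_)
    (shift_mem h.latticeIndicator_mem δ)) _
  have h1 := Subalgebra.add_mem _ (Subalgebra.smul_mem _
    (shift_mem (linear_mem (dualVector S β i)) δ) ((l : ℚ)⁻¹)) (const_mem 1)
  convert h1 using 1
  funext γ
  simp [div_eq_inv_mul]

/-- Inside of its cone, the coefficient function is given by the quasipolynomial expression. -/
theorem IsDualBasis.prodCoeff_eq {d : ℤ} {ν : ι → Fin n → ℤ} (h : IsDualBasis S β d ν)
    (hli : LinearIndependent ℤ (fun i : S => β i)) {m : ι → ℕ} (hm : ∀ i ∈ S, 0 < m i)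
    {γ : Fin n → ℤ} (hγ : ∀ i ∈ S, 0 ≤ ν i ⬝ᵥ γ) :
    prodCoeff S β m γ = (∏ i ∈ S, ∏ l ∈ Finset.Icc 1 (m i - 1),
      ((dualVector S β i ⬝ᵥ fun k => (γ k : ℚ)) / (l : ℚ) + 1)) * latticeIndicator S β γ := by
  by_cases hmem : ∃ c : ι → ℤ, γ = ∑ i ∈ S, c i • β i
  · rw [latticeIndicator, if_pos (mem_span_image_iff.2 hmem), mul_one]
    obtain ⟨c, rfl⟩ := hmem
    rw [prodCoeff_sum hli]
    refine Finset.prod_congr rfl fun i hi => ?_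
    have hc : 0 ≤ c i := by
      have := hγ i hi
      rw [h.dot_sum c hi] at this
      exact nonneg_of_mul_nonneg_right this h.pos
    rw [powCoeff_eq_prod (hm i hi) hc, h.dualVector_dot hi]
  · rw [latticeIndicator, if_neg (fun h' => hmem (mem_span_image_iff.1 h')), mul_zero,
      prodCoeff_eq_zero hmem]

/-- A simplicial cone with interior points has `n` generators. -/
theorem card_eq_of_nonempty_interior (hli : LinearIndependent ℤ (fun i : S => β i))
    (hint : (interior (coneOver S β)).Nonempty) : S.card = n := by
  classical
  apply le_antisymm
  · have := hli.fintype_card_le_finrank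
    simpa using this
  · have hsub : coneOver S β ⊆ Submodule.span ℝ ((S.image fun i => toR (β i) : Finset _) :
        Set (Fin n → ℝ)) := by
      rintro _ ⟨c, -, rfl⟩
      refine Submodule.sum_mem _ fun i hi => Submodule.smul_mem _ _ (Submodule.subset_span ?_)
      exact Finset.mem_coe.2 (Finset.mem_image_of_mem _ hi)
    have htop := Submodule.eq_top_of_nonempty_interior' _ (hint.mono (interior_mono hsub))
    have h1 := finrank_span_finset_le_card (R := ℝ) (S.image fun i => toR (β i))
    rw [Set.finrank, htop, finrank_top, Module.finrank_fin_fun] at h1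
    exact h1.trans Finset.card_image_le

/-- The behaviour of the expansion of a fraction with linearly independent denominators along a
ray whose direction is not on the boundary of the cone of the fraction. -/
theorem eventually_act_prodCoeff (hφ : ∀ i ∈ S, 0 < φ ⬝ᵥ β i)
    (hli : LinearIndependent ℤ (fun i : S => β i)) {m : ι → ℕ} (hm : ∀ i ∈ S, 0 < m i)
    (num : Laurent n) {w : Fin n → ℤ} (hw : toR w ∉ frontier (coneOver S β)) :
    (toR w ∈ coneOver S β → fractionExpression S β m num ∈ quasipolynomials n ∧
      ∀ γ : Fin n → ℤ, ∀ᶠ t : ℕ in Filter.atTop,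
        act n num (prodCoeff S β m) (γ + (t : ℤ) • w) =
          fractionExpression S β m num (γ + (t : ℤ) • w)) ∧
    (toR w ∉ coneOver S β → ∀ γ : Fin n → ℤ, ∀ᶠ t : ℕ in Filter.atTop,
        act n num (prodCoeff S β m) (γ + (t : ℤ) • w) = 0) := by
  have hcl := isClosed_coneOver (S := S) (β := β) hφ
  constructor
  · intro hwc
    have hwi : toR w ∈ interior (coneOver S β) := by
      by_contra hni
      exact hw ⟨subset_closure hwc, hni⟩
    have hcard := card_eq_of_nonempty_interior hli ⟨_, hwi⟩
    obtain ⟨d, ν, h⟩ := exists_isDualBasis hcard hli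
    refine ⟨h.fractionExpression_mem m num, fun γ => ?_⟩
    have hpos : ∀ i ∈ S, 0 < ν i ⬝ᵥ w := by
      intro i hi
      have h0 : toR (ν i) ≠ 0 := fun h0 => by
        have h1 := h.dot_self i hi
        have h2 : ν i = 0 := toR_injective (by rw [h0]; funext k; simp [toR])
        rw [h2, zero_dotProduct] at h1
        exact h.pos.ne h1
      have h1 := dot_pos_of_mem_interior h0
        (fun x hx => by rw [h.coneOver_eq] at hx; exact hx i hi) hwi
      rw [toR_dotProduct] at h1
      exact_mod_cast h1
    have hev : ∀ᶠ t : ℕ in Filter.atTop, ∀ δ ∈ num.coeff.support, ∀ i ∈ S,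
        0 ≤ ν i ⬝ᵥ (γ + (t : ℤ) • w - δ) := by
      rw [Filter.eventually_all_finset]
      intro δ _
      rw [Filter.eventually_all_finset]
      intro i hi
      filter_upwards [Filter.eventually_ge_atTop (ν i ⬝ᵥ (δ - γ)).toNat] with t ht
      rw [dotProduct_sub, dotProduct_add, dotProduct_smul, smul_eq_mul]
      have h1 : (t : ℤ) ≤ t * (ν i ⬝ᵥ w) := le_mul_of_one_le_right (by positivity) (hpos i hi)
      rw [dotProduct_sub] at ht
      omega
    filter_upwards [hev] with t ht
    rw [act_apply, fractionExpression]
    refine Finset.sum_congr rfl fun δ hδ => ?_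
    dsimp only
    rw [h.prodCoeff_eq hli hm (ht δ hδ), ← mul_assoc]
    rfl
  · intro hwc γ
    have hev : ∀ᶠ t : ℕ in Filter.atTop, ∀ δ ∈ num.coeff.support,
        toR (γ + (t : ℤ) • w - δ) ∉ coneOver S β := by
      rw [Filter.eventually_all_finset]
      intro δ _
      have hlim : Filter.Tendsto (fun t : ℕ => (t : ℝ)⁻¹ • toR (γ - δ) + toR w) Filter.atTop
          (nhds (toR w)) := by
        have := (tendsto_inv_atTop_nhds_zero_nat (𝕜 := ℝ)).smul_const (toR (γ - δ))
        simpa using this.add_const (toR w)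
      filter_upwards [hlim.eventually (hcl.isOpen_compl.mem_nhds hwc),
        Filter.eventually_gt_atTop 0] with t ht ht0 hmem
      apply ht
      have ht0' : (t : ℝ) ≠ 0 := by exact_mod_cast ht0.ne'
      have h1 := smul_mem_coneOver (r := (t : ℝ)⁻¹) (by positivity) hmem
      have h2 : (t : ℝ)⁻¹ • toR (γ + (t : ℤ) • w - δ) = (t : ℝ)⁻¹ • toR (γ - δ) + toR w := by
        rw [toR_sub, toR_add, toR_smul, toR_sub, Int.cast_natCast]
        rw [smul_sub, smul_add, smul_smul, inv_mul_cancel₀ ht0', one_smul, smul_sub]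
        abel
      rwa [h2] at h1
    filter_upwards [hev] with t ht
    rw [act_apply]
    refine Finset.sum_eq_zero fun δ hδ => ?_
    dsimp only
    have : prodCoeff S β m (γ + (t : ℤ) • w - δ) = 0 := by
      by_contra hne
      exact ht δ hδ (mem_cone_of_prodCoeff_ne_zero hli hne)
    rw [this, mul_zero]

end Simplicial

/-! ### Decompositions into contributions of cones -/

section Conic

variable {n : ℕ} {τ : Type}

/-- The function `P` is a sum of functions `E p`.  Along each ray whose direction `w` is not on
the boundary of the cone `D p`, the function `E p` eventually coincides with the quasipolynomial
`Q p` if `w ∈ D p`, and eventually vanishes if `w ∉ D p`. -/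
structure IsConicDecomposition (P : (Fin n → ℤ) → ℚ) (s : Multiset τ)
    (D : τ → Set (Fin n → ℝ)) (E Q : τ → (Fin n → ℤ) → ℚ) : Prop where
  sum : P = (s.map E).sum
  smul_mem : ∀ p ∈ s, ∀ r : ℝ, 0 < r → ∀ x ∈ D p, r • x ∈ D p
  inside : ∀ p ∈ s, ∀ w : Fin n → ℤ, toR w ∉ frontier (D p) → toR w ∈ D p →
    Q p ∈ quasipolynomials n ∧
      ∀ γ : Fin n → ℤ, ∀ᶠ t : ℕ in Filter.atTop, E p (γ + (t : ℤ) • w) = Q p (γ + (t : ℤ) • w)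
  outside : ∀ p ∈ s, ∀ w : Fin n → ℤ, toR w ∉ frontier (D p) → toR w ∉ D p →
    ∀ γ : Fin n → ℤ, ∀ᶠ t : ℕ in Filter.atTop, E p (γ + (t : ℤ) • w) = 0

open Classical in
/-- The sum of those contributions whose cone contains the point `v`. -/
noncomputable def conicSum (s : Multiset τ) (D : τ → Set (Fin n → ℝ))
    (Q : τ → (Fin n → ℤ) → ℚ) (v : Fin n → ℝ) (γ : Fin n → ℤ) : ℚ :=
  (s.map fun p => if v ∈ D p then Q p γ else 0).sum

theorem conicSum_congr {s : Multiset τ} {D : τ → Set (Fin n → ℝ)} {Q : τ → (Fin n → ℤ) → ℚ}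
    {v v' : Fin n → ℝ} (h : ∀ p ∈ s, (v ∈ D p ↔ v' ∈ D p)) :
    conicSum s D Q v = conicSum s D Q v' := by
  funext γ
  refine congrArg _ (Multiset.map_congr rfl fun p hp => ?_)
  by_cases h' : v ∈ D p
  · rw [if_pos h', if_pos ((h p hp).1 h')]
  · rw [if_neg h', if_neg fun h'' => h' ((h p hp).2 h'')]

theorem multiset_sum_map_apply {X : Type} (s : Multiset τ) (f : τ → X → ℚ) (x : X) :
    (s.map f).sum x = (s.map fun p => f p x).sum := by
  induction s using Multiset.induction_on with
  | empty => rfl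
  | cons p s ih => simp [ih]

theorem eventually_mem_iff {X : Type*} [TopologicalSpace X] {D : Set X} {v : X}
    (hv : v ∉ frontier D) : ∀ᶠ y in nhds v, (y ∈ D ↔ v ∈ D) ∧ y ∉ frontier D := by
  refine Filter.Eventually.and ?_ (isClosed_frontier.isOpen_compl.mem_nhds hv)
  by_cases h : v ∈ D
  · have hi : v ∈ interior D := by
      by_contra hi
      exact hv ⟨subset_closure h, hi⟩
    filter_upwards [isOpen_interior.mem_nhds hi] with y hy
    exact iff_of_true (interior_subset hy) h
  · have hi : v ∉ closure D := fun hc => hv ⟨hc, fun hi => h (interior_subset hi)⟩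
    filter_upwards [isClosed_closure.isOpen_compl.mem_nhds hi] with y hy
    exact iff_of_false (fun hyD => hy (subset_closure hyD)) h

/-- A connected set that avoids the boundary of `D` is contained in `D` or in its complement. -/
theorem mem_of_isPreconnected {X : Type*} [TopologicalSpace X] {K D : Set X}
    (hK : IsPreconnected K) (h : ∀ z ∈ K, z ∉ frontier D) {x y : X} (hx : x ∈ K) (hy : y ∈ K)
    (hxD : x ∈ D) : y ∈ D := by
  by_contra hyD
  have hsub : K ⊆ interior D ∪ (closure D)ᶜ := fun z hz => by
    by_contra h'
    rw [Set.mem_union, not_or, Set.notMem_compl_iff] at h'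
    exact h z hz ⟨h'.2, h'.1⟩
  obtain ⟨z, -, hzi, hzc⟩ := hK _ _ isOpen_interior isClosed_closure.isOpen_compl hsub
    ⟨x, hx, (hsub hx).resolve_right fun h' => h' (subset_closure hxD)⟩
    ⟨y, hy, (hsub hy).resolve_left fun h' => hyD (interior_subset h')⟩
  exact hzc (subset_closure (interior_subset hzi))

variable {P : (Fin n → ℤ) → ℚ} {s : Multiset τ} {D : τ → Set (Fin n → ℝ)}
  {E Q : τ → (Fin n → ℤ) → ℚ}

theorem smul_mem_iff_of_smul_mem {C : Set (Fin n → ℝ)}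
    (hC : ∀ r : ℝ, 0 < r → ∀ x ∈ C, r • x ∈ C) {r : ℝ} (hr : 0 < r) {x : Fin n → ℝ} :
    r • x ∈ C ↔ x ∈ C := by
  refine ⟨fun h => ?_, hC r hr x⟩
  have := hC r⁻¹ (by positivity) _ h
  rwa [smul_smul, inv_mul_cancel₀ hr.ne', one_smul] at this

theorem preimage_smul_eq_of_smul_mem {C : Set (Fin n → ℝ)}
    (hC : ∀ r : ℝ, 0 < r → ∀ x ∈ C, r • x ∈ C) {r : ℝ} (hr : 0 < r) :
    Homeomorph.smulOfNeZero (α := Fin n → ℝ) r hr.ne' ⁻¹' C = C := by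
  ext x
  exact smul_mem_iff_of_smul_mem hC hr

theorem smul_mem_frontier_iff {C : Set (Fin n → ℝ)}
    (hC : ∀ r : ℝ, 0 < r → ∀ x ∈ C, r • x ∈ C) {r : ℝ} (hr : 0 < r) {x : Fin n → ℝ} :
    r • x ∈ frontier C ↔ x ∈ frontier C := by
  conv_rhs => rw [← preimage_smul_eq_of_smul_mem hC hr, ← Homeomorph.preimage_frontier]
  rfl

theorem smul_mem_interior_iff {C : Set (Fin n → ℝ)}
    (hC : ∀ r : ℝ, 0 < r → ∀ x ∈ C, r • x ∈ C) {r : ℝ} (hr : 0 < r) {x : Fin n → ℝ} :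
    r • x ∈ interior C ↔ x ∈ interior C := by
  conv_rhs => rw [← preimage_smul_eq_of_smul_mem hC hr, ← Homeomorph.preimage_interior]
  rfl

/-- If `P` is given by a quasipolynomial on a cone `C`, then this quasipolynomial is the sum of
the contributions of the cones that contain a given `v ∈ C`: both sides coincide with `P` far out
on all the rays with a rational direction near `v` in the interior of `C`. -/
theorem IsConicDecomposition.eq_conicSum (h : IsConicDecomposition P s D E Q)
    {C : Set (Fin n → ℝ)} (hC : ∀ r : ℝ, 0 < r → ∀ x ∈ C, r • x ∈ C)
    {q : (Fin n → ℤ) → ℚ} (hq : q ∈ quasipolynomials n)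
    (hP : ∀ γ : Fin n → ℤ, toR γ ∈ C → P γ = q γ) {v : Fin n → ℝ}
    (hv : v ∈ closure (interior C)) (hvD : ∀ p ∈ s, v ∉ frontier (D p)) :
    q = conicSum s D Q v := by
  classical
  have hev : ∀ᶠ y in nhds v, ∀ p ∈ s, (y ∈ D p ↔ v ∈ D p) ∧ y ∉ frontier (D p) :=
    (Filter.eventually_all_finite s.finite_toSet).2 fun p hp => eventually_mem_iff (hvD p hp)
  obtain ⟨U, hU, hUo, hvU⟩ := eventually_nhds_iff.1 hev
  obtain ⟨x, hxU, hxC⟩ := mem_closure_iff.1 hv U hUo hvU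
  obtain ⟨w, m, hm, hwU, hwC⟩ := exists_rational_mem (hUo.inter isOpen_interior) ⟨hxU, hxC⟩
  have hm' : (0 : ℝ) < (m : ℝ)⁻¹ := by positivity
  rw [smul_mem_interior_iff hC hm'] at hwC
  have hw : ∀ p ∈ s, (toR w ∈ D p ↔ v ∈ D p) ∧ toR w ∉ frontier (D p) := fun p hp => by
    have := hU _ hwU p hp
    rwa [smul_mem_iff_of_smul_mem (h.smul_mem p hp) hm',
      smul_mem_frontier_iff (h.smul_mem p hp) hm'] at this
  have hq' : conicSum s D Q v ∈ quasipolynomials n := by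
    have h1 : conicSum s D Q v = (s.map fun p => if v ∈ D p then Q p else 0).sum := by
      funext γ
      rw [multiset_sum_map_apply, conicSum]
      refine congrArg _ (Multiset.map_congr rfl fun p _ => ?_)
      split_ifs <;> rfl
    rw [h1]
    refine Subalgebra.multiset_sum_mem _ fun f hf => ?_
    obtain ⟨p, hp, rfl⟩ := Multiset.mem_map.1 hf
    split_ifs with hvp
    · exact (h.inside p hp w (hw p hp).2 ((hw p hp).1.2 hvp)).1
    · exact Subalgebra.zero_mem _
  refine quasipolynomial_ext hq hq' w fun γ => ?_
  have hE : ∀ᶠ t : ℕ in Filter.atTop, ∀ p ∈ s, E p (γ + (t : ℤ) • w) =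
      if v ∈ D p then Q p (γ + (t : ℤ) • w) else 0 := by
    refine (Filter.eventually_all_finite s.finite_toSet).2 fun p hp => ?_
    split_ifs with hvp
    · exact (h.inside p hp w (hw p hp).2 ((hw p hp).1.2 hvp)).2 γ
    · exact h.outside p hp w (hw p hp).2 (fun hwp => hvp ((hw p hp).1.1 hwp)) γ
  have hlim : Filter.Tendsto (fun t : ℕ => (t : ℝ)⁻¹ • toR γ + toR w) Filter.atTop
      (nhds (toR w)) := by
    have := (tendsto_inv_atTop_nhds_zero_nat (𝕜 := ℝ)).smul_const (toR γ)
    simpa using this.add_const (toR w)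
  filter_upwards [hE, hlim.eventually (isOpen_interior.mem_nhds hwC),
    Filter.eventually_gt_atTop 0] with t ht htC ht0
  have ht0' : (0 : ℝ) < t := by exact_mod_cast ht0
  have hmem : toR (γ + (t : ℤ) • w) ∈ C := by
    have h1 := hC t ht0' _ (interior_subset htC)
    rwa [smul_add, smul_smul, mul_inv_cancel₀ ht0'.ne', one_smul, ← Int.cast_natCast, ← toR_smul,
      ← toR_add] at h1
  rw [← hP _ hmem, h.sum, multiset_sum_map_apply, conicSum]
  exact congrArg _ (Multiset.map_congr rfl ht)

/-- Remove from the cone of the `α i` a closed set `F` that contains the boundaries of all the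
cones `D p`.  On the cells of the generic points of one connected component, the partition function
is given by one and the same quasipolynomial, and these cells cover the closure of the
component. -/
theorem IsConicDecomposition.isQuasipolynomialOn_chamber {N : ℕ} {α : Fin N → Fin n → ℤ}
    (h : IsConicDecomposition (fun γ => (partitionFunction α γ : ℚ)) s D E Q)
    {H : Finset (Fin n → ℤ)} (hH : IsQuasipolynomialOnCells α Finset.univ H)
    (hint : (interior (coneOver Finset.univ α)).Nonempty) {F : Set (Fin n → ℝ)} (hF : IsClosed F)
    (hFD : ∀ p ∈ s, ∀ x ∈ coneOver Finset.univ α \ F, x ∉ frontier (D p)) {x₀ : Fin n → ℝ}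
    (hx₀ : x₀ ∈ coneOver Finset.univ α \ F) :
    IsQuasipolynomialOn (partitionFunction α)
      (closure (connectedComponentIn (coneOver Finset.univ α \ F) x₀)) := by
  set K := connectedComponentIn (coneOver Finset.univ α \ F) x₀ with hK
  have hKsub : K ⊆ coneOver Finset.univ α \ F := connectedComponentIn_subset _ _
  have hcover : ∀ y ∈ closure K, ∃ x ∈ K, IsGeneric H x ∧ y ∈ cell H x := by
    intro y hy
    by_contra! hne
    have hclosed : IsClosed (⋃₀ (cell H '' {x | x ∈ K ∧ IsGeneric H x})) := by
      rw [Set.sUnion_eq_biUnion]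
      refine Set.Finite.isClosed_biUnion ((finite_cells H).subset (Set.image_subset_range _ _)) ?_
      rintro _ ⟨x, -, rfl⟩
      exact isClosed_cell H x
    have hyW : y ∈ (⋃₀ (cell H '' {x | x ∈ K ∧ IsGeneric H x}))ᶜ := by
      rintro ⟨_, ⟨x, ⟨hxK, hxg⟩, rfl⟩, hyx⟩
      exact hne x hxK hxg hyx
    obtain ⟨e, heW, heK⟩ := mem_closure_iff.1 hy _ hclosed.isOpen_compl hyW
    obtain ⟨ε, hε, hball⟩ := Metric.isOpen_iff.1 (hclosed.isOpen_compl.inter hF.isOpen_compl) e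
      ⟨heW, (hKsub heK).2⟩
    have hsubK : Metric.ball e ε ∩ coneOver Finset.univ α ⊆ K := by
      rw [hK, connectedComponentIn_eq heK]
      refine IsPreconnected.subset_connectedComponentIn
        ((convex_ball e ε).inter convex_coneOver).isPreconnected
        ⟨Metric.mem_ball_self hε, (hKsub heK).1⟩ fun z hz => ⟨hz.2, (hball hz.1).2⟩
    have heint : e ∈ closure (interior (coneOver Finset.univ α)) := by
      rw [convex_coneOver.closure_interior_eq_closure_of_nonempty_interior hint]
      exact subset_closure (hKsub heK).1
    obtain ⟨z, hz⟩ := mem_closure_iff.1 heint _ Metric.isOpen_ball (Metric.mem_ball_self hε)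
    obtain ⟨x, ⟨hxB, hxΛ⟩, hxg⟩ := (dense_isGeneric hH.1).inter_open_nonempty _
      (Metric.isOpen_ball.inter isOpen_interior) ⟨z, hz⟩
    exact (hball hxB).1 ⟨_, ⟨x, ⟨hsubK ⟨hxB, interior_subset hxΛ⟩, hxg⟩, rfl⟩, self_mem_cell⟩
  have hcell : ∀ x ∈ K, IsGeneric H x → conicSum s D Q x₀ ∈ quasipolynomials n ∧
      ∀ γ : Fin n → ℤ, toR γ ∈ cell H x → (partitionFunction α γ : ℚ) = conicSum s D Q x₀ γ := by
    intro x hxK hxg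
    obtain ⟨q, hq, hqP⟩ := (hH.2 x (hKsub hxK).1 hxg).2
    rw [subPartition_univ] at hqP
    have h1 := h.eq_conicSum (fun r hr y hy => cell_smul_mem hr.le hy) hq hqP
      (subset_closure (self_mem_interior_cell hxg)) fun p hp => hFD p hp x (hKsub hxK)
    have h2 : conicSum s D Q x = conicSum s D Q x₀ := conicSum_congr fun p hp => by
      have hmem : x₀ ∈ K := mem_connectedComponentIn hx₀
      have hpre : IsPreconnected K := isPreconnected_connectedComponentIn
      have hfr : ∀ z ∈ K, z ∉ frontier (D p) := fun z hz => hFD p hp z (hKsub hz)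
      exact ⟨fun hx => mem_of_isPreconnected hpre hfr hxK hmem hx,
        fun hx => mem_of_isPreconnected hpre hfr hmem hxK hx⟩
    rw [← h2, ← h1]
    exact ⟨hq, hqP⟩
  obtain ⟨x, hxK, hxg, -⟩ := hcover x₀ (subset_closure (mem_connectedComponentIn hx₀))
  refine ⟨conicSum s D Q x₀, (hcell x hxK hxg).1, fun γ hγ => ?_⟩
  obtain ⟨x', hxK', hxg', hγ'⟩ := hcover _ hγ
  exact (hcell x' hxK' hxg').2 γ hγ'

/-- A partial fraction decomposition of the generating function yields a decomposition of the
partition function. -/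
theorem isConicDecomposition_partitionFunction {N : ℕ} {α : Fin N → Fin n → ℤ} {φ : Fin n → ℤ}
    (hφ : ∀ i, 0 < φ ⬝ᵥ α i) {ι : τ → Type} {S : ∀ p, Finset (ι p)}
    {β : ∀ p, ι p → Fin n → ℤ} {m : ∀ p, ι p → ℕ} {num : τ → Laurent n}
    (hβ : ∀ p ∈ s, ∀ i ∈ S p, 0 < φ ⬝ᵥ β p i)
    (hli : ∀ p ∈ s, LinearIndependent ℤ (fun i : S p => β p i))
    (hm : ∀ p ∈ s, ∀ i ∈ S p, 0 < m p i)
    (hsum : generatingFunction α =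
      (s.map fun p => algebraMap _ (RatFun n) (num p) * ∏ i ∈ S p, geom (β p i) ^ m p i).sum) :
    IsConicDecomposition (fun γ => (partitionFunction α γ : ℚ)) s
      (fun p => coneOver (S p) (β p)) (fun p => act n (num p) (prodCoeff (S p) (β p) (m p)))
      (fun p => fractionExpression (S p) (β p) (m p) (num p)) := by
  constructor
  · have h1 := isExpansion_partitionFunction hφ
    rw [hsum] at h1
    exact h1.unique (IsExpansion.multiset_sum fun p hp =>
      (isExpansion_prodCoeff (hβ p hp) (hli p hp) (m p)).num_mul (num p))
  · exact fun p _ r hr x hx => smul_mem_coneOver hr.le hx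
  · exact fun p hp w hw hwD =>
      (eventually_act_prodCoeff (hβ p hp) (hli p hp) (hm p hp) (num p) hw).1 hwD
  · exact fun p hp w hw hwD =>
      (eventually_act_prodCoeff (hβ p hp) (hli p hp) (hm p hp) (num p) hw).2 hwD

end Conic

/-! ### The partial fraction algorithm -/

section Algorithm

variable {n N : ℕ} {α : Fin N → Fin n → ℤ}

theorem mono_add (γ δ : Fin n → ℤ) : (mono (γ + δ) : Laurent n) = mono γ * mono δ := by
  rw [mono, mono, mono, AddMonoidAlgebra.single_mul_single, one_mul]

theorem mono_zero : (mono 0 : Laurent n) = 1 := rfl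

/-- The elongation formula. -/
theorem elongation_mul (a : ℤ) (β : Fin n → ℤ) :
    elongation a β * (1 - mono β) = 1 - mono (a • β) := by
  have hstep : ∀ k : ℤ, (mono ((k + 1) • β) : Laurent n) = mono (k • β) * mono β := fun k => by
    rw [← mono_add, add_smul, one_smul]
  unfold elongation
  split_ifs with h
  · lift a to ℕ using h.le
    rw [Int.toNat_natCast, Finset.sum_mul,
      Finset.sum_congr rfl (g := fun k : ℕ => (mono ((k : ℤ) • β) : Laurent n) -
        mono (((k + 1 : ℕ) : ℤ) • β)), Finset.sum_range_sub', Nat.cast_zero, zero_smul, mono_zero]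
    intro k _
    rw [Nat.cast_succ, hstep]
    ring
  · obtain ⟨m, rfl⟩ : ∃ m : ℕ, a = -(m : ℤ) := ⟨(-a).toNat, by omega⟩
    rw [neg_neg, Int.toNat_natCast, neg_mul, Finset.sum_mul,
      Finset.sum_congr rfl (g := fun k : ℕ => (mono (-((k + 1 : ℕ) : ℤ) • β) : Laurent n) -
        mono (-(k : ℤ) • β)),
        Finset.sum_range_sub (fun k : ℕ => (mono (-(k : ℤ) • β) : Laurent n)), Nat.cast_zero,
        neg_zero, zero_smul, mono_zero, neg_sub]
    intro k _
    have h1 := hstep (-((k : ℤ) + 1))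
    rw [show -((k : ℤ) + 1) + 1 = -(k : ℤ) by ring] at h1
    rw [Nat.cast_succ, h1]
    ring

/-- The Szenes–Vergne formula for the numerators. -/
theorem telescope (u : Fin N → Fin n → ℤ) (js : List (Fin N)) (i₀ : Fin N) :
    ∑ k ∈ Finset.range js.length, (mono ((js.take k).map u).sum : Laurent n) *
      (1 - mono (u (js.getD k i₀))) = 1 - mono (js.map u).sum := by
  rw [Finset.sum_congr rfl (g := fun k => (mono ((js.take k).map u).sum : Laurent n) -
    mono ((js.take (k + 1)).map u).sum), Finset.sum_range_sub', List.take_zero, List.take_length]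
  · rfl
  · intro k hk
    have hk' := Finset.mem_range.1 hk
    rw [List.take_succ_eq_append_getElem hk', List.map_append, List.sum_append, mono_add,
      List.getD_eq_getElem _ _ hk']
    simp [mul_sub]

/-- The rational function given by a fraction. -/
noncomputable def Fraction.value (α : Fin N → Fin n → ℤ) (f : Fraction n N) : RatFun n :=
  algebraMap (Laurent n) (RatFun n) f.num * ∏ i ∈ f.supp, geom (f.vec α i) ^ f.mult i

theorem Fraction.mem_supp {f : Fraction n N} {i : Fin N} : i ∈ f.supp ↔ f.mult i ≠ 0 := by
  simp [Fraction.supp]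

theorem Fraction.value_eq (f : Fraction n N) : f.value α =
    algebraMap (Laurent n) (RatFun n) f.num * ∏ i, geom (f.vec α i) ^ f.mult i := by
  rw [Fraction.value]
  congr 1
  refine Finset.prod_subset (Finset.subset_univ _) fun i _ hi => ?_
  rw [Fraction.mem_supp, not_not] at hi
  rw [hi, pow_zero]

theorem Fraction.vec_ne_zero (hne : ∀ i, α i ≠ 0) {f : Fraction n N} (hlen : ∀ i, 0 < f.len i)
    (i : Fin N) : f.vec α i ≠ 0 :=
  smul_ne_zero (by exact_mod_cast (hlen i).ne') (hne i)

theorem newFraction_vec_self (f : Fraction n N) (r : Dependence N) (pre : List (Fin N))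
    (j : Fin N) : (newFraction α f r pre j).vec α r.i₀ = (r.a₀ : ℤ) • f.vec α r.i₀ := by
  simp only [Fraction.vec, newFraction, Function.update_self, Nat.cast_mul, mul_smul]

theorem newFraction_vec_of_ne (f : Fraction n N) (r : Dependence N) (pre : List (Fin N))
    (j : Fin N) {i : Fin N} (hi : i ≠ r.i₀) : (newFraction α f r pre j).vec α i = f.vec α i := by
  simp only [Fraction.vec, newFraction, Function.update_of_ne hi]

theorem newFraction_mult_self (f : Fraction n N) (r : Dependence N) (pre : List (Fin N))
    (j : Fin N) : (newFraction α f r pre j).mult r.i₀ = f.mult r.i₀ + 1 :=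
  Function.update_self ..

theorem newFraction_mult (f : Fraction n N) (r : Dependence N) (pre : List (Fin N))
    {j : Fin N} (hj : j ≠ r.i₀) : (newFraction α f r pre j).mult j = f.mult j - 1 := by
  simp only [newFraction, Function.update_of_ne hj, Function.update_self]

theorem newFraction_mult_of_ne (f : Fraction n N) (r : Dependence N) (pre : List (Fin N))
    {i j : Fin N} (hi : i ≠ r.i₀) (hij : i ≠ j) :
    (newFraction α f r pre j).mult i = f.mult i := by
  simp only [newFraction, Function.update_of_ne hi, Function.update_of_ne hij]

theorem newFraction_len_pos {f : Fraction n N} (hlen : ∀ i, 0 < f.len i) {r : Dependence N}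
    (hr : 0 < r.a₀) (pre : List (Fin N)) (j i : Fin N) :
    0 < (newFraction α f r pre j).len i := by
  by_cases hi : i = r.i₀
  · subst hi
    simp only [newFraction, Function.update_self]
    exact Nat.mul_pos hr (hlen _)
  · simp only [newFraction, Function.update_of_ne hi, hlen]

/-- One summand of the elongated Szenes–Vergne formula. -/
theorem newFraction_value (hne : ∀ i, α i ≠ 0) {f : Fraction n N} (hlen : ∀ i, 0 < f.len i)
    {r : Dependence N} (hr : r.IsValid α f) (pre : List (Fin N)) {j : Fin N} (hj : j ∈ r.js) :
    (newFraction α f r pre j).value α = f.value α * geom ((r.a₀ : ℤ) • f.vec α r.i₀) *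
      algebraMap _ _ (mono (pre.map fun i => r.a i • f.vec α i).sum *
        (1 - mono (r.a j • f.vec α j))) := by
  obtain ⟨ha₀, hi₀, -, hi₀js, hjs, -⟩ := hr
  have hji : j ≠ r.i₀ := fun h => hi₀js (h ▸ hj)
  have hjmem : j ∈ Finset.univ.erase r.i₀ := Finset.mem_erase.2 ⟨hji, Finset.mem_univ j⟩
  have hmj : f.mult j ≠ 0 := Fraction.mem_supp.1 (hjs j hj).1
  have hvj := algebraMap_one_sub_mono_mul_geom (f.vec_ne_zero hne hlen j)
  have hv0 := algebraMap_one_sub_mono_mul_geom (f.vec_ne_zero hne hlen r.i₀)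
  have hv0' := algebraMap_one_sub_mono_mul_geom (β := (r.a₀ : ℤ) • f.vec α r.i₀)
    (smul_ne_zero (by exact_mod_cast ha₀.ne') (f.vec_ne_zero hne hlen r.i₀))
  have he0 : algebraMap (Laurent n) (RatFun n) (elongation r.a₀ (f.vec α r.i₀)) *
      geom ((r.a₀ : ℤ) • f.vec α r.i₀) = geom (f.vec α r.i₀) := by
    rw [← elongation_mul, map_mul] at hv0'
    linear_combination (geom (f.vec α r.i₀)) * hv0' - algebraMap (Laurent n) (RatFun n)
      (elongation r.a₀ (f.vec α r.i₀)) * geom ((r.a₀ : ℤ) • f.vec α r.i₀) * hv0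
  rw [Fraction.value_eq, Fraction.value_eq, ← Finset.mul_prod_erase _ _ (Finset.mem_univ r.i₀),
    ← Finset.mul_prod_erase _ _ (Finset.mem_univ r.i₀), ← Finset.mul_prod_erase _ _ hjmem,
    ← Finset.mul_prod_erase _ _ hjmem, newFraction_vec_self, newFraction_mult_self,
    newFraction_vec_of_ne f r pre j hji, newFraction_mult f r pre hji, ← elongation_mul (r.a j),
    Finset.prod_congr rfl (g := fun i => geom (f.vec α i) ^ f.mult i)]
  · obtain ⟨m, hm⟩ : ∃ m, f.mult j = m + 1 := ⟨f.mult j - 1, by omega⟩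
    rw [hm, Nat.add_sub_cancel, pow_succ (geom (f.vec α j)) m, ← he0, mul_pow, newFraction]
    simp only [map_mul, map_pow]
    linear_combination (-(algebraMap (Laurent n) (RatFun n) f.num *
      algebraMap (Laurent n) (RatFun n) (mono (pre.map fun i => r.a i • f.vec α i).sum) *
      algebraMap (Laurent n) (RatFun n) (elongation (r.a j) (f.vec α j)) *
      algebraMap (Laurent n) (RatFun n) (elongation r.a₀ (f.vec α r.i₀)) ^ f.mult r.i₀ *
      geom ((r.a₀ : ℤ) • f.vec α r.i₀) ^ (f.mult r.i₀ + 1) * geom (f.vec α j) ^ m *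
      ∏ i ∈ (Finset.univ.erase r.i₀).erase j, geom (f.vec α i) ^ f.mult i)) * hvj
  · intro i hi
    rw [Finset.mem_erase, Finset.mem_erase] at hi
    rw [newFraction_vec_of_ne f r pre j hi.2.1, newFraction_mult_of_ne f r pre hi.2.1 hi.1]

theorem newFractions_value (hne : ∀ i, α i ≠ 0) {f : Fraction n N} (hlen : ∀ i, 0 < f.len i)
    {r : Dependence N} (hr : r.IsValid α f) :
    ((newFractions α f r).map fun p => p.1.value α).sum = f.value α := by
  have h0 := algebraMap_one_sub_mono_mul_geom (β := (r.a₀ : ℤ) • f.vec α r.i₀)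
    (smul_ne_zero (by exact_mod_cast hr.1.ne') (f.vec_ne_zero hne hlen r.i₀))
  have h1 := telescope (n := n) (fun i => r.a i • f.vec α i) r.js r.i₀
  rw [← hr.2.2.2.2.2] at h1
  have h2 : ((newFractions α f r).map fun p => p.1.value α).sum =
      ∑ k ∈ Finset.range r.js.length,
        (newFraction α f r (r.js.take k) (r.js.getD k r.i₀)).value α := by
    rw [newFractions, List.map_map]
    rfl
  rw [h2, Finset.sum_congr rfl (fun k hk => newFraction_value hne hlen hr _ (by
    rw [List.getD_eq_getElem _ _ (Finset.mem_range.1 hk)]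
    exact List.getElem_mem _)), ← Finset.mul_sum, ← map_sum, h1]
  linear_combination f.value α * h0

/-- The lengths are positive, and the stored data are what they are meant to be. -/
def IsSound (α : Fin N → Fin n → ℤ) : Fraction n N × Label N → Prop
  | (f, Label.unreduced) => ∀ i, 0 < f.len i
  | (f, Label.dep r) => (∀ i, 0 < f.len i) ∧ r.IsValid α f
  | (f, Label.reduced) => (∀ i, 0 < f.len i) ∧ LinearIndependent ℤ (fun i : f.supp => α i)

theorem IsSound.len_pos {p : Fraction n N × Label N} (h : IsSound α p) : ∀ i, 0 < p.1.len i := by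
  obtain ⟨f, _ | _ | _⟩ := p
  · exact h
  · exact h.1
  · exact h.1

theorem mem_newFractions {f : Fraction n N} {r : Dependence N} {p : Fraction n N × Label N}
    (hp : p ∈ newFractions α f r) : ∃ pre, ∃ j ∈ r.js,
      p = (newFraction α f r pre j, newLabel (f.mult j) r) := by
  obtain ⟨k, hk, rfl⟩ := List.mem_map.1 hp
  refine ⟨_, r.js.getD k r.i₀, ?_, rfl⟩
  rw [List.getD_eq_getElem _ _ (List.mem_range.1 hk)]
  exact List.getElem_mem _

/-- If the factor that is cancelled was not simple, the support does not change. -/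
theorem newFraction_supp {f : Fraction n N} {r : Dependence N} (hr : r.IsValid α f)
    (pre : List (Fin N)) {j : Fin N} (hj : j ∈ r.js) (hm : f.mult j ≠ 1) :
    (newFraction α f r pre j).supp = f.supp := by
  obtain ⟨-, hi₀, -, hi₀js, hjs, -⟩ := hr
  have hji : j ≠ r.i₀ := fun h => hi₀js (h ▸ hj)
  ext i
  rw [Fraction.mem_supp, Fraction.mem_supp]
  by_cases hi : i = r.i₀
  · subst hi
    rw [newFraction_mult_self]
    exact iff_of_true (Nat.succ_ne_zero _) (Fraction.mem_supp.1 hi₀)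
  · by_cases hij : i = j
    · subst hij
      rw [newFraction_mult f r pre hi]
      omega
    · rw [newFraction_mult_of_ne f r pre hi hij]

/-- If a simple factor is cancelled, the support becomes smaller. -/
theorem newFraction_supp_ssubset {f : Fraction n N} {r : Dependence N} (hr : r.IsValid α f)
    (pre : List (Fin N)) {j : Fin N} (hj : j ∈ r.js) (hm : f.mult j = 1) :
    (newFraction α f r pre j).supp ⊂ f.supp := by
  obtain ⟨-, hi₀, -, hi₀js, hjs, -⟩ := hr
  have hji : j ≠ r.i₀ := fun h => hi₀js (h ▸ hj)
  refine (Finset.ssubset_iff_of_subset fun i hi => ?_).2 ⟨j, (hjs j hj).1, fun h => ?_⟩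
  · by_cases hi' : i = r.i₀
    · rwa [hi']
    · rw [Fraction.mem_supp] at hi ⊢
      by_cases hij : i = j
      · subst hij
        rw [hm]
        exact one_ne_zero
      · rwa [newFraction_mult_of_ne f r pre hi' hij] at hi
  · rw [Fraction.mem_supp, newFraction_mult f r pre hji, hm] at h
    exact h rfl

theorem isSound_of_mem_newFractions {f : Fraction n N} {r : Dependence N}
    (hf : IsSound α (f, Label.dep r)) {p : Fraction n N × Label N}
    (hp : p ∈ newFractions α f r) : IsSound α p := by
  obtain ⟨pre, j, hj, rfl⟩ := mem_newFractions hp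
  obtain ⟨hlen, hr⟩ := hf
  have hlen' := newFraction_len_pos (α := α) hlen hr.1 pre j
  rw [newLabel]
  split_ifs with hm
  · exact hlen'
  · have hsupp := newFraction_supp hr pre hj hm
    obtain ⟨ha₀, hi₀, hnodup, hi₀js, hjs, hsum⟩ := hr
    refine ⟨hlen', one_pos, by rwa [hsupp], hnodup, hi₀js, by rwa [hsupp], ?_⟩
    rw [Nat.cast_one, one_smul, newFraction_vec_self, hsum]
    refine congrArg _ (List.map_congr_left fun i hi => ?_)
    rw [newFraction_vec_of_ne f r pre j fun h => hi₀js (h ▸ hi)]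

theorem PFStep.isSound {s s' : PFState n N} (h : PFStep α s s') (hs : ∀ p ∈ s, IsSound α p) :
    ∀ p ∈ s', IsSound α p := by
  cases h with
  | label f s _ hli =>
    rw [Multiset.forall_mem_cons] at hs ⊢
    exact ⟨⟨hs.1, hli⟩, hs.2⟩
  | choose f r s _ hr =>
    rw [Multiset.forall_mem_cons] at hs ⊢
    exact ⟨⟨hs.1, hr⟩, hs.2⟩
  | reduce f r s =>
    rw [Multiset.forall_mem_cons] at hs
    intro p hp
    rcases Multiset.mem_add.1 hp with hp | hp
    · exact isSound_of_mem_newFractions hs.1 (Multiset.mem_coe.1 hp)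
    · exact hs.2 p hp

theorem initialState_isSound : ∀ p ∈ initialState n N, IsSound α p := by
  intro p hp
  rw [initialState, Multiset.mem_singleton] at hp
  subst hp
  exact fun _ => one_pos

theorem PFReachable.isSound {s : PFState n N} (h : PFReachable α s) : ∀ p ∈ s, IsSound α p := by
  induction h with
  | refl => exact initialState_isSound
  | tail _ hst ih => exact hst.isSound ih

theorem PFStep.value_eq (hne : ∀ i, α i ≠ 0) {s s' : PFState n N} (h : PFStep α s s')
    (hs : ∀ p ∈ s, IsSound α p) :
    (s'.map fun p => p.1.value α).sum = (s.map fun p => p.1.value α).sum := by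
  cases h with
  | label f s _ hli => simp
  | choose f r s _ hr => simp
  | reduce f r s =>
    rw [Multiset.forall_mem_cons] at hs
    rw [Multiset.map_add, Multiset.sum_add, Multiset.map_cons, Multiset.sum_cons,
      Multiset.map_coe, Multiset.sum_coe, newFractions_value hne hs.1.1 hs.1.2]

/-- The fractions of the algorithm always add up to the generating function. -/
theorem PFReachable.value_eq (hne : ∀ i, α i ≠ 0) {s : PFState n N} (h : PFReachable α s) :
    (s.map fun p => p.1.value α).sum = generatingFunction α := by
  induction h with
  | refl =>
    rw [initialState, Multiset.map_singleton, Multiset.sum_singleton, Fraction.value_eq]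
    simp [Fraction.vec, generatingFunction]
  | tail h hst ih => rw [hst.value_eq hne (PFReachable.isSound h), ih]

/-! ### Termination of the partial fraction algorithm -/

/-- The quantity that decreases when a fraction is processed: the size of the support and, for
equal supports, the total multiplicity of the factors that are to be cancelled. -/
noncomputable def rank : Fraction n N × Label N → ℕ ×ₗ ℕ∞
  | (f, Label.unreduced) => toLex (f.supp.card, ⊤)
  | (f, Label.dep r) => toLex (f.supp.card, ((r.js.map f.mult).sum : ℕ))
  | (f, Label.reduced) => toLex (f.supp.card, 0)

theorem rank_lt_of_mem_newFractions {f : Fraction n N} {r : Dependence N} (hr : r.IsValid α f)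
    {p : Fraction n N × Label N} (hp : p ∈ newFractions α f r) :
    rank p < rank (f, Label.dep r) := by
  obtain ⟨pre, j, hj, rfl⟩ := mem_newFractions hp
  rw [newLabel]
  split_ifs with hm
  · exact Prod.Lex.toLex_lt_toLex.2
      (Or.inl (Finset.card_lt_card (newFraction_supp_ssubset hr pre hj hm)))
  · refine Prod.Lex.toLex_lt_toLex.2 (Or.inr ⟨?_, ?_⟩)
    · dsimp only
      rw [newFraction_supp hr pre hj hm]
    · obtain ⟨-, -, hnodup, hi₀js, hjs, -⟩ := hr
      have hmj := Fraction.mem_supp.1 (hjs j hj).1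
      have hi : ∀ i ∈ r.js, i ≠ r.i₀ := fun i hi h => hi₀js (h ▸ hi)
      dsimp only
      rw [Nat.cast_lt]
      refine List.sum_lt_sum _ _ (fun i hi' => ?_) ⟨j, hj, ?_⟩
      · by_cases hij : i = j
        · subst hij
          rw [newFraction_mult f r pre (hi _ hi')]
          exact Nat.sub_le _ _
        · rw [newFraction_mult_of_ne f r pre (hi _ hi') hij]
      · rw [newFraction_mult f r pre (hi _ hj)]
        omega

theorem PFStep.cutExpand {s s' : PFState n N} (h : PFStep α s s') (hs : ∀ p ∈ s, IsSound α p) :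
    Relation.CutExpand (· < ·) (s'.map rank) (s.map rank) := by
  cases h with
  | label f s _ hli =>
    refine ⟨{rank (f, Label.reduced)}, rank (f, Label.unreduced), fun a ha => ?_, ?_⟩
    · rw [Multiset.mem_singleton] at ha
      subst ha
      exact Prod.Lex.toLex_lt_toLex.2 (Or.inr ⟨rfl, ENat.top_pos⟩)
    · rw [Multiset.map_cons, Multiset.map_cons, ← Multiset.singleton_add, ← Multiset.singleton_add]
      abel
  | choose f r s _ hr =>
    refine ⟨{rank (f, Label.dep r)}, rank (f, Label.unreduced), fun a ha => ?_, ?_⟩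
    · rw [Multiset.mem_singleton] at ha
      subst ha
      exact Prod.Lex.toLex_lt_toLex.2 (Or.inr ⟨rfl, ENat.natCast_lt_top _⟩)
    · rw [Multiset.map_cons, Multiset.map_cons, ← Multiset.singleton_add, ← Multiset.singleton_add]
      abel
  | reduce f r s =>
    rw [Multiset.forall_mem_cons] at hs
    refine ⟨(newFractions α f r : PFState n N).map rank, rank (f, Label.dep r),
      fun a ha => ?_, ?_⟩
    · obtain ⟨p, hp, rfl⟩ := Multiset.mem_map.1 ha
      exact rank_lt_of_mem_newFractions hs.1.2 (Multiset.mem_coe.1 hp)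
    · rw [Multiset.map_add, Multiset.map_cons, ← Multiset.singleton_add]
      abel

/-- The algorithm stops: the multiset of the ranks decreases in the well-founded multiset order. -/
theorem exists_not_pfStep {run : ℕ → PFState n N} (h0 : run 0 = initialState n N) :
    ∃ k, ¬ PFStep α (run k) (run (k + 1)) := by
  by_contra! hstep
  have hs : ∀ k, ∀ p ∈ run k, IsSound α p := by
    intro k
    induction k with
    | zero => rw [h0]; exact initialState_isSound
    | succ k ih => exact (hstep k).isSound ih
  have hwf : WellFounded (Relation.CutExpand ((· < ·) : ℕ ×ₗ ℕ∞ → ℕ ×ₗ ℕ∞ → Prop)) :=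
    wellFounded_lt.cutExpand
  obtain ⟨_, ⟨k, rfl⟩, hmin⟩ := hwf.has_min (Set.range fun k => (run k).map rank) ⟨_, ⟨0, rfl⟩⟩
  exact hmin _ ⟨k + 1, rfl⟩ ((hstep k).cutExpand (hs k))

/-! ### Progress of the partial fraction algorithm -/

theorem linearIndependent_smul_iff {ι : Type} {S : Finset ι} {β : ι → Fin n → ℤ} {l : ι → ℕ}
    (hl : ∀ i, 0 < l i) : LinearIndependent ℤ (fun i : S => (l i : ℤ) • β i) ↔
      LinearIndependent ℤ (fun i : S => β i) := by
  classical
  have hl' : ∀ i, (l i : ℤ) ≠ 0 := fun i => by exact_mod_cast (hl i).ne'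
  rw [Fintype.linearIndependent_iff, Fintype.linearIndependent_iff]
  constructor
  · intro h g hg i
    have h1 := h (fun i => g i * ∏ k ∈ Finset.univ.erase i, (l k : ℤ)) ?_ i
    · exact (mul_eq_zero.1 h1).resolve_right (Finset.prod_ne_zero_iff.2 fun k _ => hl' k)
    · have : ∀ i : S, (g i * ∏ k ∈ Finset.univ.erase i, (l k : ℤ)) • (l i : ℤ) • β i =
          (∏ k : S, (l k : ℤ)) • g i • β i := fun i => by
        rw [← Finset.mul_prod_erase _ _ (Finset.mem_univ i), smul_smul, smul_smul]
        congr 1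
        ring
      rw [Finset.sum_congr rfl fun i _ => this i, ← Finset.smul_sum, hg, smul_zero]
  · intro h g hg i
    have h1 := h (fun i => g i * l i) (by simpa only [mul_smul] using hg) i
    exact (mul_eq_zero.1 h1).resolve_right (hl' i)

/-- Linearly dependent vectors admit a dependence of the required form. -/
theorem exists_isValid {f : Fraction n N} (hlen : ∀ i, 0 < f.len i)
    (hli : ¬ LinearIndependent ℤ (fun i : f.supp => α i)) : ∃ r : Dependence N, r.IsValid α f := by
  classical
  rw [← linearIndependent_smul_iff hlen, Fintype.linearIndependent_iff] at hli
  push Not at hli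
  obtain ⟨g₀, hg₀, ⟨i₀, hi₀⟩, hne⟩ := hli
  -- the coefficient of the distinguished vector is made positive
  obtain ⟨g, hg, hpos⟩ : ∃ g : Fin N → ℤ, ∑ i ∈ f.supp, g i • f.vec α i = 0 ∧ 0 < g i₀ := by
    have key : ∀ g : f.supp → ℤ, ∑ i, g i • (f.len i : ℤ) • α i = 0 → 0 < g ⟨i₀, hi₀⟩ →
        ∃ g : Fin N → ℤ, ∑ i ∈ f.supp, g i • f.vec α i = 0 ∧ 0 < g i₀ := fun g hg hpos => by
      refine ⟨fun i => if h : i ∈ f.supp then g ⟨i, h⟩ else 0, ?_, by simpa [hi₀] using hpos⟩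
      rw [← hg, ← Finset.sum_coe_sort f.supp]
      exact Finset.sum_congr rfl fun i _ => by
        dsimp only
        rw [dif_pos i.2, Fraction.vec]
    rcases lt_or_gt_of_ne hne with h | h
    · refine key (fun i => -g₀ i) ?_ (by simpa using h)
      simp only [neg_smul, Finset.sum_neg_distrib, hg₀, neg_zero]
    · exact key g₀ hg₀ h
  let J : Finset (Fin N) := (f.supp.erase i₀).filter fun j => g j ≠ 0
  refine ⟨⟨i₀, (g i₀).toNat, J.toList, fun j => -g j⟩, ?_, hi₀, J.nodup_toList, ?_, ?_, ?_⟩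
  · dsimp only
    omega
  · simp [J]
  · intro j hj
    rw [Finset.mem_toList, Finset.mem_filter] at hj
    exact ⟨Finset.mem_of_mem_erase hj.1, neg_ne_zero.2 hj.2⟩
  · dsimp only
    rw [Int.toNat_of_nonneg hpos.le, Finset.sum_map_toList, Finset.sum_filter_of_ne]
    · rw [← Finset.add_sum_erase _ _ hi₀] at hg
      simp only [neg_smul, Finset.sum_neg_distrib]
      exact eq_neg_of_add_eq_zero_left hg
    · intro j _ h h'
      exact h (by rw [h', neg_zero, zero_smul])

theorem PFReachable.exists_pfStep {s : PFState n N} (h : PFReachable α s)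
    (hs : ¬ PFFinished s) : ∃ s', PFStep α s s' := by
  by_cases hdep : NoDependence s
  · rw [PFFinished] at hs
    push Not at hs
    obtain ⟨⟨f, lab⟩, hp, hlab⟩ := hs
    have hsound := h.isSound _ hp
    obtain ⟨s, rfl⟩ := Multiset.exists_cons_of_mem hp
    have hdep' : NoDependence s := fun p hp => hdep p (Multiset.mem_cons_of_mem hp)
    cases lab with
    | unreduced =>
      by_cases hli : LinearIndependent ℤ (fun i : f.supp => α i)
      · exact ⟨_, PFStep.label f s hdep' hli⟩
      · obtain ⟨r, hr⟩ := exists_isValid hsound.len_pos hli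
        exact ⟨_, PFStep.choose f r s hdep' hr⟩
    | dep r => exact absurd rfl (hdep _ hp r)
    | reduced => exact absurd rfl hlab
  · rw [NoDependence] at hdep
    push Not at hdep
    obtain ⟨⟨f, lab⟩, hp, r, hr⟩ := hdep
    obtain ⟨s, rfl⟩ := Multiset.exists_cons_of_mem hp
    dsimp only at hr
    subst hr
    exact ⟨_, PFStep.reduce f r s⟩

/-- The algorithm has a result. -/
theorem exists_pfFinished (α : Fin N → Fin n → ℤ) :
    ∃ s, PFReachable α s ∧ PFFinished s := by
  classical
  by_contra! hne
  choose! next hnext using fun s (h : PFReachable α s) => h.exists_pfStep (hne s h)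
  let run : ℕ → PFState n N := fun k => next^[k] (initialState n N)
  have hrun : ∀ k, PFReachable α (run k) := by
    intro k
    induction k with
    | zero => exact Relation.ReflTransGen.refl
    | succ k ih =>
      have : run (k + 1) = next (run k) := Function.iterate_succ_apply' ..
      rw [this]
      exact ih.tail (hnext _ ih)
  obtain ⟨k, hk⟩ := exists_not_pfStep (α := α) (run := run) rfl
  have : run (k + 1) = next (run k) := Function.iterate_succ_apply' ..
  exact hk (this ▸ hnext _ (hrun k))

/-- The result of the algorithm decomposes the partition function. -/
theorem PFReachable.isConicDecomposition {φ : Fin n → ℤ} (hφ : ∀ i, 0 < φ ⬝ᵥ α i)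
    {s : PFState n N} (h : PFReachable α s) (hs : PFFinished s) :
    IsConicDecomposition (fun γ => (partitionFunction α γ : ℚ)) s (fun p => p.1.cone α)
      (fun p => act n p.1.num (prodCoeff p.1.supp (p.1.vec α) p.1.mult))
      (fun p => p.1.expression α) := by
  have hne : ∀ i, α i ≠ 0 := fun i h => by
    have := hφ i
    rw [h, dotProduct_zero] at this
    omega
  have h1 := isConicDecomposition_partitionFunction (s := s) hφ (ι := fun _ => Fin N)
    (S := fun p => p.1.supp) (β := fun p => p.1.vec α) (m := fun p => p.1.mult)
    (num := fun p => p.1.num)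
    (fun p hp i _ => by
      rw [Fraction.vec, dotProduct_smul, smul_eq_mul]
      exact mul_pos (by exact_mod_cast (h.isSound p hp).len_pos i) (hφ i))
    (fun p hp => by
      have h2 := h.isSound p hp
      obtain ⟨f, lab⟩ := p
      obtain rfl : lab = Label.reduced := hs _ hp
      exact (linearIndependent_smul_iff h2.1).2 h2.2)
    (fun p _ i hi => Nat.pos_of_ne_zero (Fraction.mem_supp.1 hi))
    (h.value_eq hne).symm
  have h2 : ∀ p ∈ s, coneOver p.1.supp (p.1.vec α) = p.1.cone α := fun p hp =>
    coneOver_smul fun i _ => (h.isSound p hp).len_pos i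
  refine ⟨h1.sum, fun p hp => ?_, fun p hp w => ?_, fun p hp w => ?_⟩
  · rw [← h2 p hp]; exact h1.smul_mem p hp
  · rw [← h2 p hp]; exact h1.inside p hp w
  · rw [← h2 p hp]; exact h1.outside p hp w

end Algorithm

/-! ### Walls and bases -/

section Walls

variable {n N : ℕ} {α : Fin N → Fin n → ℤ}

/-- Linearly independent vectors of a spanning family are part of a basis. -/
theorem exists_superset_card_eq
    (hrank : Submodule.span ℝ (Set.range fun i => toR (α i)) = ⊤) {S : Finset (Fin N)}
    (hS : LinearIndependent ℤ (fun i : S => α i)) :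
    ∃ S', S ⊆ S' ∧ LinearIndependent ℤ (fun i : S' => α i) ∧ S'.card = n := by
  classical
  obtain ⟨S', hS', hmax⟩ := Finset.exists_max_image
    (Finset.univ.filter fun S' : Finset (Fin N) =>
      S ⊆ S' ∧ LinearIndependent ℤ (fun i : S' => α i)) Finset.card
    ⟨S, Finset.mem_filter.2 ⟨Finset.mem_univ S, subset_rfl, hS⟩⟩
  obtain ⟨-, hsub, hli⟩ := Finset.mem_filter.1 hS'
  refine ⟨S', hsub, hli, le_antisymm ?_ ?_⟩
  · simpa using hli.fintype_card_le_finrank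
  have hspan : ∀ i, toR (α i) ∈
      Submodule.span ℝ ((S'.image fun i => toR (α i) : Finset _) : Set (Fin n → ℝ)) := by
    intro i
    have hgen : ∀ k ∈ S', toR (α k) ∈
        Submodule.span ℝ ((S'.image fun i => toR (α i) : Finset _) : Set (Fin n → ℝ)) :=
      fun k hk => Submodule.subset_span (Finset.mem_coe.2 (Finset.mem_image_of_mem _ hk))
    by_cases hi : i ∈ S'
    · exact hgen i hi
    have hdep : ¬ LinearIndepOn ℤ α (insert i S' : Finset (Fin N)) := fun h => by
      have := hmax (insert i S') (Finset.mem_filter.2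
        ⟨Finset.mem_univ _, hsub.trans (Finset.subset_insert i S'), h⟩)
      rw [Finset.card_insert_of_notMem hi] at this
      omega
    rw [linearIndepOn_finset_iff] at hdep
    push Not at hdep
    obtain ⟨g, hg, k, hk, hgk⟩ := hdep
    rw [Finset.sum_insert hi] at hg
    have hgi : g i ≠ 0 := fun h0 => by
      rw [h0, zero_smul, zero_add] at hg
      have hS'0 := linearIndepOn_finset_iff.1 (show LinearIndepOn ℤ α S' from hli) g hg
      rcases Finset.mem_insert.1 hk with rfl | hk
      · exact hgk h0
      · exact hgk (hS'0 k hk)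
    have h1 : (g i : ℝ) • toR (α i) = -∑ k ∈ S', (g k : ℝ) • toR (α k) := by
      have := congrArg toR (eq_neg_of_add_eq_zero_left hg)
      rw [toR_smul] at this
      rw [this]
      rw [toR_neg, toR_sum]
      exact congrArg _ (Finset.sum_congr rfl fun k _ => toR_smul _ _)
    have h2 : toR (α i) = (g i : ℝ)⁻¹ • -∑ k ∈ S', (g k : ℝ) • toR (α k) := by
      rw [← h1, smul_smul, inv_mul_cancel₀ (by exact_mod_cast hgi), one_smul]
    rw [h2]
    exact Submodule.smul_mem _ _ (Submodule.neg_mem _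
      (Submodule.sum_mem _ fun k hk => Submodule.smul_mem _ _ (hgen k hk)))
  have htop : Submodule.span ℝ
      ((S'.image fun i => toR (α i) : Finset _) : Set (Fin n → ℝ)) = ⊤ := by
    rw [eq_top_iff, ← hrank, Submodule.span_le]
    rintro _ ⟨i, rfl⟩
    exact hspan i
  have h1 := finrank_span_finset_le_card (R := ℝ) (S'.image fun i => toR (α i))
  rw [Set.finrank, htop, finrank_top, Module.finrank_fin_fun] at h1
  exact h1.trans Finset.card_image_le

theorem exists_basis (hrank : Submodule.span ℝ (Set.range fun i => toR (α i)) = ⊤) :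
    ∃ S : Finset (Fin N), LinearIndependent ℤ (fun i : S => α i) ∧ S.card = n := by
  obtain ⟨S, -, h⟩ := exists_superset_card_eq (S := ∅) hrank
    (linearIndependent_empty_type (ι := (∅ : Finset (Fin N))))
  exact ⟨S, h⟩

variable {φ : Fin n → ℤ}

/-- The cones of the walls have no interior points, so that they are their own boundaries. -/
theorem subset_frontier_of_mem_wallCones {D : Set (Fin n → ℝ)} (hD : D ∈ wallCones α) :
    D ⊆ frontier D := by
  obtain ⟨S, hS, hli, rfl⟩ := hD
  refine fun x hx => ⟨subset_closure hx, fun hxi => ?_⟩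
  have := card_eq_of_nonempty_interior hli ⟨x, hxi⟩
  omega

theorem finite_wallCones : (wallCones α).Finite := by
  refine (Set.finite_range fun S : Finset (Fin N) => coneOver S α).subset ?_
  rintro _ ⟨S, -, -, rfl⟩
  exact ⟨S, rfl⟩

/-- The boundary of a simplicial cone is covered by the cones of the walls. -/
theorem frontier_coneOver_subset (hφ : ∀ i, 0 < φ ⬝ᵥ α i)
    (hrank : Submodule.span ℝ (Set.range fun i => toR (α i)) = ⊤) {S : Finset (Fin N)}
    (hli : LinearIndependent ℤ (fun i : S => α i)) :
    frontier (coneOver S α) ⊆ ⋃ D ∈ wallCones α, frontier D := by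
  classical
  intro x hx
  have hxS : x ∈ coneOver S α :=
    (isClosed_coneOver (φ := φ) fun i _ => hφ i).frontier_subset hx
  suffices h : ∃ T : Finset (Fin N), T.card + 1 = n ∧
      LinearIndependent ℤ (fun i : T => α i) ∧ x ∈ coneOver T α by
    obtain ⟨T, hT, hTli, hxT⟩ := h
    have hD : coneOver T α ∈ wallCones α := ⟨T, hT, hTli, rfl⟩
    exact Set.mem_iUnion₂.2 ⟨_, hD, subset_frontier_of_mem_wallCones hD hxT⟩
  have hsub : ∀ T T' : Finset (Fin N), T ⊆ T' → LinearIndependent ℤ (fun i : T' => α i) →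
      LinearIndependent ℤ (fun i : T => α i) := fun T T' hTT' h =>
    h.comp (fun i : T => (⟨i.1, hTT' i.2⟩ : T')) fun i j hij =>
      Subtype.ext (by simpa using hij)
  have hcard : S.card ≤ n := by simpa using hli.fintype_card_le_finrank
  rcases hcard.eq_or_lt with hcard | hcard
  · -- a boundary point of a full-dimensional simplicial cone lies on one of its facets
    obtain ⟨d, ν, h⟩ := exists_isDualBasis hcard hli
    have hd : (0 : ℝ) < d := by exact_mod_cast h.pos
    have hxν := hxS
    rw [h.coneOver_eq] at hxν
    obtain ⟨i, hi, hxi⟩ : ∃ i ∈ S, toR (ν i) ⬝ᵥ x = 0 := by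
      by_contra! hne
      exact hx.2 (h.subset_interior fun i hi => lt_of_le_of_ne (hxν i hi) (hne i hi).symm)
    have hxT : x ∈ coneOver (S.erase i) α := by
      refine ⟨fun k => if k ∈ S then (d : ℝ)⁻¹ * (toR (ν k) ⬝ᵥ x) else 0, fun k => ?_, ?_⟩
      · dsimp only
        split_ifs with hk
        · exact mul_nonneg (by positivity) (hxν k hk)
        · exact le_rfl
      · have h1 := h.smul_eq_real x
        rw [← Finset.add_sum_erase _ _ hi, hxi, zero_smul, zero_add] at h1
        have h2 : x = (d : ℝ)⁻¹ • (d : ℝ) • x := by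
          rw [smul_smul, inv_mul_cancel₀ hd.ne', one_smul]
        rw [h1, Finset.smul_sum] at h2
        refine h2.trans (Finset.sum_congr rfl fun k hk => ?_)
        dsimp only
        rw [if_pos (Finset.mem_of_mem_erase hk), mul_smul]
    exact ⟨S.erase i, by rw [Finset.card_erase_add_one hi, hcard],
      hsub _ _ (Finset.erase_subset i S) hli, hxT⟩
  · obtain ⟨S', hSS', hli', hcard'⟩ := exists_superset_card_eq hrank hli
    obtain ⟨T, hST, hTS', hT⟩ := Finset.exists_subsuperset_card_eq hSS' (n := n - 1)
      (by omega) (by omega)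
    exact ⟨T, by omega, hsub _ _ hTS' hli', coneOver_mono hST hxS⟩

end Walls

end VPF

theorem mainTheorem2 {n N : ℕ} (α : Fin N → Fin n → ℤ)
    (hne : ∀ i, α i ≠ 0) (hnonneg : ∀ i k, 0 ≤ α i k)
    (hrank : Submodule.span ℝ (Set.range fun i => VPF.toR (α i)) = ⊤) :
    -- (a)
    ((∀ run : ℕ → VPF.PFState n N, run 0 = VPF.initialState n N →
        ∃ k, ¬ VPF.PFStep α (run k) (run (k + 1))) ∧
      (∀ s, VPF.PFReachable α s → ¬ VPF.PFFinished s → ∃ s', VPF.PFStep α s s') ∧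
      ∀ 𝒞, VPF.WallCrossing α Finset.univ 𝒞 → ∀ C ∈ 𝒞,
        ∀ s, VPF.PFReachable α s → VPF.PFFinished s →
          ∀ v ∈ C, (∀ p ∈ s, v ∉ frontier (p.1.cone α)) →
            VPF.chamberExpression α s v ∈ VPF.quasipolynomials n ∧
            ∀ γ : Fin n → ℤ, VPF.toR γ ∈ C →
              (VPF.partitionFunction α γ : ℚ) = VPF.chamberExpression α s v γ) ∧
    -- (b)
    (∀ C ∈ VPF.chambers (VPF.coneOver Finset.univ α) (VPF.wallCones α),
      VPF.IsQuasipolynomialOn (VPF.partitionFunction α) C) ∧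
    -- (c)
    (∀ T : List (VPF.PFTerm n),
      VPF.IsPartialFractionDecomposition (VPF.generatingFunction α) T →
      (∃ φ : Fin n → ℤ, (∀ i, 0 < φ ⬝ᵥ α i) ∧ ∀ t ∈ T, ∀ i, 0 < φ ⬝ᵥ t.vec i) →
      ∀ C ∈ VPF.chambers (VPF.coneOver Finset.univ α) (VPF.coneSupport T),
        VPF.IsQuasipolynomialOn (VPF.partitionFunction α) C) := by
  -- the sum of the coordinates is positive on the given vectors
  have hφ : ∀ i, 0 < (fun _ => 1 : Fin n → ℤ) ⬝ᵥ α i := fun i => by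
    obtain ⟨k, hk⟩ := Function.ne_iff.1 (hne i)
    simp only [dotProduct, one_mul]
    exact Finset.sum_pos' (fun k _ => hnonneg i k)
      ⟨k, Finset.mem_univ k, lt_of_le_of_ne (hnonneg i k) (Ne.symm hk)⟩
  obtain ⟨S, hli, hS⟩ := VPF.exists_basis hrank
  obtain ⟨H, hH⟩ := VPF.exists_isQuasipolynomialOnCells hφ hS hli
  obtain ⟨d, ν, hν⟩ := VPF.exists_isDualBasis hS hli
  have hint : (interior (VPF.coneOver Finset.univ α)).Nonempty :=
    hν.nonempty_interior.mono (interior_mono (VPF.coneOver_mono (Finset.subset_univ S)))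
  refine ⟨⟨fun run h0 => VPF.exists_not_pfStep h0, fun s h hs => h.exists_pfStep hs, ?_⟩, ?_, ?_⟩
  · intro 𝒞 h𝒞 C hC s hs hfin v hv hvs
    have h1 := h𝒞.isAdaptedList hφ
    have hCc := h1.cones C hC
    obtain ⟨q, hq, hqP⟩ := h1.quasi C hC
    rw [VPF.subPartition_univ] at hqP
    have h2 : q = VPF.chamberExpression α s v :=
      (hs.isConicDecomposition hφ hfin).eq_conicSum (fun r hr x hx => hCc.smul_mem hr.le hx) hq
        hqP (hCc.subset_closure_interior hv) hvs
    rw [← h2]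
    exact ⟨hq, hqP⟩
  · rintro _ ⟨x, hx, rfl⟩
    obtain ⟨s, hs, hfin⟩ := VPF.exists_pfFinished α
    refine (hs.isConicDecomposition hφ hfin).isQuasipolynomialOn_chamber hH hint
      (VPF.finite_wallCones.isClosed_biUnion fun D _ => isClosed_frontier) ?_ hx
    intro p hp y hy hyp
    have h1 := hs.isSound p hp
    obtain ⟨f, lab⟩ := p
    obtain rfl : lab = VPF.Label.reduced := hfin _ hp
    exact hy.2 (VPF.frontier_coneOver_subset hφ hrank h1.2 hyp)
  · rintro T ⟨hT, hsum⟩ ⟨φ, hφα, hφT⟩ _ ⟨x, hx, rfl⟩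
    have hfin : (VPF.coneSupport T).Finite := by
      refine (T.finite_toSet.image VPF.PFTerm.cone).subset ?_
      rintro _ ⟨t, ht, rfl⟩
      exact ⟨t, ht, rfl⟩
    have hdec := VPF.isConicDecomposition_partitionFunction (s := (T : Multiset (VPF.PFTerm n)))
      hφα (ι := fun t => Fin t.s) (S := fun _ => Finset.univ)
      (β := fun t i => (t.len i : ℤ) • t.vec i) (m := fun t => t.mult) (num := fun t => t.num)
      (fun t ht i _ => by
        rw [dotProduct_smul, smul_eq_mul]
        exact mul_pos (by exact_mod_cast ((hT t ht).2.2 i).1) (hφT t ht i))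
      (fun t ht => (VPF.linearIndependent_smul_iff fun i => ((hT t ht).2.2 i).1).2
        ((hT t ht).2.1.comp _ Subtype.val_injective))
      (fun t ht i _ => ((hT t ht).2.2 i).2) hsum
    refine hdec.isQuasipolynomialOn_chamber hH hint
      (hfin.isClosed_biUnion fun D _ => isClosed_frontier) ?_ hx
    intro t ht y hy hyt
    refine hy.2 (Set.mem_biUnion (x := t.cone) ⟨t, ht, rfl⟩ ?_)
    rwa [VPF.coneOver_smul fun i _ => ((hT t ht).2.2 i).1] at hyt
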